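/- **Setting.** Let $p$ be a prime, $0\le N<p$, $1\le s<p$. A vector $v\in\mathbb Z_p^N$ is an *index vector* if all its entries are $0$ or $1$, and it is *$s$-sparse* if at most $s$ of its entries are non-zero; $I_v=\{i\in[N]: v_i\ne 0\}$. Let $C\in\mathbb Z_p^{s\times N}$ be the matrix with entries $C_{j,i}=i^j \bmod p$ ($1\le j\le s$, $1\le i\le N$). Let $\mathcal E=(\mathtt{KeyGen},\mathtt{Enc},\mathtt{Dec},\mathtt{Eval})$ be a homomorphic encryption scheme with message space $\mathbb Z_p$ and ciphertext space $\mathcal C$: for every generated key pair, $\mathtt{Dec}$ inverts $\mathtt{Enc}$, and for every arithmetic circuit that $\mathcal E$ supports, decrypting its gate-by-gate homomorphic evaluation on encryptions of messages gives the value of the circuit on these messages. Assume that $\mathcal E$ supports the $s$ linear circuits $x\mapsto\sum_{i=1}^N C_{j,i}x_i$. Write $\mathtt{ctxt}(a)$ for any vector of encryptions of the entries of $a$. For $\Omega\subseteq\mathbb Z_p^N$, a pair $\mathsf{Comp}:\mathcal C^N\to\mathcal C^s$, $\mathsf{Decomp}:\mathcal C^s\to\mathbb Z_p^N$ of algorithms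 ($\mathsf{Comp}$ has the public key, $\mathsf{Decomp}$ has the secret key and may be randomized) is an *$N$-to-$s$ homomorphic compression scheme for $\Omega$ over $\mathcal E$* if $\mathsf{Decomp}(\mathsf{Comp}(\mathtt{ctxt}(a)))=a$ with probability $1$, for all generated keys, all $a\in\Omega$ and all $\mathtt{ctxt}(a)$. **Algorithms.** $\mathsf{CompIdx}$ maps $\mathtt{ctxt}(v)$ to $\mathtt{Eval}(C,\mathtt{ctxt}(v))$, the homomorphic product with $C$. $\mathsf{DecompIdx}$ consists of two steps. * *Step 1.* Decrypt the $s$ input ciphertexts to $w=(w_1,\dots,w_s)$. Put $a_0=1$ and, for $k=1,\dots,s$, $a_k=k^{-1}\sum_{i=1}^{k}(-1)^{i-1}a_{k-i}w_i$; form $f(X)=\sum_{k=0}^s(-1)^ka_kX^{s-k}$; divide $f$ by $X$ as long as $X$ divides it; compute the set $I$ of the zeros in $\mathbb Z_p$ of the resulting polynomial by a zero-finding procedure. * *Step 2.* Return the vector $v\in\mathbb Z_p^N$ with $v_i=1$ if $i \bmod p\in I$ and $v_i=0$ otherwise. **Cost.** Algorithms over $\mathbb Z_p$ are probabilistic algebraic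 computation trees: each addition, subtraction, multiplication, division, loading of a constant, test for zero and choice of a uniformly random element of $\mathbb Z_p$ counts as one operation, and the control flow depends on field elements only through the tests for zero. A zero-finding procedure over $\mathbb Z_p$ is such an algorithm that, for every non-zero polynomial over $\mathbb Z_p$ (of any degree), given by its coefficients, and for all random choices, returns exactly the zeros of the polynomial in $\mathbb Z_p$. **Theorem.** There are an absolute constant $K$ and, for every prime $p$, a zero-finding procedure over $\mathbb Z_p$ such that, with this procedure used in $\mathsf{DecompIdx}$, the following holds for all $p,N,s,\mathcal E$ as above. The pair $(\mathsf{CompIdx},\mathsf{DecompIdx})$ is an $N$-to-$s$ homomorphic compression scheme over $\mathcal E$ for the $s$-sparse index vectors in $\mathbb Z_p^N$. Furthermore: 1. $\mathsf{CompIdx}$ uses at most $K\,N s$ homomorphic additions and multiplications (multiplications by public constants included). 2. On input $\mathsf{CompIdx}(\mathtt{ctxt}(v))$, for every $s$-sparse index vector $v\in\mathbb Z_p^N$ and every $\mathtt{ctxt}(v)$, Step 1 of $\mathsf{DecompIdx}$ uses exactly $s$ decryptions, for all random choices, and an expected number of at most $K\,\bigl(s^2+s\log^2 s\,(\log s+\log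 p)\bigr)$ operations in $\mathbb Z_p$. -/

import Mathlib

open scoped ENNReal

universe u

namespace HomComp

/-! ### Sparse vectors, index vectors and the power matrix -/

/-- The index set of a vector: the positions of its non-zero entries. -/
def indexSet {R : Type} [Ring R] {N : ℕ} (v : Fin N → R) : Set (Fin N) := {i | v i ≠ 0}

/-- A vector is `s`-sparse if it has at most `s` non-zero entries. -/
def IsSparse {R : Type} [Ring R] {N : ℕ} (s : ℕ) (v : Fin N → R) : Prop :=
  (indexSet v).ncard ≤ s

/-- An index vector has all its entries in `{0, 1}`. -/
def IsIndexVector {R : Type} [Ring R] {N : ℕ} (v : Fin N → R) : Prop :=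
  ∀ i, v i = 0 ∨ v i = 1

/-- The `s × N` matrix over `ℤ/p` with entry `i ^ j` in row `j` and column `i`, for `1 ≤ j ≤ s`
and `1 ≤ i ≤ N` (the indices of `Fin` start from `0`). -/
def powerMatrix (p N s : ℕ) : Matrix (Fin s) (Fin N) (ZMod p) :=
  Matrix.of fun j i => (((i : ℕ) + 1 : ℕ) : ZMod p) ^ ((j : ℕ) + 1)

/-! ### Homomorphic encryption -/

/-- Arithmetic circuits over `M` with `n` inputs. -/
inductive Circuit (M : Type) (n : ℕ) : Type
  | input (i : Fin n) : Circuit M n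
  | const (m : M) : Circuit M n
  | add (a b : Circuit M n) : Circuit M n
  | mul (a b : Circuit M n) : Circuit M n
  /-- multiplication by a public constant -/
  | smul (m : M) (a : Circuit M n) : Circuit M n

namespace Circuit

variable {M : Type} {n : ℕ}

/-- The value of a circuit on plain messages. -/
def value [CommRing M] (x : Fin n → M) : Circuit M n → M
  | input i => x i
  | const m => m
  | add a b => value x a + value x b
  | mul a b => value x a * value x b
  | smul m a => m * value x a

/-- The number of additions and multiplications in a circuit (multiplications by constants are
counted too). -/
def gates : Circuit M n → ℕ
  | input _ => 0
  | const _ => 0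
  | add a b => gates a + gates b + 1
  | mul a b => gates a + gates b + 1
  | smul _ a => gates a + 1

/-- The circuit that adds up a list of circuits. -/
def sum [Zero M] : List (Circuit M n) → Circuit M n
  | [] => const 0
  | [a] => a
  | a :: b :: l => add a (sum (b :: l))

/-- The circuit that computes the `j`-th entry of the matrix-vector product `A x`. -/
def matrixRow [Zero M] {m : ℕ} (A : Matrix (Fin m) (Fin n) M) (j : Fin m) : Circuit M n :=
  sum (List.ofFn fun i => smul (A j i) (input i))

end Circuit

/-- The data of a homomorphic encryption scheme with message space `M`: key generation, randomized
encryption, decryption, and the homomorphic operations on ciphertexts. `Supports C` says that the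
circuit `C` is one of those that the scheme is able to evaluate (all circuits for a fully
homomorphic scheme, those of small depth for a leveled one). -/
structure HEData (M : Type) where
  PublicKey : Type u
  SecretKey : Type u
  Ciphertext : Type u
  keyGen : PMF (PublicKey × SecretKey)
  enc : PublicKey → M → PMF Ciphertext
  dec : SecretKey → Ciphertext → M
  homConst : PublicKey → M → Ciphertext
  homAdd : PublicKey → Ciphertext → Ciphertext → Ciphertext
  homMul : PublicKey → Ciphertext → Ciphertext → Ciphertext
  homSMul : PublicKey → M → Ciphertext → Ciphertext
  Supports : {n : ℕ} → Circuit M n → Prop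

/-- Homomorphic evaluation of a circuit, gate by gate. -/
def HEData.eval {M : Type} (E : HEData.{u} M) (pk : E.PublicKey) {n : ℕ}
    (c : Fin n → E.Ciphertext) : Circuit M n → E.Ciphertext
  | .input i => c i
  | .const m => E.homConst pk m
  | .add a b => E.homAdd pk (E.eval pk c a) (E.eval pk c b)
  | .mul a b => E.homMul pk (E.eval pk c a) (E.eval pk c b)
  | .smul m a => E.homSMul pk m (E.eval pk c a)

/-- `c` is a possible vector of encryptions of the messages `a`, under the public key `pk`. -/
def HEData.IsEncryption {M : Type} (E : HEData.{u} M) (pk : E.PublicKey) {n : ℕ}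
    (a : Fin n → M) (c : Fin n → E.Ciphertext) : Prop :=
  ∀ i, c i ∈ (E.enc pk (a i)).support

/-- A homomorphic encryption scheme: decryption inverts encryption, and decrypting the result of
the homomorphic evaluation of a supported circuit on encryptions of messages gives the value of the
circuit on these messages. -/
structure HEScheme (M : Type) [CommRing M] extends HEData.{u} M where
  dec_enc : ∀ pk sk, (pk, sk) ∈ keyGen.support → ∀ m, ∀ c ∈ (enc pk m).support, dec sk c = m
  dec_eval : ∀ pk sk, (pk, sk) ∈ keyGen.support → ∀ (n : ℕ) (C : Circuit M n), Supports C →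
    ∀ (a : Fin n → M) (c : Fin n → Ciphertext), toHEData.IsEncryption pk a c →
      dec sk (toHEData.eval pk c C) = C.value a

/-- `(Comp, Decomp)` is an `N`-to-`s` homomorphic compression scheme for `Ω` over `E`:
decompressing the compression of a ciphertext vector of `a ∈ Ω` returns `a`, whatever the random
choices of the (possibly randomized) decompression. -/
def IsHomCompression {M : Type} [CommRing M] (E : HEScheme.{u} M) (N s : ℕ)
    (Ω : Set (Fin N → M))
    (Comp : E.PublicKey → (Fin N → E.Ciphertext) → (Fin s → E.Ciphertext))
    (Decomp : E.SecretKey → (Fin s → E.Ciphertext) → PMF (Fin N → M)) : Prop :=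
  ∀ pk sk, (pk, sk) ∈ E.keyGen.support → ∀ a ∈ Ω, ∀ c : Fin N → E.Ciphertext,
    E.IsEncryption pk a c → Decomp sk (Comp pk c) = PMF.pure a

/-! ### Algorithms over a finite field, and their number of field operations

A (probabilistic) algebraic computation tree. Field elements live in a memory to which the result
of every operation is appended. The control flow sees the addresses of the elements and the outcomes
of tests for zero, never the elements themselves. -/

/-- The instructions that produce a new field element; arguments are addresses. -/
inductive Instr (F : Type) : Type
  | const (x : F) : Instr F
  | add (i j : ℕ) : Instr F
  | sub (i j : ℕ) : Instr F
  | mul (i j : ℕ) : Instr F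
  | div (i j : ℕ) : Instr F
  /-- a uniformly random field element -/
  | random : Instr F

/-- Algorithms with result of type `α`. After an instruction the algorithm continues with the
address of the new element, after a test for zero with the outcome of the test. -/
inductive Alg (F α : Type) : Type
  | pure (a : α) : Alg F α
  | instr (I : Instr F) (k : ℕ → Alg F α) : Alg F α
  | isZero (i : ℕ) (k : Bool → Alg F α) : Alg F α

/-- The field element at address `i`. -/
def lookup {F : Type} [Zero F] (mem : List F) (i : ℕ) : F := mem.getD i 0

/-- The (distribution of the) field element that an instruction produces. -/
noncomputable def Instr.value {F : Type} [Field F] [Fintype F] (mem : List F) : Instr F → PMF F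
  | const x => PMF.pure x
  | add i j => PMF.pure (lookup mem i + lookup mem j)
  | sub i j => PMF.pure (lookup mem i - lookup mem j)
  | mul i j => PMF.pure (lookup mem i * lookup mem j)
  | div i j => PMF.pure (lookup mem i / lookup mem j)
  | random => PMF.uniformOfFintype F

/-- The outcome of a run: the result, the final memory and the number of field operations. -/
structure Outcome (F α : Type) where
  result : α
  memory : List F
  operations : ℕ

/-- Count one more operation. -/
def Outcome.tick {F α : Type} (r : Outcome F α) : Outcome F α :=
  { r with operations := r.operations + 1 }

namespace Alg

/-- The distribution of the outcome of an algorithm that is started with a given memory. Every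
instruction and every test for zero counts as one operation. -/
noncomputable def run {F α : Type} [Field F] [Fintype F] [DecidableEq F] :
    Alg F α → List F → PMF (Outcome F α)
  | pure a, mem => PMF.pure ⟨a, mem, 0⟩
  | instr I k, mem =>
      (I.value mem).bind fun x => (run (k mem.length) (mem ++ [x])).map Outcome.tick
  | isZero i k, mem => (run (k (decide (lookup mem i = 0))) mem).map Outcome.tick

/-- Sequential composition. -/
def bind {F α β : Type} : Alg F α → (α → Alg F β) → Alg F β
  | pure a, f => f a
  | instr I k, f => instr I fun i => bind (k i) f
  | isZero i k, f => isZero i fun b => bind (k b) f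

instance {F : Type} : Monad (Alg F) where
  pure := Alg.pure
  bind := Alg.bind

end Alg

/-- Execute one instruction and return the address of the new element. -/
def exec {F : Type} (I : Instr F) : Alg F ℕ := .instr I .pure

/-- Test the element at address `i` for zero. -/
def testZero {F : Type} (i : ℕ) : Alg F Bool := .isZero i .pure

/-! ### Reconstruction of the index set from the power sums -/

section Reconst

variable {F : Type} [Field F]

/-- `acc ± (x₁ y₁ - x₂ y₂ + x₃ y₃ - ⋯)`, with the sign `-` if `neg` is true. -/
def altDot : Bool → ℕ → List (ℕ × ℕ) → Alg F ℕ
  | _, acc, [] => pure acc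
  | neg, acc, (x, y) :: l => do
      let t ← exec (.mul x y)
      let acc' ← exec (if neg then .sub acc t else .add acc t)
      altDot (!neg) acc' l

/-- Newton's identities: from the addresses `ws = [w₁, w₂, …]` compute (in this order)
`[a_k, …, a₁, a₀]`, where `a₀ = 1` and `a_k = k⁻¹ ∑_{i=1}^{k} (-1)^(i-1) a_{k-i} w_i`. -/
def newton (ws : List ℕ) : ℕ → Alg F (List ℕ)
  | 0 => do
      let a ← exec (.const 1)
      pure [a]
  | k + 1 => do
      let as ← newton ws k
      let z ← exec (.const 0)
      let t ← altDot false z (as.zip ws)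
      let d ← exec (.const ((k + 1 : ℕ) : F))
      let a ← exec (.div t d)
      pure (a :: as)

/-- From `[a_k, …, a₁, a₀]` compute `[(-1)^k a_k, …, -a₁, a₀]`. -/
def alternate : List ℕ → Alg F (List ℕ)
  | [] => pure []
  | a :: as => do
      let bs ← alternate as
      if Even as.length then
        pure (a :: bs)
      else do
        let z ← exec (.const 0)
        let b ← exec (.sub z a)
        pure (b :: bs)

/-- Divide by `X` as long as possible (coefficients are listed from the constant term on). -/
def stripX : List ℕ → Alg F (List ℕ)
  | [] => pure []
  | c :: cs => do
      let b ← testZero c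
      if b then stripX cs else pure (c :: cs)

/-- The algorithm `ReconstIdx`, for power sums `w₁, …, w_s` at the addresses `0, …, s - 1`:
Newton's identities give the coefficients, from the constant term on, of
`f = ∑_{k=0}^{s} (-1)^k a_k X^(s-k)`; the factors `X` are removed; `findZeros` is applied to the
quotient. -/
def reconstIdx (findZeros : List ℕ → Alg F (List ℕ)) (s : ℕ) : Alg F (List ℕ) := do
  let as ← newton (List.range s) s
  let f ← alternate as
  let g ← stripX f
  findZeros g

/-- The polynomial with coefficients, from the constant term on, at the addresses `cs`. -/
noncomputable def polyAt (mem : List F) : List ℕ → Polynomial F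
  | [] => 0
  | c :: cs => Polynomial.C (lookup mem c) + Polynomial.X * polyAt mem cs

/-- `findZeros` is a zero-finding procedure: started with the addresses of the coefficients of a
non-zero polynomial it always ends with the addresses of the zeros of this polynomial in `F`. -/
def IsZeroFinder [Fintype F] [DecidableEq F] (findZeros : List ℕ → Alg F (List ℕ)) : Prop :=
  ∀ (mem : List F) (cs : List ℕ), (∀ c ∈ cs, c < mem.length) → polyAt mem cs ≠ 0 →
    ∀ r ∈ ((findZeros cs).run mem).support,
      (∀ i ∈ r.result, i < r.memory.length) ∧
        ∀ x : F, x ∈ r.result.map (lookup r.memory) ↔ (polyAt mem cs).IsRoot x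

end Reconst

/-! ### The compression scheme for index vectors -/

/-- `CompIdx`: homomorphic multiplication by the power matrix. -/
def compIdx {p : ℕ} [Fact p.Prime] (E : HEScheme.{u} (ZMod p)) (N s : ℕ) (pk : E.PublicKey)
    (c : Fin N → E.Ciphertext) : Fin s → E.Ciphertext :=
  fun j => E.eval pk c (Circuit.matrixRow (powerMatrix p N s) j)

/-- The number of homomorphic additions and multiplications in `CompIdx`. -/
def compIdxCost (p N s : ℕ) : ℕ :=
  ∑ j : Fin s, (Circuit.matrixRow (powerMatrix p N s) j).gates

/-- Decrypt a list of ciphertexts, one by one, and count the decryptions. -/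
def decryptAll {C M : Type*} (dec : C → M) : List C → List M × ℕ
  | [] => ([], 0)
  | c :: cs => (dec c :: (decryptAll dec cs).1, (decryptAll dec cs).2 + 1)

/-- The result of Step 1 of `DecompIdx`: a list of elements of `ℤ/p` that represents the index set,
with the numbers of decryptions and of operations in `ℤ/p` spent. -/
structure Step1Outcome (p : ℕ) where
  zeros : List (ZMod p)
  decryptions : ℕ
  operations : ℕ

/-- Step 1 of `DecompIdx`: decrypt, then run `ReconstIdx`. -/
noncomputable def decompIdxStep1 {p : ℕ} [Fact p.Prime] (E : HEScheme.{u} (ZMod p)) (s : ℕ)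
    (findZeros : List ℕ → Alg (ZMod p) (List ℕ)) (sk : E.SecretKey)
    (c : Fin s → E.Ciphertext) : PMF (Step1Outcome p) :=
  let w := decryptAll (E.dec sk) (List.ofFn c)
  ((reconstIdx findZeros s).run w.1).map fun r =>
    ⟨r.result.map (lookup r.memory), w.2, r.operations⟩

/-- Step 2 of `DecompIdx`: the index vector of length `N` of the index set given by `zeros`. -/
def indexVectorOf {p : ℕ} (N : ℕ) (zeros : List (ZMod p)) : Fin N → ZMod p :=
  fun i => if (((i : ℕ) + 1 : ℕ) : ZMod p) ∈ zeros then 1 else 0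

/-- `DecompIdx`. -/
noncomputable def decompIdx {p : ℕ} [Fact p.Prime] (E : HEScheme.{u} (ZMod p)) (N s : ℕ)
    (findZeros : List ℕ → Alg (ZMod p) (List ℕ)) (sk : E.SecretKey)
    (c : Fin s → E.Ciphertext) : PMF (Fin N → ZMod p) :=
  (decompIdxStep1 E s findZeros sk c).map fun r => indexVectorOf N r.zeros

/-- The expected number of operations in `ℤ/p`. -/
noncomputable def expectedOperations {p : ℕ} (P : PMF (Step1Outcome p)) : ℝ≥0∞ :=
  ∑' r, P r * (r.operations : ℝ≥0∞)

/-- The set of `s`-sparse index vectors of length `N` over `ℤ/p`. -/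
def sparseIndexVectors (p N s : ℕ) : Set (Fin N → ZMod p) :=
  {v | IsIndexVector v ∧ IsSparse s v}

end HomComp

/-! Compression and correctness. The product with the power matrix encrypts the power sums of the
set A of the positions of the ones. Padding A by s - |A| zeros changes no power sum and gives
exactly s numbers. Newton's identities, which only divide by 1, ..., s < p, therefore recover the
polynomial X^(s-|A|) ∏ (X - α) (`toPoly_alternateList_newtonList`). As N < p, the positions are
distinct and non-zero modulo p, so removing the factors X leaves exactly ∏ (X - α). These steps take
O(s²) operations; everything else concerns the cost of finding its zeros.

Zero finding. A polynomial f of degree d with d distinct non-zero zeros is split by gcd with (X +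
δ)^((p-1)/2) - 1 for a random shift δ: the zeros α with α + δ a non-zero square go to one side. A
given pair of zeros remains together with probability at most 3/4, so the number of unseparated
pairs decreases geometrically on average. With splitting cost O(d² + d log d log p), the quadratic
terms sum geometrically and the other term is paid about log d times (`ecost_findRoots_le`). Below a
fixed recursion depth brute force takes over, so that the program always ends and is always correct;
that depth is reached too rarely to matter.

Splitting cost. The power needs O(log p) multiplications modulo f, and the field need not contain
the roots of unity that a fast Fourier transform uses. There are two regimes (`exists_isSplitter`).
If log p = O(log d), Karatsuba multiplication with Montgomery reduction suffices, since log d ·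
d^(log₂ 3) = O(d²). If log p is large, residues are kept as values on two disjoint point sets u and
v, and one modular multiplication costs one extension of values from u to v and one back. For fibers
of a tower of maps x ↦ x² - c this extension is a Fourier-like recursion. A tower of height k with
2^k of order min(d, log p) leaves dense problems of size about d / 2^k, and the log p
multiplications together cost O(d² + d log d log p) (`exists_isSplitter_of_le_log`).

Existence of the tower. All points of many fibers must be rational, so many translates of a set of
up to about (log p)/16 elements must consist of non-zero squares. This follows from a one-sided
bound for sums of quadratic characters of products of distinct linear factors, which is proved by
Stepanov's method (`card_pow_eq_mul_le`): an auxiliary polynomial of small degree vanishes to high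
order at every point where the character has a given value. -/

set_option linter.unusedSectionVars false

namespace HomComp

/-! ### Properties of all outcomes of a program, and its expected cost -/

namespace Alg

variable {F α β : Type} [Field F] [Fintype F] [DecidableEq F]

/-- Every possible outcome of a run satisfies `Q` (result, final memory, number of operations). -/
def Holds : Alg F α → List F → (α → List F → ℕ → Prop) → Prop
  | pure a, mem, Q => Q a mem 0
  | instr I k, mem, Q =>
      ∀ x ∈ (I.value mem).support,
        Holds (k mem.length) (mem ++ [x]) fun a m t => Q a m (t + 1)
  | isZero i k, mem, Q =>
      Holds (k (decide (lookup mem i = 0))) mem fun a m t => Q a m (t + 1)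

theorem Holds.mono {p : Alg F α} : ∀ {mem : List F} {Q R : α → List F → ℕ → Prop},
    Holds p mem Q → (∀ a m t, mem <+: m → Q a m t → R a m t) → Holds p mem R := by
  induction p with
  | pure a => intro mem Q R h hQR; exact hQR _ _ _ (List.prefix_refl _) h
  | instr I k ih =>
    intro mem Q R h hQR x hx
    exact ih _ (h x hx) fun a m t hm => hQR a m (t + 1) ((List.prefix_append _ _).trans hm)
  | isZero i k ih =>
    intro mem Q R h hQR
    exact ih _ h fun a m t hm => hQR a m (t + 1) hm

theorem holds_pure {a : α} {mem : List F} {Q : α → List F → ℕ → Prop} (h : Q a mem 0) :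
    Holds (Pure.pure a : Alg F α) mem Q := h

theorem Holds.bind {p : Alg F α} {f : α → Alg F β} : ∀ {mem : List F}
    {Q : α → List F → ℕ → Prop} {R : β → List F → ℕ → Prop},
    Holds p mem Q →
    (∀ a m t, mem <+: m → Q a m t → Holds (f a) m fun b m' t' => R b m' (t + t')) →
    Holds (p >>= f) mem R := by
  induction p with
  | pure a =>
    intro mem Q R h hf
    have := hf _ _ _ (List.prefix_refl _) h
    simp only [Nat.zero_add] at this
    exact this
  | instr I k ih =>
    intro mem Q R h hf x hx
    refine ih _ (h x hx) fun a m t hm hQ => ?_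
    refine (hf a m (t + 1) ((List.prefix_append _ _).trans hm) hQ).mono fun b m' t' _ hR => ?_
    rwa [Nat.add_right_comm]
  | isZero i k ih =>
    intro mem Q R h hf
    refine ih _ h fun a m t hm hQ => ?_
    refine (hf a m (t + 1) hm hQ).mono fun b m' t' _ hR => ?_
    rwa [Nat.add_right_comm]

theorem Holds.of_mem_support {p : Alg F α} : ∀ {mem : List F} {Q : α → List F → ℕ → Prop},
    Holds p mem Q → ∀ r ∈ (p.run mem).support, Q r.result r.memory r.operations := by
  induction p with
  | pure a =>
    intro mem Q h r hr
    simp only [run, PMF.support_pure, Set.mem_singleton_iff] at hr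
    subst hr; exact h
  | instr I k ih =>
    intro mem Q h r hr
    simp only [run, PMF.mem_support_bind_iff, PMF.mem_support_map_iff] at hr
    obtain ⟨x, hx, r', hr', rfl⟩ := hr
    exact ih _ (h x hx) r' hr'
  | isZero i k ih =>
    intro mem Q h r hr
    simp only [run, PMF.mem_support_map_iff] at hr
    obtain ⟨r', hr', rfl⟩ := hr
    exact ih _ h r' hr'

/-- The expected number of operations. -/
noncomputable def ecost : Alg F α → List F → ℝ≥0∞
  | pure _, _ => 0
  | instr I k, mem => 1 + ∑' x, I.value mem x * ecost (k mem.length) (mem ++ [x])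
  | isZero i k, mem => 1 + ecost (k (decide (lookup mem i = 0))) mem

theorem tsum_bind_mul {γ δ : Type*} (P : PMF γ) (f : γ → PMF δ) (g : δ → ℝ≥0∞) :
    ∑' b, (P.bind f) b * g b = ∑' a, P a * ∑' b, f a b * g b := by
  simp only [PMF.bind_apply, ← ENNReal.tsum_mul_right, ← ENNReal.tsum_mul_left]
  rw [ENNReal.tsum_comm]
  simp only [mul_assoc]

theorem tsum_pure_mul {γ : Type*} (a : γ) (g : γ → ℝ≥0∞) :
    ∑' b, (PMF.pure a) b * g b = g a := by
  classical
  rw [tsum_eq_single a]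
  · simp
  · intro b hb; simp [hb]

theorem tsum_map_mul {γ δ : Type*} (P : PMF γ) (f : γ → δ) (g : δ → ℝ≥0∞) :
    ∑' b, (P.map f) b * g b = ∑' a, P a * g (f a) := by
  rw [PMF.map, tsum_bind_mul]
  simp only [Function.comp, tsum_pure_mul]

theorem tsum_run_operations (p : Alg F α) : ∀ mem : List F,
    ∑' r, (p.run mem) r * (r.operations : ℝ≥0∞) = p.ecost mem := by
  induction p with
  | pure a => intro mem; simp only [run, tsum_pure_mul, ecost, Nat.cast_zero]
  | instr I k ih =>
    intro mem
    simp only [run, tsum_bind_mul, tsum_map_mul, ecost, Outcome.tick, Nat.cast_add, Nat.cast_one,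
      mul_add, mul_one, ENNReal.tsum_add, ih, PMF.tsum_coe]
    rw [add_comm]
  | isZero i k ih =>
    intro mem
    simp only [run, tsum_map_mul, ecost, Outcome.tick, Nat.cast_add, Nat.cast_one,
      mul_add, mul_one, ENNReal.tsum_add, ih, PMF.tsum_coe]
    rw [add_comm]

theorem Holds.ecost_le {p : Alg F α} {mem : List F} {B : ℝ≥0∞}
    (h : Holds p mem fun _ _ t => (t : ℝ≥0∞) ≤ B) : p.ecost mem ≤ B := by
  rw [← tsum_run_operations]
  calc _ ≤ ∑' r, (p.run mem) r * B := by
        refine ENNReal.tsum_le_tsum fun r => ?_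
        by_cases hr : r ∈ (p.run mem).support
        · gcongr; exact h.of_mem_support r hr
        · rw [PMF.mem_support_iff, not_not] at hr; simp [hr]
    _ = B := by rw [ENNReal.tsum_mul_right, PMF.tsum_coe, one_mul]

end Alg

/-! ### Lists of field elements in a memory that only grows -/

section Rep

variable {F : Type}

/-- The addresses in the list `l` hold the field elements in the list `xs`. -/
def Rep (mem : List F) (l : List ℕ) (xs : List F) : Prop :=
  List.Forall₂ (fun i x => mem[i]? = some x) l xs

theorem Rep.mono {mem m : List F} {l : List ℕ} {xs : List F} (h : Rep mem l xs)
    (hm : mem <+: m) : Rep m l xs := by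
  refine List.Forall₂.imp (fun i x hx => ?_) h
  obtain ⟨t, rfl⟩ := hm
  rw [List.getElem?_append_left (List.getElem?_eq_some_iff.1 hx).1, hx]

theorem Rep.length_eq {mem : List F} {l : List ℕ} {xs : List F} (h : Rep mem l xs) :
    l.length = xs.length := List.Forall₂.length_eq h

theorem Rep.nil {mem : List F} : Rep mem [] [] := List.Forall₂.nil

theorem Rep.cons {mem : List F} {i : ℕ} {x : F} {l : List ℕ} {xs : List F}
    (hi : mem[i]? = some x) (h : Rep mem l xs) : Rep mem (i :: l) (x :: xs) :=
  List.Forall₂.cons hi h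

theorem Rep.append {mem : List F} {l l' : List ℕ} {xs xs' : List F}
    (h : Rep mem l xs) (h' : Rep mem l' xs') : Rep mem (l ++ l') (xs ++ xs') :=
  List.rel_append h h'

theorem Rep.reverse {mem : List F} {l : List ℕ} {xs : List F}
    (h : Rep mem l xs) : Rep mem l.reverse xs.reverse :=
  List.rel_reverse h

theorem Rep.take {mem : List F} {l : List ℕ} {xs : List F}
    (h : Rep mem l xs) (n : ℕ) : Rep mem (l.take n) (xs.take n) :=
  List.forall₂_take n h

theorem Rep.drop {mem : List F} {l : List ℕ} {xs : List F}
    (h : Rep mem l xs) (n : ℕ) : Rep mem (l.drop n) (xs.drop n) :=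
  List.forall₂_drop n h

theorem Rep.replicate {mem : List F} {i : ℕ} {x : F} (n : ℕ)
    (hi : mem[i]? = some x) : Rep mem (List.replicate n i) (List.replicate n x) := by
  induction n with
  | zero => exact Rep.nil
  | succ n ih => exact Rep.cons hi ih

theorem getElem?_mono {mem m : List F} {i : ℕ} {x : F} (h : mem[i]? = some x)
    (hm : mem <+: m) : m[i]? = some x := by
  obtain ⟨t, rfl⟩ := hm
  rw [List.getElem?_append_left (List.getElem?_eq_some_iff.1 h).1, h]

theorem lookup_of_getElem? [Zero F] {mem : List F} {i : ℕ} {x : F} (h : mem[i]? = some x) :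
    lookup mem i = x := by
  simp [lookup, List.getD, h]

theorem Rep.map_lookup [Zero F] {mem : List F} {l : List ℕ} {xs : List F} (h : Rep mem l xs) :
    l.map (lookup mem) = xs := by
  induction h with
  | nil => rfl
  | cons hi _ ih => simp [lookup_of_getElem? hi, ih]

theorem Rep.lt_length {mem : List F} {l : List ℕ} {xs : List F} (h : Rep mem l xs) :
    ∀ i ∈ l, i < mem.length := by
  induction h with
  | nil => simp
  | cons hi _ ih =>
    intro i hi'
    rcases List.mem_cons.1 hi' with rfl | h'
    · exact (List.getElem?_eq_some_iff.1 hi).1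
    · exact ih i h'

theorem Rep.of_lt_length [Zero F] {mem : List F} {l : List ℕ} (h : ∀ i ∈ l, i < mem.length) :
    Rep mem l (l.map (lookup mem)) := by
  induction l with
  | nil => exact Rep.nil
  | cons i l ih =>
    refine Rep.cons ?_ (ih fun j hj => h j (List.mem_cons_of_mem _ hj))
    have hi := h i List.mem_cons_self
    simp [lookup, List.getD, hi]

end Rep

/-! ### Single instructions -/

section Exec

variable {F : Type} [Field F] [Fintype F] [DecidableEq F]

theorem getElem?_append_length (mem : List F) (x : F) : (mem ++ [x])[mem.length]? = some x := by
  simp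

theorem holds_exec {I : Instr F} {mem : List F} {x : F} (h : I.value mem = PMF.pure x) :
    (exec I).Holds mem fun a m t => m[a]? = some x ∧ t = 1 := by
  intro y hy
  rw [h, PMF.support_pure, Set.mem_singleton_iff] at hy
  subst hy
  exact ⟨getElem?_append_length _ _, rfl⟩

theorem holds_const (x : F) (mem : List F) :
    (exec (.const x)).Holds mem fun a m t => m[a]? = some x ∧ t = 1 :=
  holds_exec rfl

theorem holds_add {mem : List F} {i j : ℕ} {x y : F} (hi : mem[i]? = some x)
    (hj : mem[j]? = some y) :
    (exec (.add i j)).Holds mem fun a m t => m[a]? = some (x + y) ∧ t = 1 :=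
  holds_exec (by simp only [Instr.value, lookup_of_getElem? hi, lookup_of_getElem? hj])

theorem holds_sub {mem : List F} {i j : ℕ} {x y : F} (hi : mem[i]? = some x)
    (hj : mem[j]? = some y) :
    (exec (.sub i j)).Holds mem fun a m t => m[a]? = some (x - y) ∧ t = 1 :=
  holds_exec (by simp only [Instr.value, lookup_of_getElem? hi, lookup_of_getElem? hj])

theorem holds_mul {mem : List F} {i j : ℕ} {x y : F} (hi : mem[i]? = some x)
    (hj : mem[j]? = some y) :
    (exec (.mul i j)).Holds mem fun a m t => m[a]? = some (x * y) ∧ t = 1 :=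
  holds_exec (by simp only [Instr.value, lookup_of_getElem? hi, lookup_of_getElem? hj])

theorem holds_div {mem : List F} {i j : ℕ} {x y : F} (hi : mem[i]? = some x)
    (hj : mem[j]? = some y) :
    (exec (.div i j)).Holds mem fun a m t => m[a]? = some (x / y) ∧ t = 1 :=
  holds_exec (by simp only [Instr.value, lookup_of_getElem? hi, lookup_of_getElem? hj])

theorem holds_testZero {mem : List F} {i : ℕ} {x : F} (hi : mem[i]? = some x) :
    (testZero i : Alg F Bool).Holds mem fun b m t => b = decide (x = 0) ∧ m = mem ∧ t = 1 := by
  simp only [testZero, Alg.Holds, lookup_of_getElem? hi]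
  simp

end Exec

/-! ### Stepanov's method for the equation f(x)^((p-1)/2) = a -/

section Stepanov

open Polynomial

variable {p : ℕ} [Fact p.Prime]

/-- The operator `r ↦ e f' r + f r'`, which describes the derivative of `f ^ e * r`. -/
noncomputable def twistedDerivative (f : (ZMod p)[X]) (e : ℕ) : (ZMod p)[X] →ₗ[ZMod p] (ZMod p)[X] :=
  LinearMap.mulLeft (ZMod p) ((e : (ZMod p)[X]) * derivative f) +
    LinearMap.mulLeft (ZMod p) f ∘ₗ derivative

/-- The iterates of `twistedDerivative`, with decreasing exponents. -/
noncomputable def iterTwistedDerivative (f : (ZMod p)[X]) (e : ℕ) :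
    ℕ → (ZMod p)[X] →ₗ[ZMod p] (ZMod p)[X]
  | 0 => LinearMap.id
  | k + 1 => twistedDerivative f (e - k) ∘ₗ iterTwistedDerivative f e k

/-- Powers of X^p have derivative zero and act as constants. Hence each derivative costs one factor
f and otherwise only raises the degree of the cofactor r by at most deg f. -/
theorem derivative_pow_mul_mul_X_pow (f r : (ZMod p)[X]) (e j : ℕ) :
    derivative (f ^ (e + 1) * r * X ^ (p * j)) =
      f ^ e * twistedDerivative f (e + 1) r * X ^ (p * j) := by
  have : derivative (X ^ (p * j) : (ZMod p)[X]) = 0 := by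
    rw [derivative_X_pow]; simp
  rw [derivative_mul, this, mul_zero, add_zero, derivative_mul, derivative_pow_succ]
  simp only [twistedDerivative, LinearMap.add_apply, LinearMap.mulLeft_apply, LinearMap.comp_apply]
  simp
  ring

theorem iterate_derivative_pow_mul_mul_X_pow (f r : (ZMod p)[X]) (e j k : ℕ) (hk : k ≤ e) :
    derivative^[k] (f ^ e * r * X ^ (p * j)) =
      f ^ (e - k) * iterTwistedDerivative f e k r * X ^ (p * j) := by
  induction k with
  | zero => simp [iterTwistedDerivative]
  | succ k ih =>
    rw [Function.iterate_succ_apply', ih (by omega)]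
    obtain ⟨d, hd⟩ : ∃ d, e - k = d + 1 := ⟨e - k - 1, by omega⟩
    rw [hd, derivative_pow_mul_mul_X_pow]
    simp only [iterTwistedDerivative, LinearMap.comp_apply, hd]
    congr 3; omega

theorem natDegree_twistedDerivative_le (f r : (ZMod p)[X]) (e : ℕ) :
    (twistedDerivative f e r).natDegree ≤ r.natDegree + f.natDegree := by
  simp only [twistedDerivative, LinearMap.add_apply, LinearMap.mulLeft_apply, LinearMap.comp_apply]
  refine (natDegree_add_le _ _).trans (max_le ?_ ?_)
  · refine natDegree_mul_le.trans ?_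
    have h1 : ((e : (ZMod p)[X]) * derivative f).natDegree ≤ f.natDegree := by
      refine natDegree_mul_le.trans ?_
      rw [natDegree_natCast, zero_add]
      exact (natDegree_derivative_le f).trans (Nat.sub_le _ _)
    omega
  · refine natDegree_mul_le.trans ?_
    have := (natDegree_derivative_le r).trans (Nat.sub_le _ _)
    omega

theorem natDegree_iterTwistedDerivative_le (f r : (ZMod p)[X]) (e k : ℕ) :
    (iterTwistedDerivative f e k r).natDegree ≤ r.natDegree + k * f.natDegree := by
  induction k with
  | zero => simp [iterTwistedDerivative]
  | succ k ih =>
    simp only [iterTwistedDerivative, LinearMap.comp_apply]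
    refine (natDegree_twistedDerivative_le _ _ _).trans ?_
    rw [Nat.succ_mul]; omega

theorem finrank_degreeLT (c : ℕ) : Module.finrank (ZMod p) (degreeLT (ZMod p) c) = c := by
  rw [(degreeLTEquiv (ZMod p) c).finrank_eq]; simp

instance (c : ℕ) : Module.Finite (ZMod p) (degreeLT (ZMod p) c) :=
  Module.Finite.equiv (degreeLTEquiv (ZMod p) c).symm

theorem natDegree_lt_of_mem_degreeLT {c : ℕ} (hc : 0 < c) {r : (ZMod p)[X]}
    (h : r ∈ degreeLT (ZMod p) c) : r.natDegree < c := by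
  by_cases h0 : r = 0
  · simpa [h0] using hc
  · rw [mem_degreeLT] at h; exact (natDegree_lt_iff_degree_lt h0).2 h

/-- At the simple zero β of f the left side has odd multiplicity and the right side even
multiplicity, unless both vanish identically. -/
theorem sq_mul_ne_of_squarefree_root {f r s : (ZMod p)[X]} {β a : ZMod p} (ha : a ≠ 0)
    (hβ : f.rootMultiplicity β = 1) (h : r ^ 2 * f = C a * s ^ 2) : r = 0 ∧ s = 0 := by
  have hf : f ≠ 0 := by rintro rfl; simp at hβ
  by_cases hr : r = 0
  · subst hr
    refine ⟨rfl, ?_⟩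
    have : C a * s ^ 2 = 0 := by rw [← h]; ring
    simpa [ha] using this
  · exfalso
    have hL : r ^ 2 * f ≠ 0 := mul_ne_zero (pow_ne_zero _ hr) hf
    have hs : s ≠ 0 := by
      rintro rfl
      apply hL; rw [h]; ring
    have h1 := congrArg (rootMultiplicity β) h
    rw [rootMultiplicity_mul hL, rootMultiplicity_mul (by rw [← h]; exact hL), rootMultiplicity_C,
      pow_two, pow_two, rootMultiplicity_mul (mul_ne_zero hr hr),
      rootMultiplicity_mul (mul_ne_zero hs hs), hβ] at h1
    omega

/-- Over the prime field f^p = f(X^p), which is constant modulo X^p. -/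
theorem X_pow_dvd_expand_sub (f : (ZMod p)[X]) : (X : (ZMod p)[X]) ^ p ∣ f ^ p - C (f.coeff 0) := by
  rw [X_pow_dvd_iff, ← ZMod.expand_card]
  intro d hd
  rw [coeff_sub, coeff_expand (Fact.out : p.Prime).pos, coeff_C]
  by_cases h0 : d = 0
  · subst h0; simp
  · rw [if_neg, if_neg h0, sub_zero]
    exact fun h => absurd (Nat.le_of_dvd (by omega) h) (by omega)

/-- Multiplying by the conjugate r - s f^((p-1)/2) and by f replaces the high power of f by f^p,
that is, by f(0) modulo X^p. What remains has degree below p, so the congruence is an equality,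
which the parity of multiplicities excludes. -/
theorem eq_zero_of_X_pow_dvd {f r s : (ZMod p)[X]} {β : ZMod p} (hodd : p ≠ 2)
    (hβ : f.rootMultiplicity β = 1) (h0 : f.coeff 0 ≠ 0) {c : ℕ} (hc0 : 0 < c)
    (hc : 2 * c + f.natDegree ≤ p)
    (hr : r ∈ degreeLT (ZMod p) c) (hs : s ∈ degreeLT (ZMod p) c)
    (h : X ^ p ∣ r + s * f ^ ((p - 1) / 2)) : r = 0 ∧ s = 0 := by
  have hp : p.Prime := Fact.out
  have hp2 : 2 * ((p - 1) / 2) + 1 = p := by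
    have := hp.eq_two_or_odd; omega
  have h1 : X ^ p ∣ r ^ 2 * f - C (f.coeff 0) * s ^ 2 := by
    have e : r ^ 2 * f - C (f.coeff 0) * s ^ 2 =
        (r + s * f ^ ((p - 1) / 2)) * ((r - s * f ^ ((p - 1) / 2)) * f) +
          (f ^ p - C (f.coeff 0)) * s ^ 2 := by
      conv_rhs => enter [2, 1, 1, 2]; rw [← hp2]
      ring
    rw [e]
    exact dvd_add (h.mul_right _) ((X_pow_dvd_expand_sub f).mul_right _)
  have hr' := natDegree_lt_of_mem_degreeLT hc0 hr
  have hs' := natDegree_lt_of_mem_degreeLT hc0 hs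
  have hdeg : (r ^ 2 * f - C (f.coeff 0) * s ^ 2).natDegree < p := by
    refine lt_of_le_of_lt (natDegree_sub_le _ _) (max_lt ?_ ?_)
    · refine lt_of_le_of_lt natDegree_mul_le ?_
      have := natDegree_pow_le (p := r) (n := 2)
      omega
    · refine lt_of_le_of_lt natDegree_mul_le ?_
      have := natDegree_pow_le (p := s) (n := 2)
      rw [natDegree_C]; omega
  have h2 : r ^ 2 * f - C (f.coeff 0) * s ^ 2 = 0 := by
    by_contra hne
    have := natDegree_le_of_dvd h1 hne
    rw [natDegree_X_pow] at this
    omega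
  exact sq_mul_ne_of_squarefree_root h0 hβ (sub_eq_zero.1 h2)

/-- This makes the auxiliary polynomial of Stepanov's method non-zero. The coefficient pairs vanish
one after the other: modulo X^p only the term j = 0 remains, and then X^p can be cancelled. -/
theorem eq_zero_of_sum_mul_X_pow_eq_zero {f : (ZMod p)[X]} {β : ZMod p} (hodd : p ≠ 2)
    (hβ : f.rootMultiplicity β = 1) (h0 : f.coeff 0 ≠ 0) {c : ℕ} (hc0 : 0 < c)
    (hc : 2 * c + f.natDegree ≤ p) : ∀ (J : ℕ) (r s : ℕ → (ZMod p)[X]),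
    (∀ j, r j ∈ degreeLT (ZMod p) c) → (∀ j, s j ∈ degreeLT (ZMod p) c) →
    (∑ j ∈ Finset.range J, (r j + s j * f ^ ((p - 1) / 2)) * X ^ (p * j) = 0) →
    ∀ j < J, r j = 0 ∧ s j = 0 := by
  intro J
  induction J with
  | zero => intro r s _ _ _ j hj; omega
  | succ J ih =>
    intro r s hr hs h
    rw [Finset.sum_range_succ'] at h
    have e : ∑ k ∈ Finset.range J, (r (k + 1) + s (k + 1) * f ^ ((p - 1) / 2)) * X ^ (p * (k + 1)) =
        X ^ p * ∑ k ∈ Finset.range J, (r (k + 1) + s (k + 1) * f ^ ((p - 1) / 2)) * X ^ (p * k) := by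
      rw [Finset.mul_sum]
      refine Finset.sum_congr rfl fun k _ => ?_
      ring
    rw [e, mul_zero, pow_zero, mul_one] at h
    have hd : X ^ p ∣ r 0 + s 0 * f ^ ((p - 1) / 2) := by
      rw [eq_neg_of_add_eq_zero_right h]
      exact (dvd_mul_right _ _).neg_right
    obtain ⟨hr0, hs0⟩ := eq_zero_of_X_pow_dvd hodd hβ h0 hc0 hc (hr 0) (hs 0) hd
    rw [hr0, hs0, zero_mul, add_zero, add_zero] at h
    have h' := (mul_eq_zero.1 h).resolve_left (pow_ne_zero _ X_ne_zero)
    have := ih (fun k => r (k + 1)) (fun k => s (k + 1)) (fun k => hr _) (fun k => hs _) h'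
    intro j hj
    rcases j with _ | j
    · exact ⟨hr0, hs0⟩
    · exact this j (by omega)

/-- The number of points where `f ^ ((p - 1) / 2)` takes a given non-zero value `a`. -/
theorem card_pow_eq_mul_le {f : (ZMod p)[X]} {β : ZMod p} (hodd : p ≠ 2)
    (hβ : f.rootMultiplicity β = 1) (h0 : f.coeff 0 ≠ 0) {c l J : ℕ} (hc0 : 0 < c) (hJ : 0 < J)
    (hc : 2 * c + f.natDegree ≤ p) (hl : l < p)
    (hdim : l * (c + l * f.natDegree + J) < 2 * (J * c)) (a : ZMod p) :
    l * (Finset.univ.filter fun x : ZMod p => (f.eval x) ^ ((p - 1) / 2) = a).card ≤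
      l * f.natDegree + c + (p - 1) / 2 * f.natDegree + (J - 1) * p := by
  have hp : p.Prime := Fact.out
  set N := (p - 1) / 2 with hN
  have hN0 : 0 < N := by have := hp.two_le; have := hp.eq_two_or_odd; omega
  -- D exceeds the degree of each reduced derivative `Q k`; its vanishing for all k < l is l * D
  -- linear conditions on the 2 * J * c coefficients of the r_j and s_j.
  set D := c + l * f.natDegree + J with hD
  have hf : f ≠ 0 := by rintro rfl; simp at hβ
  let V := (Fin J → degreeLT (ZMod p) c) × (Fin J → degreeLT (ZMod p) c)
  let pr : Fin J → V →ₗ[ZMod p] (ZMod p)[X] := fun j =>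
    (degreeLT (ZMod p) c).subtype ∘ₗ LinearMap.proj j ∘ₗ LinearMap.fst _ _ _
  let ps : Fin J → V →ₗ[ZMod p] (ZMod p)[X] := fun j =>
    (degreeLT (ZMod p) c).subtype ∘ₗ LinearMap.proj j ∘ₗ LinearMap.snd _ _ _
  -- At the points to be counted, X^p may be replaced by X and f^N by a. After the factor f^(l-k) is
  -- taken out, this turns the k-th derivative of the auxiliary polynomial into the low-degree
  -- polynomial `Q k`.
  let Q : ℕ → V →ₗ[ZMod p] (ZMod p)[X] := fun k => ∑ j : Fin J,
    LinearMap.mulLeft (ZMod p) (X ^ (j : ℕ)) ∘ₗ (iterTwistedDerivative f l k ∘ₗ pr j +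
      a • (iterTwistedDerivative f (l + N) k ∘ₗ ps j))
  let Λ : V →ₗ[ZMod p] (Fin l → Fin D → ZMod p) :=
    LinearMap.pi fun k => LinearMap.pi fun i => lcoeff (ZMod p) (i : ℕ) ∘ₗ Q k
  have hker : LinearMap.ker Λ ≠ ⊥ := by
    apply LinearMap.ker_ne_bot_of_finrank_lt
    simp only [V, Module.finrank_prod, Module.finrank_pi_fintype, finrank_degreeLT,
      Module.finrank_self, Finset.sum_const, Finset.card_univ, Fintype.card_fin, smul_eq_mul,
      mul_one]
    linarith
  obtain ⟨v, hv, hv0⟩ := (Submodule.ne_bot_iff _).1 hker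
  have hprdeg : ∀ j, (pr j v).natDegree < c := fun j =>
    natDegree_lt_of_mem_degreeLT hc0 (v.1 j).2
  have hpsdeg : ∀ j, (ps j v).natDegree < c := fun j =>
    natDegree_lt_of_mem_degreeLT hc0 (v.2 j).2
  have hQ0 : ∀ k < l, Q k v = 0 := by
    intro k hk
    have hdeg : (Q k v).natDegree < D := by
      simp only [Q, LinearMap.sum_apply]
      refine lt_of_le_of_lt (natDegree_sum_le_of_forall_le (n := D - 1) _ _ fun j _ => ?_) (by omega)
      simp only [LinearMap.comp_apply, LinearMap.mulLeft_apply, LinearMap.add_apply,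
        LinearMap.smul_apply]
      refine natDegree_mul_le.trans ?_
      rw [natDegree_X_pow]
      have h1 := natDegree_iterTwistedDerivative_le f (pr j v) l k
      have h2 := natDegree_iterTwistedDerivative_le f (ps j v) (l + N) k
      have h3 := natDegree_smul_le a (iterTwistedDerivative f (l + N) k (ps j v))
      have h4 := natDegree_add_le (iterTwistedDerivative f l k (pr j v))
        (a • iterTwistedDerivative f (l + N) k (ps j v))
      have h5 := hprdeg j
      have h6 := hpsdeg j
      have h7 : k * f.natDegree ≤ l * f.natDegree := Nat.mul_le_mul_right _ hk.le
      have h8 := j.2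
      have h9 : max (iterTwistedDerivative f l k (pr j v)).natDegree
        (a • iterTwistedDerivative f (l + N) k (ps j v)).natDegree ≤ c - 1 + l * f.natDegree :=
        max_le (by omega) (by omega)
      omega
    ext i
    by_cases hi : i < D
    · have := congrFun (congrFun (LinearMap.mem_ker.1 hv) ⟨k, hk⟩) ⟨i, hi⟩
      simpa [Λ] using this
    · rw [coeff_eq_zero_of_natDegree_lt (by omega), coeff_zero]
  -- The auxiliary polynomial f^l ∑ (r_j + s_j f^N) X^(pj); the factor f^l leaves room for l
  -- derivatives.
  let R : (ZMod p)[X] := ∑ j : Fin J, (f ^ l * pr j v * X ^ (p * (j : ℕ)) +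
    f ^ (l + N) * ps j v * X ^ (p * (j : ℕ)))
  have hRne : R ≠ 0 := by
    intro hR
    have hR' : f ^ l * ∑ j ∈ Finset.range J, ((if h : j < J then pr ⟨j, h⟩ v else 0) +
        (if h : j < J then ps ⟨j, h⟩ v else 0) * f ^ N) * X ^ (p * j) = 0 := by
      rw [← hR, Finset.sum_range, Finset.mul_sum]
      refine Finset.sum_congr rfl fun j _ => ?_
      simp only [Fin.is_lt, dif_pos]
      ring
    have hS := (mul_eq_zero.1 hR').resolve_left (pow_ne_zero _ hf)
    have hz := eq_zero_of_sum_mul_X_pow_eq_zero hodd hβ h0 hc0 hc J _ _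
      (fun j => by
        by_cases h : j < J
        · simp only [h, dif_pos]; exact (v.1 ⟨j, h⟩).2
        · simp only [h, dif_neg, not_false_iff]; exact Submodule.zero_mem _)
      (fun j => by
        by_cases h : j < J
        · simp only [h, dif_pos]; exact (v.2 ⟨j, h⟩).2
        · simp only [h, dif_neg, not_false_iff]; exact Submodule.zero_mem _) hS
    apply hv0
    refine Prod.ext (funext fun j => Subtype.ext ?_) (funext fun j => Subtype.ext ?_)
    · have h : pr j v = 0 := by simpa only [Fin.is_lt, dif_pos] using (hz j j.2).1
      exact h
    · have h : ps j v = 0 := by simpa only [Fin.is_lt, dif_pos] using (hz j j.2).2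
      exact h
  have hRdeg : R.natDegree ≤ l * f.natDegree + c + N * f.natDegree + (J - 1) * p := by
    refine natDegree_sum_le_of_forall_le _ _ fun j _ => ?_
    have h5 := hprdeg j
    have h6 := hpsdeg j
    have hj : p * (j : ℕ) ≤ (J - 1) * p := by
      rw [mul_comm]; exact Nat.mul_le_mul_right _ (by have := j.2; omega)
    refine (natDegree_add_le _ _).trans (max_le ?_ ?_)
    · refine natDegree_mul_le.trans ?_
      rw [natDegree_X_pow]
      have h1 := natDegree_mul_le (p := f ^ l) (q := pr j v)
      have h2 := natDegree_pow_le (p := f) (n := l)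
      omega
    · refine natDegree_mul_le.trans ?_
      rw [natDegree_X_pow]
      have h1 := natDegree_mul_le (p := f ^ (l + N)) (q := ps j v)
      have h2 := natDegree_pow_le (p := f) (n := l + N)
      rw [add_mul] at h2
      omega
  have hroot : ∀ x : ZMod p, (f.eval x) ^ N = a → l ≤ R.rootMultiplicity x := by
    intro x hx
    by_cases hl0 : l = 0
    · omega
    obtain ⟨l', rfl⟩ : ∃ l', l = l' + 1 := ⟨l - 1, by omega⟩
    -- Vanishing derivatives detect the multiplicity l because l < p makes (l - 1)! invertible.
    refine Nat.succ_le_of_lt ((lt_rootMultiplicity_iff_isRoot_iterate_derivative_of_mem_nonZeroDivisors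
      hRne ?_).2 ?_)
    · rw [mem_nonZeroDivisors_iff_ne_zero]
      intro h
      rw [ZMod.natCast_eq_zero_iff, hp.dvd_factorial] at h
      omega
    · intro k hk
      have hder : derivative^[k] R = ∑ j : Fin J,
          (f ^ (l' + 1 - k) * iterTwistedDerivative f (l' + 1) k (pr j v) * X ^ (p * (j : ℕ)) +
          f ^ (l' + 1 + N - k) * iterTwistedDerivative f (l' + 1 + N) k (ps j v) *
            X ^ (p * (j : ℕ))) := by
        simp only [R]
        rw [iterate_derivative_sum]
        refine Finset.sum_congr rfl fun j _ => ?_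
        rw [iterate_map_add, iterate_derivative_pow_mul_mul_X_pow _ _ _ _ _ (by omega),
          iterate_derivative_pow_mul_mul_X_pow _ _ _ _ _ (by omega)]
      have hQ := congrArg (eval x) (hQ0 k (by omega))
      rw [IsRoot, hder, eval_finsetSum]
      simp only [Q, LinearMap.sum_apply, LinearMap.comp_apply, LinearMap.mulLeft_apply,
        LinearMap.add_apply, LinearMap.smul_apply, eval_finsetSum, eval_mul, eval_pow, eval_X,
        eval_add, eval_smul, smul_eq_mul, eval_zero] at hQ
      have : l' + 1 + N - k = (l' + 1 - k) + N := by omega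
      rw [this]
      rw [← mul_zero ((f.eval x) ^ (l' + 1 - k)), ← hQ, Finset.mul_sum]
      refine Finset.sum_congr rfl fun j _ => ?_
      simp only [eval_add, eval_mul, eval_pow, eval_X, pow_mul, ZMod.pow_card]
      rw [pow_add, hx]
      ring
  refine le_trans ?_ hRdeg
  set S := Finset.univ.filter fun x : ZMod p => (f.eval x) ^ N = a with hS
  calc l * S.card = ∑ x ∈ S, l := by rw [Finset.sum_const, smul_eq_mul, mul_comm]
    _ ≤ ∑ x ∈ S, R.rootMultiplicity x :=
        Finset.sum_le_sum fun x hx => hroot x (by simpa [hS] using hx)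
    _ = ∑ x ∈ S, R.roots.count x := by simp only [count_roots]
    _ ≤ Multiset.card R.roots := by
        classical
        have := Multiset.sum_count_eq_card (s := S ∪ R.roots.toFinset) (m := R.roots)
          (fun x hx => Finset.mem_union_right _ (Multiset.mem_toFinset.2 hx))
        rw [← this]
        exact Finset.sum_le_sum_of_subset Finset.subset_union_left
    _ ≤ R.natDegree := card_roots' R

end Stepanov

/-! ### Quadratic character sums, and translates that consist of squares -/

section Stepanov

open Polynomial

variable {p : ℕ} [Fact p.Prime]

/-- By Euler's criterion the sum is p minus the number of zeros minus twice the number of points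
with value -1, and Stepanov's bound limits the latter to little more than p/2. The loss is about p
(|T| + 1) / (2h), with h free as long as p is large enough. -/
theorem neg_le_sum_quadraticChar (hodd : p ≠ 2) {T : Finset (ZMod p)} (hT : T.Nonempty)
    (h0 : (0 : ZMod p) ∉ T) {h : ℕ} (h1 : 0 < h)
    (hp : T.card + 2 + 2 * (h * (2 * h * T.card + h + 1)) ≤ p) :
    -((6 * h * T.card + p * (T.card + 1) : ℕ) : ℤ) ≤
      2 * h * ∑ c : ZMod p, quadraticChar (ZMod p) (∏ b ∈ T, (c + b)) := by
  have hpp : p.Prime := Fact.out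
  have hodd' : p % 2 = 1 := by have := hpp.eq_two_or_odd; omega
  set f : (ZMod p)[X] := ∏ b ∈ T, (X + C b) with hf
  have hfm : f.Monic := monic_prod_of_monic _ _ fun b _ => monic_X_add_C b
  have hdeg : f.natDegree = T.card := by
    rw [hf, natDegree_prod_of_monic _ _ fun b _ => monic_X_add_C b]; simp
  have heval : ∀ c : ZMod p, f.eval c = ∏ b ∈ T, (c + b) := by
    intro c; rw [hf, eval_prod]; simp
  have hc0 : f.coeff 0 ≠ 0 := by
    rw [coeff_zero_eq_eval_zero, heval, Finset.prod_ne_zero_iff]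
    intro b hb; rw [zero_add]; rintro rfl; exact h0 hb
  obtain ⟨β, hβT⟩ := hT
  have hβ : f.rootMultiplicity (-β) = 1 := by
    have : f = (X + C β) * ∏ b ∈ T.erase β, (X + C b) := (Finset.mul_prod_erase T _ hβT).symm
    rw [this, rootMultiplicity_mul (by rw [← this]; exact hfm.ne_zero)]
    have e : (X + C β : (ZMod p)[X]) = X - C (-β) := by simp
    rw [e, rootMultiplicity_X_sub_C_self, rootMultiplicity_eq_zero]
    rw [IsRoot, eval_prod, Finset.prod_eq_zero_iff]
    rintro ⟨b, hb, hb'⟩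
    simp only [eval_add, eval_X, eval_C, neg_add_eq_zero] at hb'
    exact (Finset.mem_erase.1 hb).1 hb'.symm
  set χ := quadraticChar (ZMod p)
  set m := T.card with hm
  have hchar : ringChar (ZMod p) ≠ 2 := by rw [ZMod.ringChar_zmod_n]; exact hodd
  set A := Finset.univ.filter fun x : ZMod p => (f.eval x) ^ ((p - 1) / 2) = -1 with hA
  set Z := Finset.univ.filter fun x : ZMod p => f.eval x = 0 with hZ
  -- With l = 2h and J = h + 1 the main term (J - 1) p / l is exactly p/2, and the dimension
  -- condition becomes h (2hm + h + 1) < c.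
  have hAcard := card_pow_eq_mul_le (f := f) (β := -β) hodd hβ hc0 (c := (p - m) / 2)
    (l := 2 * h) (J := h + 1) (by omega) (by omega) (by rw [hdeg]; omega)
    (by
      have : 2 * h ≤ 2 * (h * (2 * h * m + h + 1)) :=
        Nat.mul_le_mul_left _ (Nat.le_mul_of_pos_right _ (Nat.succ_pos _))
      omega)
    (by
      rw [hdeg]
      have : h * (2 * h * m + h + 1) < (p - m) / 2 := by omega
      nlinarith)
    (-1)
  rw [hdeg] at hAcard
  have hZcard : Z.card ≤ m := by
    have : Z ⊆ f.roots.toFinset := by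
      intro x hx
      rw [Multiset.mem_toFinset, mem_roots hfm.ne_zero]
      simpa [hZ] using hx
    refine (Finset.card_le_card this).trans ((Multiset.toFinset_card_le _).trans ?_)
    rw [← hdeg]; exact card_roots' f
  have hval : ∀ c : ZMod p, χ (∏ b ∈ T, (c + b)) =
      1 - (if c ∈ Z then 1 else 0) - 2 * (if c ∈ A then 1 else 0) := by
    intro c
    rw [← heval]
    have hq := quadraticChar_eq_pow_of_char_ne_two' hchar (f.eval c)
    rw [ZMod.card] at hq
    have e : p / 2 = (p - 1) / 2 := by omega
    rw [e] at hq
    by_cases hz : f.eval c = 0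
    · have h2 : c ∉ A := by
        simp only [hA, Finset.mem_filter, Finset.mem_univ, true_and, hz]
        rw [zero_pow (by have := hpp.two_le; omega)]
        intro h
        have := neg_eq_zero.1 h.symm
        exact one_ne_zero this
      have h1 : c ∈ Z := by simp [hZ, hz]
      simp [h1, h2, hz, χ]
    · have h1 : c ∉ Z := by simp [hZ, hz]
      rcases quadraticChar_dichotomy hz with h' | h'
      · have h2 : c ∉ A := by
          simp only [hA, Finset.mem_filter, Finset.mem_univ, true_and]
          rw [← hq, h']
          intro hh
          push_cast at hh
          exact Ring.neg_one_ne_one_of_char_ne_two hchar hh.symm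
        simp [h1, h2, h', χ]
      · have h2 : c ∈ A := by
          simp only [hA, Finset.mem_filter, Finset.mem_univ, true_and]
          rw [← hq, h']; simp
        simp [h1, h2, h', χ]
  have hsum : ∑ c : ZMod p, χ (∏ b ∈ T, (c + b)) = p - Z.card - 2 * A.card := by
    simp only [hval, Finset.sum_sub_distrib, ← Finset.mul_sum]
    simp [ZMod.card]
  rw [hsum]
  have h3 : 2 * ((p - m) / 2) ≤ p := by omega
  have h4 : 2 * ((p - 1) / 2 * m) ≤ p * m := by
    rw [← mul_assoc]; exact Nat.mul_le_mul_right _ (by omega)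
  have h5 : h + 1 - 1 = h := by omega
  rw [h5] at hAcard
  have h6 : 2 * h * Z.card ≤ 2 * h * m := Nat.mul_le_mul_left _ hZcard
  zify at hAcard h3 h4 h6 ⊢
  nlinarith

/-- The product of the factors 1 + χ(c + b) detects the good c. Its sum over c expands into one
character sum for every subset of B: the empty set contributes p, and the others only have to be
bounded from below. -/
theorem le_card_forall_isSquare_add_of_zero_notMem (hodd : p ≠ 2) {B : Finset (ZMod p)}
    (hB : B.Nonempty) (h0 : (0 : ZMod p) ∉ B) (hp : 2 ^ (16 * B.card) ≤ p) :
    p ≤ 2 ^ (B.card + 1) *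
      (Finset.univ.filter fun c : ZMod p => ∀ b ∈ B, c + b ≠ 0 ∧ IsSquare (c + b)).card := by
  classical
  set n := B.card with hn
  have hn1 : 1 ≤ n := hB.card_pos
  set χ := quadraticChar (ZMod p)
  set G := Finset.univ.filter fun c : ZMod p => ∀ b ∈ B, c + b ≠ 0 ∧ IsSquare (c + b) with hG
  -- Each of the at most 2^n non-empty subsets loses p (n + 1) / (2h) to leading order; this h
  -- limits the total of these losses to p/4.
  set h := (n + 1) * 2 ^ (n + 1) with hh
  set y := 2 ^ n with hy
  have hny : n + 1 ≤ y := Nat.lt_two_pow_self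
  have hy2 : 2 ≤ y := by omega
  have hhy : h = 2 * ((n + 1) * y) := by rw [hh, pow_succ]; ring
  have hpy : y ^ 16 ≤ p := by rw [hy, ← pow_mul, mul_comm]; exact hp
  have hh1 : h ≤ 2 * y ^ 2 := by rw [hhy]; nlinarith
  have hbig : n + 2 + 2 * (h * (2 * h * n + h + 1)) ≤ p := by
    have e1 : 2 * h * n + h + 1 ≤ 2 * h * y := by nlinarith [Nat.pos_of_ne_zero (show h ≠ 0 by positivity)]
    have e2 : h * (2 * h * n + h + 1) ≤ (2 * y ^ 2) * (2 * (2 * y ^ 2) * y) :=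
      Nat.mul_le_mul hh1 (e1.trans (by gcongr))
    have e3 : n + 2 ≤ 2 * y := by omega
    have e4 : 2 * y + 2 * ((2 * y ^ 2) * (2 * (2 * y ^ 2) * y)) ≤ y ^ 16 := by
      have a1 : y ≤ y ^ 5 := Nat.le_self_pow (by norm_num) y
      have a2 : 2 ^ 11 ≤ y ^ 11 := Nat.pow_le_pow_left hy2 11
      calc _ = 2 * y + 16 * y ^ 5 := by ring
        _ ≤ 2 ^ 11 * y ^ 5 := by omega
        _ ≤ y ^ 11 * y ^ 5 := Nat.mul_le_mul_right _ a2
        _ = y ^ 16 := by ring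
    omega
  have hT : ∀ T ∈ B.powerset.erase ∅, -((6 * h * n + p * (n + 1) : ℕ) : ℤ) ≤
      2 * h * ∑ c : ZMod p, χ (∏ b ∈ T, (c + b)) := by
    intro T hT
    obtain ⟨hT1, hT2⟩ := Finset.mem_erase.1 hT
    rw [Finset.mem_powerset] at hT2
    have hc : T.card ≤ n := Finset.card_le_card hT2
    refine le_trans ?_ (neg_le_sum_quadraticChar hodd (Finset.nonempty_iff_ne_empty.2 hT1)
      (fun h => h0 (hT2 h)) (h := h) (by positivity) (le_trans (by gcongr) hbig))
    rw [neg_le_neg_iff]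
    exact_mod_cast (by gcongr)
  set W := ∑ c : ZMod p, ∏ b ∈ B, (1 + χ (c + b)) with hW
  have hWexp : W = p + ∑ T ∈ B.powerset.erase ∅, ∑ c : ZMod p, χ (∏ b ∈ T, (c + b)) := by
    have : W = ∑ T ∈ B.powerset, ∑ c : ZMod p, χ (∏ b ∈ T, (c + b)) := by
      rw [hW, Finset.sum_comm]
      refine Finset.sum_congr rfl fun c _ => ?_
      rw [Finset.prod_one_add]
      simp only [map_prod]
    rw [this, ← Finset.add_sum_erase _ _ (Finset.empty_mem_powerset B)]
    simp [ZMod.card]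
  have hlow : 2 * h * (p : ℤ) - y * (6 * h * n + p * (n + 1)) ≤ 2 * h * W := by
    rw [hWexp, mul_add (2 * (h : ℤ)), Finset.mul_sum, sub_eq_add_neg]
    gcongr
    calc -((y : ℤ) * (6 * h * n + p * (n + 1)))
        ≤ ∑ T ∈ B.powerset.erase ∅, -((6 * h * n + p * (n + 1) : ℕ) : ℤ) := by
          rw [Finset.sum_const, nsmul_eq_mul, mul_neg, neg_le_neg_iff]
          push_cast
          gcongr
          calc (B.powerset.erase ∅).card ≤ B.powerset.card := Finset.card_le_card (Finset.erase_subset _ _)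
            _ = y := by rw [Finset.card_powerset]
      _ ≤ _ := Finset.sum_le_sum hT
  -- A product is at most 2^n, and it is zero unless c is good or c + b = 0 for some b ∈ B; the
  -- latter happens for n values of c.
  have hup : W ≤ y * (G.card + n) := by
    have hpt : ∀ c : ZMod p, ∏ b ∈ B, (1 + χ (c + b)) ≤
        (y : ℤ) * ((if c ∈ G then 1 else 0) + (if -c ∈ B then 1 else 0)) := by
      intro c
      have hle : ∀ b, 0 ≤ 1 + χ (c + b) ∧ 1 + χ (c + b) ≤ 2 := by
        intro b
        by_cases hz : c + b = 0
        · simp [hz, χ]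
        · rcases quadraticChar_dichotomy hz with h' | h' <;> simp [χ, h']
      have hy' : ∏ b ∈ B, (1 + χ (c + b)) ≤ y := by
        calc _ ≤ ∏ b ∈ B, (2 : ℤ) := Finset.prod_le_prod (fun b _ => (hle b).1) fun b _ => (hle b).2
          _ = y := by simp [hy, hn]
      by_cases hcG : c ∈ G
      · rw [if_pos hcG]
        refine hy'.trans ?_
        split_ifs <;> nlinarith
      · by_cases hcB : -c ∈ B
        · rw [if_pos hcB, if_neg hcG]; simpa using hy'
        · rw [if_neg hcG, if_neg hcB, add_zero, mul_zero]
          have : ∃ b ∈ B, ¬ (c + b ≠ 0 ∧ IsSquare (c + b)) := by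
            by_contra hcon
            push Not at hcon
            exact hcG (by simpa [hG] using hcon)
          obtain ⟨b, hb, hnot⟩ := this
          have hz : c + b ≠ 0 := by
            intro hz; apply hcB
            rw [neg_eq_of_add_eq_zero_right hz]; exact hb
          have hns : ¬ IsSquare (c + b) := fun hs => hnot ⟨hz, hs⟩
          have : χ (c + b) = -1 := by
            rcases quadraticChar_dichotomy hz with h' | h'
            · exact absurd ((quadraticChar_one_iff_isSquare hz).1 h') hns
            · exact h'
          rw [Finset.prod_eq_zero hb (by rw [this]; norm_num)]
    refine (Finset.sum_le_sum fun c _ => hpt c).trans ?_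
    rw [← Finset.mul_sum, Finset.sum_add_distrib]
    have e1 : ∑ c : ZMod p, (if c ∈ G then (1 : ℤ) else 0) = G.card := by simp
    have e2 : ∑ c : ZMod p, (if -c ∈ B then (1 : ℤ) else 0) = n := by
      rw [← Equiv.sum_comp (Equiv.neg (ZMod p))]; simp [hn]
    rw [e1, e2]
  have hfin : 16 * (n * y) ≤ p := by
    have a1 : n * y ≤ y ^ 2 := by nlinarith
    have a2 : 2 ^ 14 ≤ y ^ 14 := Nat.pow_le_pow_left hy2 14
    calc 16 * (n * y) ≤ 2 ^ 14 * y ^ 2 := by omega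
      _ ≤ y ^ 14 * y ^ 2 := Nat.mul_le_mul_right _ a2
      _ = y ^ 16 := by ring
      _ ≤ p := hpy
  have hhp : (0 : ℤ) < h := by positivity
  have e1 : (y : ℤ) * (p * (n + 1)) * 2 = h * p := by
    rw [hhy]; push_cast; ring
  have hfin' : 16 * ((n : ℤ) * y) ≤ p := by exact_mod_cast hfin
  have key : (h : ℤ) * p ≤ h * (2 * (y * G.card)) := by
    have h1 : 2 * (h : ℤ) * W ≤ 2 * h * (y * (G.card + n)) :=
      mul_le_mul_of_nonneg_left hup (by positivity)
    have h2 : (h : ℤ) * (16 * ((n : ℤ) * y)) ≤ h * p := mul_le_mul_of_nonneg_left hfin' hhp.le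
    nlinarith
  have := le_of_mul_le_mul_left key hhp
  zify
  rw [pow_succ]
  have hy' : (2 : ℤ) ^ n = y := by rw [hy]; push_cast; rfl
  rw [hy']; linarith

/-- Many translates of a small set consist of non-zero squares. -/
theorem le_card_forall_isSquare_add (hodd : p ≠ 2) {B : Finset (ZMod p)}
    (hB : B.Nonempty) (hp : 2 ^ (16 * B.card) ≤ p) :
    p ≤ 2 ^ (B.card + 1) *
      (Finset.univ.filter fun c : ZMod p => ∀ b ∈ B, c + b ≠ 0 ∧ IsSquare (c + b)).card := by
  classical
  have hlt : B.card < p := lt_of_lt_of_le (lt_of_lt_of_le Nat.lt_two_pow_self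
    (Nat.pow_le_pow_right (by norm_num) (by omega))) hp
  -- Translating B by an element outside it removes 0 from the set, as the preceding lemma requires;
  -- the number of good c does not change.
  obtain ⟨e, he⟩ : ∃ e : ZMod p, e ∉ B := by
    by_contra hcon
    push Not at hcon
    have : B = Finset.univ := Finset.eq_univ_of_forall hcon
    rw [this, Finset.card_univ, ZMod.card] at hlt
    exact lt_irrefl _ hlt
  have hinj : Function.Injective fun b : ZMod p => b - e := sub_left_injective
  have hcard : (B.image fun b => b - e).card = B.card := Finset.card_image_of_injective _ hinj
  have := le_card_forall_isSquare_add_of_zero_notMem hodd (B := B.image fun b => b - e)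
    (hB.image _) (by simpa [sub_eq_zero] using he) (by rwa [hcard])
  rw [hcard] at this
  refine this.trans (Nat.mul_le_mul_left _ ?_)
  refine Finset.card_le_card_of_injOn (fun c => c - e) ?_ (sub_left_injective.injOn)
  intro c hc
  simp only [Finset.coe_filter, Finset.mem_univ, true_and, Set.mem_ofPred_eq,
    Finset.forall_mem_image] at hc ⊢
  intro b hb
  have h1 := hc hb
  have : c - e + b = c + (b - e) := by ring
  rw [this]; exact h1

end Stepanov

/-! ### Programs for vectors and for lists of coefficients -/

section ListPrograms

variable {F : Type} [Field F] [Fintype F] [DecidableEq F]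

/-- Apply a binary instruction to the entries of two lists. -/
def zipInstr (op : ℕ → ℕ → Instr F) : List ℕ → List ℕ → Alg F (List ℕ)
  | a :: as, b :: bs => do
      let t ← exec (op a b)
      let ts ← zipInstr op as bs
      pure (t :: ts)
  | _, _ => pure []

theorem holds_zipInstr {op : ℕ → ℕ → Instr F} {φ : F → F → F}
    (hop : ∀ (mem : List F) i j x y, mem[i]? = some x → mem[j]? = some y →
      (op i j).value mem = PMF.pure (φ x y)) {l l' : List ℕ} :
    ∀ {mem xs ys}, Rep mem l xs → Rep mem l' ys →
    (zipInstr op l l').Holds mem fun out m t =>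
      Rep m out (List.zipWith φ xs ys) ∧ t ≤ xs.length := by
  induction l generalizing l' with
  | nil =>
    intro mem xs ys h _
    cases h
    exact Alg.holds_pure ⟨Rep.nil, le_rfl⟩
  | cons a l ih =>
    intro mem xs ys h h'
    cases h with
    | cons hx h =>
    cases h' with
    | nil => exact Alg.holds_pure ⟨Rep.nil, Nat.zero_le _⟩
    | cons hy h' =>
    refine (holds_exec (hop _ _ _ _ _ hx hy)).bind fun c m t hm hc => ?_
    refine (ih (Rep.mono h hm) (Rep.mono h' hm)).bind fun out m' t' hm' hout => ?_
    refine Alg.holds_pure ⟨Rep.cons (getElem?_mono hc.1 hm') hout.1, ?_⟩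
    have := hout.2
    have := hc.2
    simp only [List.length_cons]; omega

theorem holds_zipAdd {l l' : List ℕ} {mem xs ys : List F} (h : Rep mem l xs) (h' : Rep mem l' ys) :
    (zipInstr .add l l').Holds mem fun out m t =>
      Rep m out (List.zipWith (· + ·) xs ys) ∧ t ≤ xs.length :=
  holds_zipInstr (fun mem i j x y hx hy => by
    simp only [Instr.value, lookup_of_getElem? hx, lookup_of_getElem? hy]) h h'

theorem holds_zipSub {l l' : List ℕ} {mem xs ys : List F} (h : Rep mem l xs) (h' : Rep mem l' ys) :
    (zipInstr .sub l l').Holds mem fun out m t =>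
      Rep m out (List.zipWith (· - ·) xs ys) ∧ t ≤ xs.length :=
  holds_zipInstr (fun mem i j x y hx hy => by
    simp only [Instr.value, lookup_of_getElem? hx, lookup_of_getElem? hy]) h h'

theorem holds_zipMul {l l' : List ℕ} {mem xs ys : List F} (h : Rep mem l xs) (h' : Rep mem l' ys) :
    (zipInstr .mul l l').Holds mem fun out m t =>
      Rep m out (List.zipWith (· * ·) xs ys) ∧ t ≤ xs.length :=
  holds_zipInstr (fun mem i j x y hx hy => by
    simp only [Instr.value, lookup_of_getElem? hx, lookup_of_getElem? hy]) h h'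

theorem holds_zipDiv {l l' : List ℕ} {mem xs ys : List F} (h : Rep mem l xs) (h' : Rep mem l' ys) :
    (zipInstr .div l l').Holds mem fun out m t =>
      Rep m out (List.zipWith (· / ·) xs ys) ∧ t ≤ xs.length :=
  holds_zipInstr (fun mem i j x y hx hy => by
    simp only [Instr.value, lookup_of_getElem? hx, lookup_of_getElem? hy]) h h'

/-- Run a program for every entry of a list. -/
def forEach {γ : Type} (g : γ → Alg F ℕ) : List γ → Alg F (List ℕ)
  | [] => pure []
  | c :: cs => do
      let t ← g c
      let ts ← forEach g cs
      pure (t :: ts)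

theorem holds_forEach {γ : Type} {g : γ → Alg F ℕ} {φ : γ → F} {T : ℕ} {mem : List F}
    {cs : List γ} (hg : ∀ c ∈ cs, ∀ m, mem <+: m →
      (g c).Holds m fun a m' t => m'[a]? = some (φ c) ∧ t ≤ T) :
    (forEach g cs).Holds mem fun out m t => Rep m out (cs.map φ) ∧ t ≤ cs.length * T := by
  induction cs generalizing mem with
  | nil => exact Alg.holds_pure ⟨Rep.nil, Nat.zero_le _⟩
  | cons c cs ih =>
    refine (hg c List.mem_cons_self mem (List.prefix_refl _)).bind fun a m t hm ha => ?_
    refine (ih fun c' hc' m' hm' => hg c' (List.mem_cons_of_mem _ hc') m' (hm.trans hm')).bind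
      fun out m' t' hm' hout => ?_
    refine Alg.holds_pure ⟨Rep.cons (getElem?_mono ha.1 hm') hout.1, ?_⟩
    have := hout.2
    have := ha.2
    simp only [List.length_cons, Nat.succ_mul]; omega

/-- Load a list of constants. -/
def constList (cs : List F) : Alg F (List ℕ) := forEach (fun c => exec (.const c)) cs

theorem holds_constList (cs mem : List F) :
    (constList cs).Holds mem fun out m t => Rep m out cs ∧ t ≤ cs.length := by
  refine (holds_forEach (φ := id) (T := 1) fun c _ m _ => ?_).mono fun out m t _ h => ?_
  · exact (holds_const c m).mono fun a m t _ h => ⟨h.1, h.2.le⟩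
  · simpa using h

/-- Sum of the entries of a list, added to an accumulator. -/
def sumList : ℕ → List ℕ → Alg F ℕ
  | acc, [] => pure acc
  | acc, a :: as => do
      let t ← exec (.add acc a)
      sumList t as

theorem holds_sumList {l : List ℕ} : ∀ {acc : ℕ} {mem xs : List F} {x : F},
    mem[acc]? = some x → Rep mem l xs →
    (sumList acc l).Holds mem fun a m t => m[a]? = some (x + xs.sum) ∧ t ≤ xs.length := by
  induction l with
  | nil =>
    intro acc mem xs x hx h
    cases h
    exact Alg.holds_pure ⟨by simpa using hx, le_rfl⟩
  | cons a l ih =>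
    intro acc mem xs x hx h
    cases h with
    | cons hy h =>
    refine (holds_add hx hy).bind fun b m t hm hb => ?_
    refine (ih hb.1 (Rep.mono h hm)).mono fun c m' t' _ hc => ?_
    refine ⟨by rw [hc.1, List.sum_cons, add_assoc], ?_⟩
    have := hc.2
    have := hb.2
    simp only [List.length_cons]; omega

/-- The dot product of two lists. -/
def dot (xs ys : List F) : F := (List.zipWith (· * ·) xs ys).sum

/-- Dot product with a list of constants. -/
def dotConst (l : List ℕ) (cs : List F) : Alg F ℕ := do
  let z ← exec (.const 0)
  let c ← constList cs
  let r ← zipInstr .mul c l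
  sumList z r

theorem holds_dotConst {l : List ℕ} {mem xs : List F} (cs : List F) (h : Rep mem l xs) :
    (dotConst l cs).Holds mem fun a m t =>
      m[a]? = some (dot cs xs) ∧ t ≤ 3 * cs.length + 1 := by
  refine (holds_const 0 mem).bind fun z m1 t1 h1 hz => ?_
  refine (holds_constList cs m1).bind fun c m2 t2 h2 hc => ?_
  refine (holds_zipMul hc.1 (h.mono (h1.trans h2))).bind fun r m3 t3 h3 hr => ?_
  refine (holds_sumList (getElem?_mono hz.1 (h2.trans h3)) hr.1).mono fun a m4 t4 h4 ha => ?_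
  refine ⟨by rw [ha.1, zero_add]; rfl, ?_⟩
  have e1 := ha.2
  have e2 := hr.2
  have e3 := hc.2
  have e4 := hz.2
  rw [List.length_zipWith] at e1
  omega

/-- Multiplication by a constant matrix, given by its rows. -/
def matVec (rows : List (List F)) (l : List ℕ) : Alg F (List ℕ) := forEach (dotConst l) rows

theorem holds_matVec {rows : List (List F)} {l : List ℕ} {mem xs : List F} {n : ℕ}
    (hn : ∀ r ∈ rows, r.length ≤ n) (h : Rep mem l xs) :
    (matVec rows l).Holds mem fun out m t =>
      Rep m out (rows.map fun r => dot r xs) ∧ t ≤ rows.length * (3 * n + 1) :=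
  holds_forEach fun c hc m hm => (holds_dotConst c (h.mono hm)).mono fun a m' t _ ha =>
    ⟨ha.1, ha.2.trans (by have := hn c hc; omega)⟩

/-- Entrywise sum; the shorter list is padded by zeros. -/
def addList : List ℕ → List ℕ → Alg F (List ℕ)
  | a :: as, b :: bs => do
      let t ← exec (.add a b)
      let ts ← addList as bs
      pure (t :: ts)
  | [], bs => pure bs
  | as, [] => pure as

/-- Entrywise difference; the shorter list is padded by zeros (`z` is the address of a zero). -/
def subList (z : ℕ) : List ℕ → List ℕ → Alg F (List ℕ)
  | a :: as, b :: bs => do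
      let t ← exec (.sub a b)
      let ts ← subList z as bs
      pure (t :: ts)
  | [], b :: bs => do
      let t ← exec (.sub z b)
      let ts ← subList z [] bs
      pure (t :: ts)
  | as, [] => pure as

open Polynomial

/-- The polynomial with a given list of coefficients, from the constant term on. -/
noncomputable def toPoly : List F → F[X]
  | [] => 0
  | c :: cs => C c + X * toPoly cs

theorem toPoly_append (xs ys : List F) :
    toPoly (xs ++ ys) = toPoly xs + X ^ xs.length * toPoly ys := by
  induction xs with
  | nil => simp [toPoly]
  | cons x xs ih => simp only [List.cons_append, toPoly, ih, List.length_cons]; ring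

theorem toPoly_replicate_zero (n : ℕ) : toPoly (List.replicate n (0 : F)) = 0 := by
  induction n with
  | zero => rfl
  | succ n ih => simp [List.replicate_succ, toPoly, ih]

theorem toPoly_take_add_drop (xs : List F) (n : ℕ) (hn : n ≤ xs.length) :
    toPoly (xs.take n) + X ^ n * toPoly (xs.drop n) = toPoly xs := by
  conv_rhs => rw [← List.take_append_drop n xs, toPoly_append, List.length_take, min_eq_left hn]

theorem coeff_toPoly (xs : List F) (n : ℕ) : (toPoly xs).coeff n = xs.getD n 0 := by
  induction xs generalizing n with
  | nil => simp [toPoly]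
  | cons x xs ih =>
    cases n with
    | zero => simp [toPoly]
    | succ n => simp [toPoly, ih]

theorem degree_toPoly_lt (xs : List F) : (toPoly xs).degree < xs.length := by
  rw [degree_lt_iff_coeff_zero]
  intro m hm
  rw [coeff_toPoly, List.getD_eq_default _ _ hm]

theorem toPoly_map_mul (c : F) (xs : List F) : toPoly (xs.map (c * ·)) = C c * toPoly xs := by
  induction xs with
  | nil => simp [toPoly]
  | cons x xs ih => simp only [List.map_cons, toPoly, ih, C_mul]; ring

theorem polyAt_eq_toPoly {mem : List F} {l : List ℕ} {xs : List F} (h : Rep mem l xs) :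
    polyAt mem l = toPoly xs := by
  induction h with
  | nil => rfl
  | cons hx _ ih => simp only [polyAt, toPoly, ih, lookup_of_getElem? hx]

theorem holds_addList {l l' : List ℕ} : ∀ {mem xs ys : List F}, Rep mem l xs → Rep mem l' ys →
    (addList l l').Holds mem fun out m t => ∃ zs, Rep m out zs ∧
      zs.length = max xs.length ys.length ∧ toPoly zs = toPoly xs + toPoly ys ∧
      t ≤ ys.length := by
  induction l generalizing l' with
  | nil =>
    intro mem xs ys h h'
    cases h
    cases h' with
    | nil => exact Alg.holds_pure ⟨[], Rep.nil, by simp, by simp [toPoly], le_rfl⟩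
    | cons hy h' =>
      exact Alg.holds_pure ⟨_, Rep.cons hy h', by simp, by simp [toPoly], Nat.zero_le _⟩
  | cons a l ih =>
    intro mem xs ys h h'
    cases h with
    | cons hx h =>
    cases h' with
    | nil => exact Alg.holds_pure ⟨_, Rep.cons hx h, by simp, by simp [toPoly], Nat.zero_le _⟩
    | cons hy h' =>
    refine (holds_add hx hy).bind fun c m t hm hc => ?_
    refine (ih (Rep.mono h hm) (Rep.mono h' hm)).bind fun out m' t' hm' hout => ?_
    obtain ⟨zs, hzs, hlen, hpoly, ht⟩ := hout
    refine Alg.holds_pure ⟨_, Rep.cons (getElem?_mono hc.1 hm') hzs, ?_, ?_, ?_⟩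
    · simp only [List.length_cons, hlen]; omega
    · simp only [toPoly, hpoly, C_add]; ring
    · have := hc.2; simp only [List.length_cons]; omega

theorem holds_subList {z : ℕ} {l l' : List ℕ} : ∀ {mem xs ys : List F}, mem[z]? = some 0 →
    Rep mem l xs → Rep mem l' ys →
    (subList z l l').Holds mem fun out m t => ∃ zs, Rep m out zs ∧
      zs.length = max xs.length ys.length ∧ toPoly zs = toPoly xs - toPoly ys ∧
      t ≤ ys.length := by
  induction l' generalizing l with
  | nil =>
    intro mem xs ys _ h h'
    cases h'
    cases h with
    | nil => exact Alg.holds_pure ⟨[], Rep.nil, by simp, by simp [toPoly], le_rfl⟩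
    | cons hy h =>
      exact Alg.holds_pure ⟨_, Rep.cons hy h, by simp, by simp [toPoly], Nat.zero_le _⟩
  | cons a l' ih =>
    intro mem xs ys hz h h'
    cases h' with
    | cons hy h' =>
    cases h with
    | nil =>
      refine (holds_sub hz hy).bind fun c m t hm hc => ?_
      refine (ih (getElem?_mono hz hm) Rep.nil (Rep.mono h' hm)).bind fun out m' t' hm' hout => ?_
      obtain ⟨zs, hzs, hlen, hpoly, ht⟩ := hout
      refine Alg.holds_pure ⟨_, Rep.cons (getElem?_mono hc.1 hm') hzs, ?_, ?_, ?_⟩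
      · simp only [List.length_cons, hlen]; simp
      · simp only [toPoly, hpoly, zero_sub, C_neg]; ring
      · have := hc.2; simp only [List.length_cons]; omega
    | cons hx h =>
      refine (holds_sub hx hy).bind fun c m t hm hc => ?_
      refine (ih (getElem?_mono hz hm) (Rep.mono h hm) (Rep.mono h' hm)).bind
        fun out m' t' hm' hout => ?_
      obtain ⟨zs, hzs, hlen, hpoly, ht⟩ := hout
      refine Alg.holds_pure ⟨_, Rep.cons (getElem?_mono hc.1 hm') hzs, ?_, ?_, ?_⟩
      · simp only [List.length_cons, hlen]; omega
      · simp only [toPoly, hpoly, C_sub]; ring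
      · have := hc.2; simp only [List.length_cons]; omega

/-- Multiplication of all entries of a list by a field element. -/
def scaleList (c : ℕ) : List ℕ → Alg F (List ℕ)
  | [] => pure []
  | a :: as => do
      let t ← exec (.mul c a)
      let ts ← scaleList c as
      pure (t :: ts)

theorem holds_scaleList {c : ℕ} {l : List ℕ} : ∀ {mem xs : List F} {x : F}, mem[c]? = some x →
    Rep mem l xs → (scaleList c l).Holds mem fun out m t =>
      Rep m out (xs.map (x * ·)) ∧ t ≤ xs.length := by
  induction l with
  | nil =>
    intro mem xs x _ h
    cases h
    exact Alg.holds_pure ⟨Rep.nil, le_rfl⟩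
  | cons a l ih =>
    intro mem xs x hx h
    cases h with
    | cons hy h =>
    refine (holds_mul hx hy).bind fun b m t hm hb => ?_
    refine (ih (getElem?_mono hx hm) (Rep.mono h hm)).bind fun out m' t' hm' hout => ?_
    refine Alg.holds_pure ⟨Rep.cons (getElem?_mono hb.1 hm') hout.1, ?_⟩
    have := hb.2
    have := hout.2
    simp only [List.length_cons]; omega

/-- Evaluation of a polynomial by Horner's rule. -/
def horner (x : ℕ) : List ℕ → Alg F ℕ
  | [] => exec (.const 0)
  | c :: cs => do
      let a ← horner x cs
      let b ← exec (.mul x a)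
      exec (.add c b)

theorem holds_horner {x : ℕ} {l : List ℕ} : ∀ {mem xs : List F} {y : F}, mem[x]? = some y →
    Rep mem l xs → (horner x l).Holds mem fun a m t =>
      m[a]? = some ((toPoly xs).eval y) ∧ t ≤ 2 * xs.length + 1 := by
  induction l with
  | nil =>
    intro mem xs y _ h
    cases h
    exact (holds_const 0 mem).mono fun a m t _ h => ⟨by simpa [toPoly] using h.1, by simp [h.2]⟩
  | cons c l ih =>
    intro mem xs y hy h
    cases h with
    | cons hx h =>
    refine (ih hy h).bind fun a m t hm ha => ?_
    refine (holds_mul (getElem?_mono hy hm) ha.1).bind fun b m' t' hm' hb => ?_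
    refine (holds_add (getElem?_mono hx (hm.trans hm')) hb.1).mono fun d m'' t'' _ hd => ?_
    refine ⟨by rw [hd.1]; simp [toPoly], ?_⟩
    have := ha.2
    have := hb.2
    have := hd.2
    simp only [List.length_cons]; omega

end ListPrograms

/-! ### Extension of the values of a polynomial from one point set to another -/

section Extend

open Polynomial

variable {F : Type} [Field F] [Fintype F] [DecidableEq F]

theorem zipWith_map_map {α β γ δ : Type*} (f : β → γ → δ) (g : α → β) (h : α → γ) (l : List α) :
    List.zipWith f (l.map g) (l.map h) = l.map fun x => f (g x) (h x) := by
  induction l with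
  | nil => rfl
  | cons a l ih => simp [ih]

theorem zipWith_self_map {α β γ : Type*} (f : α → β → γ) (h : α → β) (l : List α) :
    List.zipWith f l (l.map h) = l.map fun x => f x (h x) := by
  conv_lhs => rw [← List.map_id l, List.map_map, zipWith_map_map]
  rfl

/-- From the values of a polynomial of degree less than `D` at the points `u`, its values at the
points `v` can be computed with at most `T` operations. -/
def CanExtend (T D : ℕ) (u v : List F) : Prop :=
  ∃ prog : List ℕ → Alg F (List ℕ), ∀ (mem : List F) (l : List ℕ) (xs : List F),
    Rep mem l xs → xs.length = u.length → (prog l).Holds mem fun out m t =>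
      t ≤ T ∧ ∃ ys, Rep m out ys ∧ ys.length = v.length ∧
        ∀ g : F[X], g.degree < D → xs = u.map (fun x => g.eval x) → ys = v.map fun x => g.eval x

/-- The value at `y` of the Lagrange interpolation polynomial. -/
noncomputable def lagrangeRow (u : List F) (y : F) : List F :=
  u.map fun x => (Lagrange.basis u.toFinset id x).eval y

theorem dot_map_map (u : List F) (f g : F → F) :
    dot (u.map f) (u.map g) = (u.map fun x => f x * g x).sum := by
  rw [dot, zipWith_map_map]

theorem eq_sum_lagrange_basis {u : List F} (hu : u.Nodup) {g : F[X]} (hg : g.degree < u.length) :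
    g = ∑ x ∈ u.toFinset, C (g.eval x) * Lagrange.basis u.toFinset id x := by
  have h := Lagrange.eq_interpolate (s := u.toFinset) (v := id) (f := g)
    (Function.injective_id.injOn) (by rwa [List.toFinset_card_of_nodup hu])
  conv_lhs => rw [h]
  rw [Lagrange.interpolate_apply]
  rfl

/-- The interpolation weights depend only on the points, so a program may load them as constants. -/
theorem dot_lagrangeRow {u : List F} (hu : u.Nodup) {g : F[X]} (hg : g.degree < u.length) (y : F) :
    dot (lagrangeRow u y) (u.map fun x => g.eval x) = g.eval y := by
  rw [lagrangeRow, dot_map_map, ← List.sum_toFinset _ hu]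
  conv_rhs => rw [eq_sum_lagrange_basis hu hg, eval_finsetSum]
  refine Finset.sum_congr rfl fun x _ => ?_
  rw [eval_mul, eval_C, mul_comm]

theorem canExtend_lagrange {u v : List F} (hu : u.Nodup) :
    CanExtend (v.length * (3 * u.length + 1)) u.length u v := by
  refine ⟨matVec (v.map (lagrangeRow u)), fun mem l xs h hlen => ?_⟩
  refine (holds_matVec (n := u.length) ?_ h).mono fun out m t _ hout => ?_
  · intro r hr
    obtain ⟨y, _, rfl⟩ := List.mem_map.1 hr
    simp [lagrangeRow]
  · refine ⟨by simpa using hout.2, _, hout.1, by simp, fun g hg hxs => ?_⟩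
    subst hxs
    rw [List.map_map]
    refine List.map_congr_left fun y _ => ?_
    exact dot_lagrangeRow hu hg y

/-- The decomposition into even and odd parts, written in powers of X² - c: repeated division by X²
- c leaves linear remainders, whose two coefficients are collected in g0 and g1. -/
theorem exists_even_odd (c : F) (D : ℕ) (g : F[X]) (hg : g.degree < (2 * D : ℕ)) :
    ∃ g0 g1 : F[X], g0.degree < D ∧ g1.degree < D ∧
      g = g0.comp (X ^ 2 - C c) + X * g1.comp (X ^ 2 - C c) := by
  induction D generalizing g with
  | zero =>
    have : g = 0 := by simpa using hg
    exact ⟨0, 0, by simp, by simp, by simp [this]⟩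
  | succ D ih =>
    have hm : (X ^ 2 - C c).Monic := monic_X_pow_sub_C c (by norm_num)
    have hmd : (X ^ 2 - C c).natDegree = 2 := natDegree_X_pow_sub_C
    have hq : (g /ₘ (X ^ 2 - C c)).degree < (2 * D : ℕ) := by
      rw [degree_lt_iff_coeff_zero] at hg ⊢
      by_contra hcon
      push Not at hcon
      obtain ⟨m, hm1, hm2⟩ := hcon
      have h1 := le_natDegree_of_ne_zero hm2
      rw [natDegree_divByMonic _ hm, hmd] at h1
      have h2 : g.natDegree < 2 * (D + 1) := by
        by_cases h0 : g = 0
        · simp [h0]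
        · rw [natDegree_lt_iff_degree_lt h0, degree_lt_iff_coeff_zero]; exact hg
      have h3 : 2 * D = 0 := by omega
      have h4 : g.natDegree < 2 := by omega
      rw [(divByMonic_eq_zero_iff hm).2] at hm2
      · simp at hm2
      · rw [degree_eq_natDegree hm.ne_zero, hmd]
        exact degree_le_natDegree.trans_lt (by exact_mod_cast h4)
    obtain ⟨q0, q1, h0, h1, hqe⟩ := ih _ hq
    have hr : (g %ₘ (X ^ 2 - C c)).degree < 2 := by
      have := degree_modByMonic_lt g hm
      rwa [degree_eq_natDegree hm.ne_zero, hmd] at this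
    set r := g %ₘ (X ^ 2 - C c)
    have hr' : r = C (r.coeff 1) * X + C (r.coeff 0) :=
      eq_X_add_C_of_degree_le_one (degree_le_of_natDegree_le (by
        by_cases hz : r = 0
        · simp [hz]
        · exact Nat.lt_succ_iff.1 ((natDegree_lt_iff_degree_lt hz).2 hr)))
    have hX : ∀ (q : F[X]) (a : F), q.degree < D → (X * q + C a).degree < ((D + 1 : ℕ) : WithBot ℕ) := by
      intro q a hq
      rw [degree_lt_iff_coeff_zero] at hq ⊢
      intro m hm
      obtain ⟨m, rfl⟩ : ∃ k, m = k + 1 := ⟨m - 1, by omega⟩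
      rw [coeff_add, coeff_X_mul, coeff_C_succ, hq m (by omega), add_zero]
    refine ⟨X * q0 + C (r.coeff 0), X * q1 + C (r.coeff 1), hX _ _ h0, hX _ _ h1, ?_⟩
    have hg' := modByMonic_add_div g (X ^ 2 - C c)
    rw [← hg', hqe]
    change r + _ = _
    rw [hr']
    simp only [add_comp, mul_comp, X_comp, C_comp, coeff_add, coeff_C_mul_X, coeff_C]
    simp
    ring

/-- The butterfly step. For g = g0(X² - c) + X g1(X² - c), the sum and the difference of g(a) and
g(-a), divided by 2 and by 2a, are the values of g0 and g1 at a² - c. Two extensions of half the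
size carry them over, and g(±b) = g0(b² - c) ± b g1(b² - c) reassembles g. -/
theorem canExtend_sqrt {T D : ℕ} {u v A A' : List F} {c : F} (h2 : (2 : F) ≠ 0)
    (h : CanExtend T D u v) (hA : A.map (fun a => a ^ 2 - c) = u)
    (hA' : A'.map (fun a => a ^ 2 - c) = v) (h0 : ∀ a ∈ A, a ≠ 0) (hlen : A.length = A'.length) :
    CanExtend (2 * T + 10 * A.length) (2 * D) (A ++ A.map Neg.neg) (A' ++ A'.map Neg.neg) := by
  obtain ⟨prog, hprog⟩ := h
  have hulen : u.length = A.length := by rw [← hA, List.length_map]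
  have hvlen : v.length = A'.length := by rw [← hA', List.length_map]
  refine ⟨fun l => do
    let s ← zipInstr .add (l.take A.length) (l.drop A.length)
    let d ← zipInstr .sub (l.take A.length) (l.drop A.length)
    let k ← constList (A.map fun _ => 2⁻¹)
    let w ← constList (A.map fun a => (2 * a)⁻¹)
    let s' ← zipInstr .mul s k
    let d' ← zipInstr .mul d w
    let e ← prog s'
    let o ← prog d'
    let b ← constList A'
    let o' ← zipInstr .mul b o
    let y ← zipInstr .add e o'
    let z ← zipInstr .sub e o'
    pure (y ++ z), fun mem l xs hl hxs => ?_⟩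
  rw [List.length_append, List.length_map] at hxs
  have hx1 : (xs.take A.length).length = A.length := by rw [List.length_take]; omega
  have hx2 : (xs.drop A.length).length = A.length := by rw [List.length_drop]; omega
  refine (holds_zipAdd (hl.take A.length) (hl.drop A.length)).bind fun s m1 t1 i1 hs => ?_
  refine (holds_zipSub ((hl.mono i1).take A.length) ((hl.mono i1).drop A.length)).bind
    fun d m2 t2 i2 hd => ?_
  refine (holds_constList _ _).bind fun k m3 t3 i3 hk => ?_
  refine (holds_constList _ _).bind fun w m4 t4 i4 hw => ?_
  refine (holds_zipMul (hs.1.mono ((i2.trans i3).trans i4)) (hk.1.mono i4)).bind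
    fun s' m5 t5 i5 hs' => ?_
  refine (holds_zipMul (hd.1.mono ((i3.trans i4).trans i5)) (hw.1.mono i5)).bind
    fun d' m6 t6 i6 hd' => ?_
  refine (hprog _ _ _ (hs'.1.mono i6) (by simp [hx1, hx2, hulen])).bind
    fun e m7 t7 i7 he => ?_
  obtain ⟨ht7, es, hes, heslen, hesval⟩ := he
  refine (hprog _ _ _ (hd'.1.mono i7) (by simp [hx1, hx2, hulen])).bind
    fun o m8 t8 i8 ho => ?_
  obtain ⟨ht8, os, hos, hoslen, hosval⟩ := ho
  refine (holds_constList _ _).bind fun b m9 t9 i9 hb => ?_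
  refine (holds_zipMul hb.1 (hos.mono i9)).bind fun o' m10 t10 i10 ho' => ?_
  refine (holds_zipAdd (hes.mono ((i8.trans i9).trans i10)) ho'.1).bind fun y m11 t11 i11 hy => ?_
  refine (holds_zipSub (hes.mono (((i8.trans i9).trans i10).trans i11)) (ho'.1.mono i11)).bind
    fun z m12 t12 i12 hz => ?_
  refine Alg.holds_pure ⟨?_, _, (hy.1.mono i12).append hz.1, ?_, fun g hg hxg => ?_⟩
  · have e1 := hs.2
    have e2 := hd.2
    have e3 := hk.2
    have e4 := hw.2
    have e5 := hs'.2
    have e6 := hd'.2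
    have e9 := hb.2
    have e10 := ho'.2
    have e11 := hy.2
    have e12 := hz.2
    simp only [List.length_map, List.length_zipWith, hx1, hx2, heslen, hvlen] at *
    omega
  · simp [heslen, hoslen, hvlen]
  · subst hxg
    obtain ⟨g0, g1, h0d, h1d, hgeq⟩ := exists_even_odd c D g hg
    have hval : ∀ x : F, g.eval x = g0.eval (x ^ 2 - c) + x * g1.eval (x ^ 2 - c) := by
      intro x; conv_lhs => rw [hgeq]
      simp
    have etake : ((A ++ A.map Neg.neg).map fun x => g.eval x).take A.length =
        A.map fun x => g.eval x := by
      rw [List.map_append, List.take_left' (by simp)]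
    have edrop : ((A ++ A.map Neg.neg).map fun x => g.eval x).drop A.length =
        A.map fun x => g.eval (-x) := by
      rw [List.map_append, List.drop_left' (by simp), List.map_map]; rfl
    have es1 : es = v.map fun x => g0.eval x := by
      refine hesval g0 h0d ?_
      rw [etake, edrop, zipWith_map_map, zipWith_map_map, ← hA, List.map_map]
      refine List.map_congr_left fun a _ => ?_
      simp only [Function.comp, hval, neg_sq]
      field_simp; ring
    have os1 : os = v.map fun x => g1.eval x := by
      refine hosval g1 h1d ?_
      rw [etake, edrop, zipWith_map_map, zipWith_map_map, ← hA, List.map_map]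
      refine List.map_congr_left fun a ha => ?_
      have := h0 a ha
      simp only [Function.comp, hval, neg_sq]
      field_simp; ring
    rw [es1, os1, ← hA', List.map_map, List.map_map, zipWith_self_map, zipWith_map_map,
      zipWith_map_map, List.map_append, List.map_map]
    congr 1
    · refine List.map_congr_left fun a _ => ?_
      simp only [Function.comp, hval]
    · refine List.map_congr_left fun a _ => ?_
      simp only [Function.comp, hval, neg_sq]; ring

end Extend

/-! ### Totally split fibers of towers of quadratic maps -/

section Tower

variable {F : Type} [Field F] [Fintype F] [DecidableEq F]

/-- The composition of the maps `x ↦ x ^ 2 - c`. -/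
def iterSq : List F → F → F
  | [], x => x
  | c :: cs, x => iterSq cs (x ^ 2 - c)

/-- The fiber of `iterSq cs` over `t` is totally split. -/
def TotallySplit : List F → F → Prop
  | [], _ => True
  | c :: cs, t => TotallySplit cs t ∧ ∀ b, iterSq cs b = t → c + b ≠ 0 ∧ IsSquare (c + b)

/-- A square root, if there is one. -/
noncomputable def squareRoot (x : F) : F :=
  open Classical in if h : IsSquare x then h.choose else 0

theorem squareRoot_sq {x : F} (h : IsSquare x) : squareRoot x ^ 2 = x := by
  rw [squareRoot, dif_pos h, sq]; exact h.choose_spec.symm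

/-- The points of the fibers of `iterSq cs` over the elements of `ts`. -/
noncomputable def towerPoints : List F → List F → List F
  | [], ts => ts
  | c :: cs, ts =>
    let A := (towerPoints cs ts).map fun b => squareRoot (c + b)
    A ++ A.map Neg.neg

theorem length_towerPoints (cs ts : List F) :
    (towerPoints cs ts).length = 2 ^ cs.length * ts.length := by
  induction cs with
  | nil => simp [towerPoints]
  | cons c cs ih => simp only [towerPoints, List.length_append, List.length_map, ih,
      List.length_cons]; ring

theorem iterSq_mem_of_mem_towerPoints {cs ts : List F} (h : ∀ t ∈ ts, TotallySplit cs t) :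
    ∀ x ∈ towerPoints cs ts, iterSq cs x ∈ ts := by
  induction cs with
  | nil => intro x hx; exact hx
  | cons c cs ih =>
    have ih' := ih fun t ht => (h t ht).1
    have key : ∀ b ∈ towerPoints cs ts, iterSq cs (squareRoot (c + b) ^ 2 - c) ∈ ts := by
      intro b hb
      rw [squareRoot_sq ((h _ (ih' b hb)).2 b rfl).2, add_sub_cancel_left]
      exact ih' b hb
    intro x hx
    simp only [towerPoints, List.mem_append, List.mem_map] at hx
    rcases hx with ⟨b, hb, rfl⟩ | ⟨_, ⟨b, hb, rfl⟩, rfl⟩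
    · exact key b hb
    · simp only [iterSq, neg_sq]; exact key b hb

theorem map_sq_sub_sqrt {c : F} {cs ts : List F} (h : ∀ t ∈ ts, TotallySplit (c :: cs) t) :
    ((towerPoints cs ts).map fun b => squareRoot (c + b)).map (fun a => a ^ 2 - c) =
      towerPoints cs ts := by
  rw [List.map_map]
  conv_rhs => rw [← List.map_id (towerPoints cs ts)]
  refine List.map_congr_left fun b hb => ?_
  have := iterSq_mem_of_mem_towerPoints (fun t ht => (h t ht).1) b hb
  simp only [Function.comp, id]
  rw [squareRoot_sq ((h _ this).2 b rfl).2, add_sub_cancel_left]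

theorem squareRoot_ne_zero_of_mem {c : F} {cs ts : List F}
    (h : ∀ t ∈ ts, TotallySplit (c :: cs) t) :
    ∀ a ∈ (towerPoints cs ts).map (fun b => squareRoot (c + b)), a ≠ 0 := by
  intro a ha
  obtain ⟨b, hb, rfl⟩ := List.mem_map.1 ha
  have := iterSq_mem_of_mem_towerPoints (fun t ht => (h t ht).1) b hb
  obtain ⟨h1, h2⟩ := (h _ this).2 b rfl
  intro h0
  apply h1
  rw [← squareRoot_sq h2, h0]; simp

/-- Distinct b have distinct chosen roots, since squaring recovers c + b. A chosen root is never the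
negative of a chosen root: equal squares would force a = -a, but the roots are non-zero and 2 ≠ 0.
-/
theorem nodup_towerPoints (h2 : (2 : F) ≠ 0) {cs ts : List F} (hts : ts.Nodup)
    (h : ∀ t ∈ ts, TotallySplit cs t) : (towerPoints cs ts).Nodup := by
  induction cs with
  | nil => exact hts
  | cons c cs ih =>
    have hn := ih fun t ht => (h t ht).1
    have hmap := map_sq_sub_sqrt h
    have hne := squareRoot_ne_zero_of_mem h
    simp only [towerPoints]
    set A := (towerPoints cs ts).map fun b => squareRoot (c + b)
    have hinj : ∀ a ∈ A, ∀ b ∈ A, a ^ 2 = b ^ 2 → a = b := by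
      have hA : (A.map fun a => a ^ 2 - c).Nodup := by rw [hmap]; exact hn
      intro a ha b hb hab
      exact List.inj_on_of_nodup_map hA ha hb (by simp only [hab])
    have hAn : A.Nodup := by
      refine List.Nodup.of_map (fun a => a ^ 2 - c) ?_
      rw [hmap]; exact hn
    refine List.Nodup.append hAn (hAn.map neg_injective) ?_
    intro x hx hx'
    obtain ⟨y, hy, rfl⟩ := List.mem_map.1 hx'
    have := hinj _ hx _ hy (by simp)
    have h3 : (2 : F) * y = 0 := by linear_combination -this
    exact hne y hy ((mul_eq_zero.1 h3).resolve_left h2)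

/-- The bottom of the tower uses the dense Lagrange matrix on the points of `ts`. Every level
doubles the number of subproblems and adds a linear amount of work, as in the fast Fourier
transform. -/
theorem canExtend_towerPoints (h2 : (2 : F) ≠ 0) {cs ts ts' : List F} (hts : ts.Nodup)
    (hlen : ts.length = ts'.length)
    (h : ∀ t ∈ ts, TotallySplit cs t) (h' : ∀ t ∈ ts', TotallySplit cs t) :
    CanExtend (2 ^ cs.length * (ts.length * (3 * ts.length + 1 + 10 * cs.length)))
      (2 ^ cs.length * ts.length) (towerPoints cs ts) (towerPoints cs ts') := by
  induction cs with
  | nil =>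
    have := canExtend_lagrange (v := ts') hts
    simpa [towerPoints, ← hlen] using this
  | cons c cs ih =>
    have := canExtend_sqrt h2 (ih (fun t ht => (h t ht).1) (fun t ht => (h' t ht).1))
      (map_sq_sub_sqrt h) (map_sq_sub_sqrt h') (squareRoot_ne_zero_of_mem h)
      (by simp [length_towerPoints, hlen])
    simp only [List.length_map, length_towerPoints] at this
    obtain ⟨prog, hprog⟩ := this
    refine ⟨prog, fun mem l xs hl hxs => (hprog mem l xs hl hxs).mono fun out m t _ hQ => ?_⟩
    obtain ⟨ht, ys, hys, hyl, hy⟩ := hQ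
    refine ⟨ht.trans ?_, ys, hys, hyl, fun g hg => hy g ?_⟩
    · simp only [List.length_cons, pow_succ]
      nlinarith [Nat.zero_le (2 ^ cs.length * ts.length)]
    · refine hg.trans_le (le_of_eq ?_)
      simp only [List.length_cons]
      congr 1; ring

theorem card_fiber_iterSq_le (cs : List F) (t : F) :
    (Finset.univ.filter fun b => iterSq cs b = t).card ≤ 2 ^ cs.length := by
  classical
  induction cs with
  | nil =>
    refine Finset.card_le_one.2 fun a ha b hb => ?_
    exact (Finset.mem_filter.1 ha).2.trans (Finset.mem_filter.1 hb).2.symm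
  | cons c cs ih =>
    have hmaps : ∀ x ∈ Finset.univ.filter fun b => iterSq (c :: cs) b = t,
        x ^ 2 - c ∈ Finset.univ.filter fun b => iterSq cs b = t := by
      intro x hx
      exact Finset.mem_filter.2 ⟨Finset.mem_univ _, (Finset.mem_filter.1 hx).2⟩
    have := Finset.card_le_mul_card_image_of_maps_to (f := fun x => x ^ 2 - c) hmaps 2 ?_
    · rw [List.length_cons, pow_succ']
      exact this.trans (Nat.mul_le_mul_left _ ih)
    · intro b _
      refine le_trans (Finset.card_le_card (t := (Polynomial.nthRoots 2 (b + c)).toFinset) ?_)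
        ((Multiset.toFinset_card_le _).trans (Polynomial.card_nthRoots 2 (b + c)))
      intro x hx
      rw [Multiset.mem_toFinset, Polynomial.mem_nthRoots (by norm_num)]
      rw [← (Finset.mem_filter.1 hx).2]; ring

end Tower

/-! ### Existence of towers with many totally split fibers -/

section TowerExistence

variable {p : ℕ} [Fact p.Prime]

theorem le_card_forall_isSquare_add_of_card_le (hodd : p ≠ 2) {B : Finset (ZMod p)} {n : ℕ}
    (hB : B.card ≤ n) (hp : 2 ^ (16 * n) ≤ p) :
    p ≤ 2 ^ (n + 1) *
      (Finset.univ.filter fun c : ZMod p => ∀ b ∈ B, c + b ≠ 0 ∧ IsSquare (c + b)).card := by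
  rcases B.eq_empty_or_nonempty with rfl | hne
  · simp only [Finset.notMem_empty, false_imp_iff, implies_true, Finset.filter_true,
      Finset.card_univ, ZMod.card]
    exact Nat.le_mul_of_pos_left _ (by positivity)
  · refine (le_card_forall_isSquare_add hodd hne (le_trans ?_ hp)).trans ?_
    · exact Nat.pow_le_pow_right (by norm_num) (by omega)
    · exact Nat.mul_le_mul_right _ (Nat.pow_le_pow_right (by norm_num) (by omega))

open Classical in
-- The levels are added one by one by averaging. Over each good t the fiber has at most 2^k points,
-- so a proportion of at least 2^(-(2^k+1)) of all c makes the next level split; some c does this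
-- for at least that proportion of the good t. The exponents 2^k + 1 add up to 2^k + k in the
-- statement.
theorem exists_tower (hodd : p ≠ 2) (k : ℕ) (hp : 2 ^ (16 * 2 ^ k) ≤ p) :
    ∃ cs : List (ZMod p), cs.length = k ∧
      p ≤ 2 ^ (2 ^ k + k) * (Finset.univ.filter fun t => TotallySplit cs t).card := by
  induction k with
  | zero =>
    refine ⟨[], rfl, ?_⟩
    have : (Finset.univ.filter fun t : ZMod p => TotallySplit [] t) = Finset.univ :=
      Finset.filter_true_of_mem fun _ _ => trivial
    rw [this, Finset.card_univ, ZMod.card]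
    exact Nat.le_mul_of_pos_left _ (by positivity)
  | succ k ih =>
    have hle : 2 ^ (16 * 2 ^ k) ≤ p := le_trans (Nat.pow_le_pow_right (by norm_num) (by
      rw [pow_succ]; omega)) hp
    obtain ⟨cs, hcs, hcard⟩ := ih hle
    set S := Finset.univ.filter fun t : ZMod p => TotallySplit cs t with hS
    set n := 2 ^ k with hn
    have hgood : ∀ t, p ≤ 2 ^ (n + 1) * (Finset.univ.filter fun c : ZMod p =>
        ∀ b, iterSq cs b = t → c + b ≠ 0 ∧ IsSquare (c + b)).card := by
      intro t
      have h1 := card_fiber_iterSq_le cs t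
      rw [hcs] at h1
      have h2 := le_card_forall_isSquare_add_of_card_le hodd h1 hle
      simpa using h2
    -- Double counting of the pairs (t, c) with t good for the old tower and c extending the
    -- splitting over t.
    have hdouble : ∑ t ∈ S, (Finset.univ.filter fun c : ZMod p =>
        ∀ b, iterSq cs b = t → c + b ≠ 0 ∧ IsSquare (c + b)).card =
        ∑ c : ZMod p, (Finset.univ.filter fun t => TotallySplit (c :: cs) t).card := by
      have := Finset.sum_card_bipartiteAbove_eq_sum_card_bipartiteBelow (s := S)
        (t := (Finset.univ : Finset (ZMod p)))
        (fun t c => ∀ b, iterSq cs b = t → c + b ≠ 0 ∧ IsSquare (c + b))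
      simp only [Finset.bipartiteAbove, Finset.bipartiteBelow] at this
      rw [this]
      refine Finset.sum_congr rfl fun c _ => ?_
      congr 1
      ext t
      simp only [hS, Finset.mem_filter, Finset.mem_univ, true_and]
      rfl
    by_contra hcon
    push Not at hcon
    have hsum : ∑ c : ZMod p, 2 ^ (2 ^ (k + 1) + (k + 1)) *
        (Finset.univ.filter fun t => TotallySplit (c :: cs) t).card < ∑ _c : ZMod p, p := by
      refine Finset.sum_lt_sum_of_nonempty Finset.univ_nonempty fun c _ => ?_
      exact hcon (c :: cs) (by simp [hcs])
    rw [← Finset.mul_sum, ← hdouble, Finset.sum_const, Finset.card_univ, ZMod.card,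
      smul_eq_mul] at hsum
    have hlow : p * p ≤ 2 ^ (2 ^ (k + 1) + (k + 1)) * ∑ t ∈ S, (Finset.univ.filter
        fun c : ZMod p => ∀ b, iterSq cs b = t → c + b ≠ 0 ∧ IsSquare (c + b)).card := by
      calc p * p ≤ (2 ^ (n + k) * S.card) * p := Nat.mul_le_mul_right _ hcard
        _ = 2 ^ (n + k) * ∑ t ∈ S, p := by rw [Finset.sum_const, smul_eq_mul, mul_assoc]
        _ ≤ 2 ^ (n + k) * ∑ t ∈ S, (2 ^ (n + 1) * (Finset.univ.filter
            fun c : ZMod p => ∀ b, iterSq cs b = t → c + b ≠ 0 ∧ IsSquare (c + b)).card) :=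
            Nat.mul_le_mul_left _ (Finset.sum_le_sum fun t _ => hgood t)
        _ = _ := by
            rw [← Finset.mul_sum, ← mul_assoc, ← pow_add]
            congr 2
            rw [hn, pow_succ]; ring
    omega

/-- Two lists of points between which low-degree polynomials can be extended quickly. -/
theorem exists_canExtend (hodd : p ≠ 2) (k L : ℕ) (hp : 2 ^ (16 * 2 ^ k) ≤ p)
    (hL : 2 ^ (2 ^ k + k) * (2 * L) ≤ p) :
    ∃ u v : List (ZMod p), u.length = 2 ^ k * L ∧ v.length = 2 ^ k * L ∧ u.Nodup ∧ v.Nodup ∧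
      List.Disjoint u v ∧
      CanExtend (2 ^ k * (L * (3 * L + 1 + 10 * k))) (2 ^ k * L) u v ∧
      CanExtend (2 ^ k * (L * (3 * L + 1 + 10 * k))) (2 ^ k * L) v u := by
  classical
  have h2 : (2 : ZMod p) ≠ 0 :=
    Ring.two_ne_zero (by rw [ZMod.ringChar_zmod_n]; exact hodd)
  obtain ⟨cs, hcs, hcard⟩ := exists_tower hodd k hp
  set S := Finset.univ.filter fun t : ZMod p => TotallySplit cs t with hS
  -- L base values for u and L others for v; fibers over different values are disjoint.
  have hSL : 2 * L ≤ S.card := le_of_mul_le_mul_left (hL.trans hcard) (by positivity)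
  obtain ⟨S', hS', hS'c⟩ := Finset.exists_subset_card_eq hSL
  set ts := S'.toList.take L
  set ts' := S'.toList.drop L
  have hSlen : S'.toList.length = 2 * L := by rw [Finset.length_toList, hS'c]
  have htl : ts.length = L := by simp only [ts, List.length_take, hSlen]; omega
  have htl' : ts'.length = L := by simp only [ts', List.length_drop, hSlen]; omega
  have hnd : (ts ++ ts').Nodup := by
    rw [List.take_append_drop]; exact Finset.nodup_toList S'
  obtain ⟨hn, hn', hdis⟩ := List.nodup_append'.1 hnd
  have hsp : ∀ t ∈ ts, TotallySplit cs t := fun t ht => by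
    have := hS' (Finset.mem_toList.1 (List.mem_of_mem_take ht)); simpa [hS] using this
  have hsp' : ∀ t ∈ ts', TotallySplit cs t := fun t ht => by
    have := hS' (Finset.mem_toList.1 (List.mem_of_mem_drop ht)); simpa [hS] using this
  refine ⟨towerPoints cs ts, towerPoints cs ts', ?_, ?_, nodup_towerPoints h2 hn hsp,
    nodup_towerPoints h2 hn' hsp', ?_, ?_, ?_⟩
  · rw [length_towerPoints, hcs, htl]
  · rw [length_towerPoints, hcs, htl']
  · intro x hx hx'
    exact hdis (iterSq_mem_of_mem_towerPoints hsp x hx) (iterSq_mem_of_mem_towerPoints hsp' x hx')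
  · have := canExtend_towerPoints h2 hn (htl.trans htl'.symm) hsp hsp'
    rwa [hcs, htl] at this
  · have := canExtend_towerPoints h2 hn' (htl'.trans htl.symm) hsp' hsp
    rwa [hcs, htl'] at this

end TowerExistence

/-! ### Gcd and division by elimination of constant terms -/

section Euclid

open Polynomial

variable {F : Type} [Field F] [Fintype F] [DecidableEq F]

/-- Eliminate the head of the list `a :: as` by a multiple of the list `b :: bs`. Returns the
quotient of the heads and the remaining list (`z` is the address of a zero). -/
def elimHead (z a : ℕ) (as : List ℕ) (b : ℕ) (bs : List ℕ) : Alg F (ℕ × List ℕ) := do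
  let q ← exec (.div a b)
  let s ← scaleList q bs
  let r ← subList z as s
  pure (q, r)

theorem holds_elimHead {z a b : ℕ} {as bs : List ℕ} {mem xs ys : List F} {x y : F}
    (hz : mem[z]? = some 0) (hx : mem[a]? = some x) (hy : mem[b]? = some y)
    (hxs : Rep mem as xs) (hys : Rep mem bs ys) :
    (elimHead z a as b bs).Holds mem fun r m t => m[r.1]? = some (x / y) ∧ ∃ zs, Rep m r.2 zs ∧
      zs.length = max xs.length ys.length ∧
      (y ≠ 0 → toPoly (x :: xs) = C (x / y) * toPoly (y :: ys) + X * toPoly zs) ∧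
      t ≤ 2 * ys.length + 1 := by
  refine (holds_div hx hy).bind fun q m1 t1 i1 hq => ?_
  refine (holds_scaleList hq.1 (hys.mono i1)).bind fun s m2 t2 i2 hs => ?_
  refine (holds_subList (getElem?_mono hz (i1.trans i2)) (hxs.mono (i1.trans i2)) hs.1).bind
    fun r m3 t3 i3 hr => ?_
  obtain ⟨zs, hzs, hlen, hpoly, ht⟩ := hr
  refine Alg.holds_pure ⟨getElem?_mono hq.1 (i2.trans i3), zs, hzs, by simpa using hlen, ?_, ?_⟩
  · intro hy0
    rw [hpoly, toPoly_map_mul]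
    simp only [toPoly]
    have : C x = C (x / y) * C y := by rw [← C_mul, div_mul_cancel₀ _ hy0]
    rw [this]; ring
  · have := hq.2
    have := hs.2
    rw [List.length_map] at ht
    omega

/-- The first `n` coefficients of the quotient of two power series. -/
def divSeries (z : ℕ) : ℕ → List ℕ → List ℕ → Alg F (List ℕ)
  | n + 1, a :: as, b :: bs => do
      let r ← elimHead z a as b bs
      let qs ← divSeries z n r.2 (b :: bs)
      pure (r.1 :: qs)
  | n, _, _ => pure (List.replicate n z)

/-- The cost and the length are controlled even for y = 0, when the output is meaningless. Later
bounds need this, because they must hold for all random choices. -/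
theorem holds_divSeries {z b : ℕ} {bs : List ℕ} {n : ℕ} : ∀ {l : List ℕ} {mem xs ys : List F}
    {y : F}, mem[z]? = some 0 → Rep mem l xs → mem[b]? = some y → Rep mem bs ys →
    (divSeries z n l (b :: bs)).Holds mem fun out m t => ∃ qs, Rep m out qs ∧ qs.length = n ∧
      (y ≠ 0 → ∃ W, toPoly xs = toPoly qs * toPoly (y :: ys) + X ^ n * W) ∧
      t ≤ n * (2 * ys.length + 1) := by
  induction n with
  | zero =>
    intro l mem xs ys y hz _ _ _
    have : divSeries z 0 l (b :: bs) = (pure [] : Alg F (List ℕ)) := by cases l <;> rfl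
    rw [this]
    exact Alg.holds_pure ⟨[], Rep.nil, rfl, fun _ => ⟨toPoly xs, by simp [toPoly]⟩, Nat.zero_le _⟩
  | succ n ih =>
    intro l mem xs ys y hz h hy hys
    cases h with
    | nil =>
      exact Alg.holds_pure ⟨_, Rep.replicate _ hz, by simp, fun _ => ⟨0, by
        rw [toPoly_replicate_zero]; simp [toPoly]⟩, Nat.zero_le _⟩
    | cons hx h =>
      refine (holds_elimHead hz hx hy h hys).bind fun r m t hm hr => ?_
      obtain ⟨hq, zs, hzs, _, hpoly, ht⟩ := hr
      refine (ih (getElem?_mono hz hm) hzs (getElem?_mono hy hm) (hys.mono hm)).bind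
        fun qs m' t' hm' hqs => ?_
      obtain ⟨qv, hqv, hqlen, hqpoly, ht'⟩ := hqs
      refine Alg.holds_pure ⟨_, Rep.cons (getElem?_mono hq hm') hqv, by simp [hqlen], ?_, ?_⟩
      · intro hy0
        obtain ⟨W, hW⟩ := hqpoly hy0
        refine ⟨W, ?_⟩
        rw [hpoly hy0, hW]
        conv_rhs => rw [toPoly]
        ring
      · rw [Nat.succ_mul]; omega

/-- A greatest common divisor up to powers of `X`, by elimination of constant terms. -/
def gcdList (z : ℕ) : ℕ → List ℕ → List ℕ → Alg F (List ℕ)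
  | 0, _, _ => pure []
  | _ + 1, [], bs => pure bs
  | _ + 1, as, [] => pure as
  | n + 1, a :: as, b :: bs => do
      let ta ← testZero a
      if ta then gcdList z n as (b :: bs) else do
        let tb ← testZero b
        if tb then gcdList z n (a :: as) bs
        else if bs.length ≤ as.length then do
          let r ← elimHead z a as b bs
          gcdList z n r.2 (b :: bs)
        else do
          let r ← elimHead z b bs a as
          gcdList z n (a :: as) r.2

/-- Every step drops a head that is zero or has been eliminated, from a list that is not shorter
than the other one in the case of elimination. So the total length, which the fuel n exceeds,
decreases. Dropping a head divides by X, which keeps every common zero α ≠ 0. -/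
theorem holds_gcdList {z M n : ℕ} : ∀ {l l' : List ℕ} {mem xs ys : List F},
    mem[z]? = some 0 → Rep mem l xs → Rep mem l' ys → xs.length + ys.length < n →
    xs.length ≤ M → ys.length ≤ M →
    (gcdList z n l l').Holds mem fun out m t => ∃ gs, Rep m out gs ∧ gs.length ≤ M ∧
      toPoly gs ∣ toPoly xs ∧ toPoly gs ∣ toPoly ys ∧
      (∀ α ≠ 0, (toPoly xs).eval α = 0 → (toPoly ys).eval α = 0 → (toPoly gs).eval α = 0) ∧
      t ≤ n * (2 * M + 3) := by
  induction n with
  | zero => intro l l' mem xs ys _ _ _ hn; omega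
  | succ n ih =>
    intro l l' mem xs ys hz h h' hn hxM hyM
    have hX : ∀ (α : F), α ≠ 0 → ∀ P : F[X], (X * P).eval α = 0 → P.eval α = 0 := by
      intro α hα P hP
      rw [eval_mul, eval_X] at hP
      exact (mul_eq_zero.1 hP).resolve_left hα
    cases h with
    | nil =>
      exact Alg.holds_pure ⟨ys, h', hyM, by simp [toPoly], dvd_rfl, fun _ _ _ h => h,
        Nat.zero_le _⟩
    | @cons a x as xs hx h =>
    cases h' with
    | nil =>
      exact Alg.holds_pure ⟨_, Rep.cons hx h, hxM, dvd_rfl, by simp [toPoly], fun _ _ h _ => h,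
        Nat.zero_le _⟩
    | @cons b y bs ys hy h' =>
    simp only [List.length_cons] at hn hxM hyM
    have hstep : (n + 1) * (2 * M + 3) = n * (2 * M + 3) + (2 * M + 3) := Nat.succ_mul _ _
    simp only [gcdList]
    refine (holds_testZero hx).bind fun ta m1 t1 i1 hta => ?_
    obtain ⟨rfl, rfl, rfl⟩ := hta
    by_cases hx0 : x = 0
    · simp only [hx0, decide_true, if_true]
      refine (ih hz h (Rep.cons hy h') (by simp only [List.length_cons]; omega) (by omega)
        (by simpa using hyM)).mono fun out m t hm hQ => ?_
      obtain ⟨gs, hgs, hM, hd, hd', hr, ht⟩ := hQ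
      refine ⟨gs, hgs, hM, ?_, hd', ?_, by omega⟩
      · simpa [toPoly] using hd.mul_left X
      · intro α hα h1 h2
        simp only [toPoly, map_zero, zero_add] at h1
        exact hr α hα (hX α hα _ h1) h2
    simp only [hx0, decide_false, Bool.false_eq_true, if_false]
    refine (holds_testZero hy).bind fun tb m2 t2 i2 htb => ?_
    obtain ⟨rfl, rfl, rfl⟩ := htb
    by_cases hy0 : y = 0
    · simp only [hy0, decide_true, if_true]
      refine (ih hz (Rep.cons hx h) h' (by simp only [List.length_cons]; omega)
        (by simpa using hxM) (by omega)).mono fun out m t hm hQ => ?_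
      obtain ⟨gs, hgs, hM, hd, hd', hr, ht⟩ := hQ
      refine ⟨gs, hgs, hM, hd, ?_, ?_, by omega⟩
      · simpa [toPoly] using hd'.mul_left X
      · intro α hα h1 h2
        simp only [toPoly, map_zero, zero_add] at h2
        exact hr α hα h1 (hX α hα _ h2)
    simp only [hy0, decide_false, Bool.false_eq_true, if_false]
    have e1 := h.length_eq
    have e2 := h'.length_eq
    split_ifs with hle
    · refine (holds_elimHead hz hx hy h h').bind fun r m t hm hr => ?_
      obtain ⟨hq, zs, hzs, hlen, hpoly, ht⟩ := hr
      have hpoly := hpoly hy0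
      refine (ih (getElem?_mono hz hm) hzs (Rep.mono (Rep.cons hy h') hm)
        (by simp only [List.length_cons]; omega) (by omega) (by simpa using hyM)).mono
        fun out m' t' hm' hQ => ?_
      obtain ⟨gs, hgs, hM, hd, hd', hr, ht'⟩ := hQ
      refine ⟨gs, hgs, hM, ?_, hd', ?_, by omega⟩
      · rw [hpoly]; exact dvd_add (hd'.mul_left _) (hd.mul_left _)
      · intro α hα h1 h2
        refine hr α hα (hX α hα _ ?_) h2
        rw [hpoly, eval_add, eval_mul, h2, mul_zero, zero_add] at h1
        exact h1
    · refine (holds_elimHead hz hy hx h' h).bind fun r m t hm hr => ?_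
      obtain ⟨hq, zs, hzs, hlen, hpoly, ht⟩ := hr
      have hpoly := hpoly hx0
      refine (ih (getElem?_mono hz hm) (Rep.mono (Rep.cons hx h) hm) hzs
        (by simp only [List.length_cons]; omega) (by simpa using hxM) (by omega)).mono
        fun out m' t' hm' hQ => ?_
      obtain ⟨gs, hgs, hM, hd, hd', hr, ht'⟩ := hQ
      refine ⟨gs, hgs, hM, hd, ?_, ?_, by omega⟩
      · rw [hpoly]; exact dvd_add (hd.mul_left _) (hd'.mul_left _)
      · intro α hα h1 h2
        refine hr α hα h1 (hX α hα _ ?_)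
        rw [hpoly, eval_add, eval_mul, h1, mul_zero, zero_add] at h2
        exact h2

theorem holds_stripX {l : List ℕ} : ∀ {mem xs : List F}, Rep mem l xs →
    (stripX l : Alg F (List ℕ)).Holds mem fun out m t =>
      Rep m out (xs.dropWhile (· = 0)) ∧ t ≤ xs.length := by
  induction l with
  | nil => intro mem xs h; cases h; exact Alg.holds_pure ⟨Rep.nil, le_rfl⟩
  | cons a l ih =>
    intro mem xs h
    cases h with
    | @cons _ x _ xs hx h =>
    simp only [stripX]
    refine (holds_testZero hx).bind fun ta m1 t1 i1 hta => ?_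
    obtain ⟨rfl, rfl, rfl⟩ := hta
    by_cases hx0 : x = 0
    · simp only [hx0, decide_true, if_true]
      refine (ih h).mono fun out m t hm hQ => ?_
      refine ⟨by simpa using hQ.1, ?_⟩
      have := hQ.2
      simp only [List.length_cons]; omega
    · simp only [hx0, decide_false, Bool.false_eq_true, if_false]
      refine Alg.holds_pure ⟨?_, by simp⟩
      rw [List.dropWhile_cons_of_neg (by simpa using hx0)]
      exact Rep.cons hx h

/-- Remove the zeros at the end of a list of coefficients. -/
def trimTop (l : List ℕ) : Alg F (List ℕ) := do
  let r ← stripX l.reverse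
  pure r.reverse

theorem toPoly_rdropWhile (xs : List F) : toPoly (xs.rdropWhile (· = 0)) = toPoly xs := by
  induction xs using List.reverseRecOn with
  | nil => simp
  | append_singleton xs x ih =>
    by_cases hx : x = 0
    · rw [List.rdropWhile_concat_pos _ _ _ (by simpa using hx), ih, toPoly_append, hx]
      simp [toPoly]
    · rw [List.rdropWhile_concat_neg _ _ _ (by simpa using hx)]

theorem getLast_rdropWhile_ne_zero {xs : List F} (h : xs.rdropWhile (· = 0) ≠ []) :
    (xs.rdropWhile (· = 0)).getLast h ≠ 0 := by
  have := List.rdropWhile_last_not (fun x : F => decide (x = 0)) xs h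
  simpa using this

theorem natDegree_toPoly {xs : List F} (h : xs ≠ []) (hl : xs.getLast h ≠ 0) :
    (toPoly xs).natDegree + 1 = xs.length := by
  have hpos : 0 < xs.length := List.length_pos_iff.2 h
  have h1 : (toPoly xs).coeff (xs.length - 1) ≠ 0 := by
    rw [coeff_toPoly, List.getD_eq_getElem _ _ (by omega), ← List.getLast_eq_getElem h]
    exact hl
  have h2 := le_natDegree_of_ne_zero h1
  have h3 : toPoly xs ≠ 0 := by rintro h0; rw [h0] at h1; simp at h1
  have h4 := (natDegree_lt_iff_degree_lt h3).2 (degree_toPoly_lt xs)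
  omega

theorem holds_trimTop {l : List ℕ} {mem xs : List F} (h : Rep mem l xs) :
    (trimTop l : Alg F (List ℕ)).Holds mem fun out m t => ∃ ys, Rep m out ys ∧
      toPoly ys = toPoly xs ∧ (∀ hne : ys ≠ [], ys.getLast hne ≠ 0) ∧ ys.length ≤ xs.length ∧
      t ≤ xs.length := by
  refine (holds_stripX h.reverse).bind fun out m t _ hQ => ?_
  refine Alg.holds_pure ⟨xs.rdropWhile (· = 0), hQ.1.reverse, toPoly_rdropWhile xs,
    fun hne => getLast_rdropWhile_ne_zero hne, ?_, ?_⟩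
  · exact (List.rdropWhile_prefix _ _).length_le
  · simpa using hQ.2

end Euclid

/-! ### Repeated squaring with a multiplication that introduces a scaling factor -/

section Power

variable {F : Type} [Field F] [Fintype F] [DecidableEq F]

/-- Repeated squaring with respect to a multiplication program. -/
def powProg (mul : List ℕ → List ℕ → Alg F (List ℕ)) (n : ℕ) (l : List ℕ) : Alg F (List ℕ) :=
  if n ≤ 1 then pure l else do
    let r ← powProg mul (n / 2) l
    let s ← mul r r
    if n % 2 = 1 then mul s l else pure s
termination_by n
decreasing_by omega

/-- A multiplication program on lists of `m` field elements that represent functions on a set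
of points `R` (by the relation `Enc`), up to the factor `z⁻¹`. -/
def IsScaledMul (mem₀ : List F) (m T : ℕ) (R : Set F) (z : F → F) (Enc : List F → (F → F) → Prop)
    (mul : List ℕ → List ℕ → Alg F (List ℕ)) : Prop :=
  ∀ mem, mem₀ <+: mem → ∀ l l' xs ys, Rep mem l xs → Rep mem l' ys → xs.length = m →
    ys.length = m → (mul l l').Holds mem fun out mem' t => t ≤ T ∧ ∃ zs, Rep mem' out zs ∧
      zs.length = m ∧ ∀ φ ψ, Enc xs φ → Enc ys ψ →
        ∃ χ, Enc zs χ ∧ ∀ α ∈ R, z α * χ α = φ α * ψ α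

/-- If products come with a factor z⁻¹, then the functions divided by z multiply in the ordinary
way. Hence the result is z (φ/z)^n. -/
theorem holds_powProg {mem₀ : List F} {m T : ℕ} {R : Set F} {z : F → F}
    {Enc : List F → (F → F) → Prop} {mul : List ℕ → List ℕ → Alg F (List ℕ)}
    (hmul : IsScaledMul mem₀ m T R z Enc mul) (n : ℕ) (hn : 0 < n) :
    ∀ {mem xs : List F} {l : List ℕ}, mem₀ <+: mem → Rep mem l xs → xs.length = m →
    (powProg mul n l).Holds mem fun out mem' t => t ≤ 2 * Nat.log 2 n * T ∧ ∃ zs, Rep mem' out zs ∧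
      zs.length = m ∧ ∀ φ, Enc xs φ → ∃ χ, Enc zs χ ∧
        ∀ α ∈ R, z α ≠ 0 → χ α = z α * (φ α / z α) ^ n := by
  induction n using Nat.strong_induction_on with
  | _ n ih =>
  intro mem xs l h0 h hlen
  rw [powProg]
  split_ifs with h1 h2
  · obtain rfl : n = 1 := by omega
    refine Alg.holds_pure ⟨Nat.zero_le _, xs, h, hlen, fun φ hφ => ⟨φ, hφ, fun α _ hz => ?_⟩⟩
    rw [pow_one, mul_div_cancel₀ _ hz]
  all_goals
    have hlog : Nat.log 2 n = Nat.log 2 (n / 2) + 1 := Nat.log_of_one_lt_of_le (by norm_num) (by omega)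
    refine (ih (n / 2) (by omega) (by omega) h0 h hlen).bind fun r m1 t1 i1 hr => ?_
    obtain ⟨ht1, rs, hrs, hrl, hrv⟩ := hr
    refine (hmul m1 (h0.trans i1) _ _ _ _ hrs hrs hrl hrl).bind fun s m2 t2 i2 hs => ?_
    obtain ⟨ht2, ss, hss, hsl, hsv⟩ := hs
  · refine (hmul m2 ((h0.trans i1).trans i2) _ _ _ _ hss (h.mono (i1.trans i2)) hsl hlen).mono
      fun o m3 t3 i3 ho => ?_
    obtain ⟨ht3, os, hos, hol, hov⟩ := ho
    refine ⟨?_, os, hos, hol, fun φ hφ => ?_⟩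
    · rw [hlog]; linarith
    · obtain ⟨χ, hχ, hχv⟩ := hrv φ hφ
      obtain ⟨χ', hχ', hχv'⟩ := hsv χ χ hχ hχ
      obtain ⟨χ'', hχ'', hχv''⟩ := hov χ' φ hχ' hφ
      refine ⟨χ'', hχ'', fun α hα hz => ?_⟩
      have e1 := hχv α hα hz
      have e2 := hχv' α hα
      have e3 := hχv'' α hα
      have hn2 : n = n / 2 + n / 2 + 1 := by omega
      rw [hn2, pow_succ, pow_add]
      rw [e1] at e2
      have e2' : χ' α = z α * ((φ α / z α) ^ (n / 2) * (φ α / z α) ^ (n / 2)) :=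
        mul_left_cancel₀ hz (by rw [e2]; ring)
      refine mul_left_cancel₀ hz ?_
      rw [e3, e2']
      generalize (φ α / z α) ^ (n / 2) = w
      field_simp
  · refine Alg.holds_pure ?_
    refine ⟨?_, ss, hss, hsl, fun φ hφ => ?_⟩
    · rw [hlog]; linarith
    · obtain ⟨χ, hχ, hχv⟩ := hrv φ hφ
      obtain ⟨χ', hχ', hχv'⟩ := hsv χ χ hχ hχ
      refine ⟨χ', hχ', fun α hα hz => ?_⟩
      have e1 := hχv α hα hz
      have e2 := hχv' α hα
      have hn2 : n = n / 2 + n / 2 := by omega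
      conv_rhs => rw [hn2, pow_add]
      rw [e1] at e2
      exact mul_left_cancel₀ hz (by rw [e2]; ring)

end Power

/-! ### Splitters, which separate zeros by a quadratic character -/

section Splitter

open Polynomial

variable {p : ℕ} [Fact p.Prime]

/-- `body` computes from the address of `δ` and the coefficients of a polynomial `f` of formal
degree `d` a polynomial that vanishes at a zero `α` of `f` if and only if `α + δ` is a non-zero
square, unless `f (s - δ) = 0` for some `s ∈ S`. -/
def IsSplitter (d T : ℕ) (S : List (ZMod p)) (body : ℕ → List ℕ → Alg (ZMod p) (List ℕ)) : Prop :=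
  ∀ (mem : List (ZMod p)) (a : ℕ) (δ : ZMod p) (l : List ℕ) (xs : List (ZMod p)),
    mem[a]? = some δ → Rep mem l xs → xs.length = d + 1 →
    (body a l).Holds mem fun out m t => t ≤ T ∧ ∃ es, Rep m out es ∧ es.length ≤ 4 * d ∧
      ((toPoly xs).eval 0 ≠ 0 → (∀ s ∈ S, (toPoly xs).eval (s - δ) ≠ 0) →
        ∀ α, (toPoly xs).eval α = 0 →
          ((toPoly es).eval α = 0 ↔ (α + δ) ^ ((p - 1) / 2) = 1))

/-- The unknown scaling is cancelled by comparison with the power of 1, computed by the same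
program. -/
theorem scaled_pow_sub_eq_zero_iff {F : Type} [Field F] {z β : F} (hz : z ≠ 0) (n : ℕ) :
    z * (β / z) ^ n - z * (1 / z) ^ n = 0 ↔ β ^ n = 1 := by
  rw [← mul_sub, mul_eq_zero, or_iff_right hz, div_pow, div_pow, one_pow, sub_eq_zero,
    div_left_inj' (pow_ne_zero _ hz)]

end Splitter

/-! ### Modular multiplication on values at two point sets -/

section ValueSplitter

open Polynomial

variable {F : Type} [Field F] [Fintype F] [DecidableEq F]

/-- Taylor shift: the coefficients of `f (X + δ)`. -/
def taylorShift (a : ℕ) : List ℕ → Alg F (List ℕ)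
  | [] => pure []
  | c :: cs => do
      let r ← taylorShift a cs
      let s ← scaleList a r
      addList (c :: r) s

theorem holds_taylorShift {a : ℕ} {l : List ℕ} : ∀ {mem xs : List F} {δ : F},
    mem[a]? = some δ → Rep mem l xs → (taylorShift a l).Holds mem fun out m t =>
      ∃ ys, Rep m out ys ∧ ys.length = xs.length ∧ toPoly ys = (toPoly xs).comp (X + C δ) ∧
        t ≤ 2 * xs.length * xs.length := by
  induction l with
  | nil =>
    intro mem xs δ _ h
    cases h
    exact Alg.holds_pure ⟨[], Rep.nil, rfl, by simp [toPoly], Nat.zero_le _⟩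
  | cons c l ih =>
    intro mem xs δ ha h
    cases h with
    | @cons _ x _ xs hx h =>
    refine (ih ha h).bind fun r m1 t1 i1 hr => ?_
    obtain ⟨ys, hys, hyl, hyp, ht⟩ := hr
    refine (holds_scaleList (getElem?_mono ha i1) hys).bind fun s m2 t2 i2 hs => ?_
    refine (holds_addList ((Rep.cons (getElem?_mono hx i1) hys).mono i2) hs.1).mono
      fun out m3 t3 i3 hQ => ?_
    obtain ⟨zs, hzs, hzl, hzp, ht3⟩ := hQ
    refine ⟨zs, hzs, ?_, ?_, ?_⟩
    · rw [hzl]; simp [hyl]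
    · rw [hzp, toPoly_map_mul]
      simp only [toPoly, hyp]
      simp only [add_comp, mul_comp, X_comp, C_comp]
      ring
    · have := hs.2
      rw [List.length_map] at ht3
      simp only [List.length_cons]
      nlinarith

/-- One multiplication modulo a polynomial, on values at the points `u` and `v`; `fu` and `fv`
are the addresses of the values of the modulus. -/
noncomputable def valueMul (ext ext' : List ℕ → Alg F (List ℕ)) (u v : List F) (fu fv : List ℕ)
    (l l' : List ℕ) : Alg F (List ℕ) := do
  let tu ← zipInstr .mul (l.take u.length) (l'.take u.length)
  let q ← zipInstr .div tu fu
  let q' ← ext q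
  let tv ← zipInstr .mul (l.drop u.length) (l'.drop u.length)
  let w ← zipInstr .mul q' fv
  let y ← zipInstr .sub tv w
  let zi ← constList (v.map fun x => ((u.map fun s => x - s).prod)⁻¹)
  let r ← zipInstr .mul y zi
  let r' ← ext' r
  pure (r' ++ r)

/-- Representation of functions by the values at the points `u` and `v` of a polynomial. -/
def ValueEnc (u v : List F) (δ : F) (R : Set F) (xs : List F) (φ : F → F) : Prop :=
  ∃ r : F[X], r.degree < u.length ∧ xs = (u ++ v).map (fun x => r.eval x) ∧
    ∀ α ∈ R, r.eval (α + δ) = φ α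

theorem exists_eval_eq {u : List F} (hu : u.Nodup) (w : F → F) :
    ∃ q : F[X], q.degree < u.length ∧ ∀ x ∈ u, q.eval x = w x := by
  refine ⟨Lagrange.interpolate u.toFinset id w, ?_, fun x hx => ?_⟩
  · rw [← List.toFinset_card_of_nodup hu]
    exact Lagrange.degree_interpolate_lt _ Function.injective_id.injOn
  · exact Lagrange.eval_interpolate_at_node w Function.injective_id.injOn (List.mem_toFinset.2 hx)

/-- Montgomery reduction with the radix ∏ (X - s), s ∈ u, in place of a power of X: q is chosen so
that r₁ r₂ - q f vanishes on u, and the degree of the exact quotient is again below |u|. -/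
theorem exists_mod_quotient {u : List F} (hu : u.Nodup) {f r₁ r₂ : F[X]}
    (hf : f.degree ≤ u.length) (h₁ : r₁.degree < u.length) (h₂ : r₂.degree < u.length)
    (hfu : ∀ x ∈ u, f.eval x ≠ 0) :
    ∃ q r : F[X], q.degree < u.length ∧ r.degree < u.length ∧
      (∀ x ∈ u, q.eval x = r₁.eval x * r₂.eval x / f.eval x) ∧
      (u.map fun s => (X - C s)).prod * r = r₁ * r₂ - q * f := by
  obtain ⟨q, hq, hqv⟩ := exists_eval_eq hu fun x => r₁.eval x * r₂.eval x / f.eval x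
  have hZ : (u.map fun s => (X - C s)).prod = ∏ s ∈ u.toFinset, (X - C s) :=
    (List.prod_toFinset _ hu).symm
  have hdvd : (u.map fun s => (X - C s)).prod ∣ r₁ * r₂ - q * f := by
    rw [hZ]
    refine Finset.prod_dvd_of_coprime ?_ fun s hs => ?_
    · intro a _ b _ hab
      exact pairwise_coprime_X_sub_C Function.injective_id hab
    · rw [dvd_iff_isRoot, IsRoot]
      have hs' := List.mem_toFinset.1 hs
      rw [eval_sub, eval_mul, eval_mul, hqv s hs', div_mul_cancel₀ _ (hfu s hs'), sub_self]
  obtain ⟨r, hr⟩ := hdvd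
  refine ⟨q, r, hq, ?_, hqv, hr.symm⟩
  have hZm : (u.map fun s => (X - C s)).prod.Monic := by
    rw [hZ]; exact monic_prod_of_monic _ _ fun s _ => monic_X_sub_C s
  have hZd : (u.map fun s => (X - C s)).prod.degree = (u.length : WithBot ℕ) := by
    rw [degree_eq_natDegree hZm.ne_zero, hZ,
      natDegree_prod_of_monic _ _ fun s _ => monic_X_sub_C s]
    simp [List.toFinset_card_of_nodup hu]
  by_contra hcon
  push Not at hcon
  have hPdeg : (r₁ * r₂ - q * f).degree < (u.length : WithBot ℕ) + u.length := by
    refine lt_of_le_of_lt (degree_sub_le _ _) (max_lt ?_ ?_)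
    · rw [degree_mul]
      by_cases h0 : r₂ = 0
      · rw [h0, degree_zero, WithBot.add_bot]; exact WithBot.bot_lt_coe (u.length + u.length)
      · exact WithBot.add_lt_add_of_lt_of_le (by simpa [degree_eq_bot] using h0) h₁ h₂.le
    · rw [degree_mul]
      by_cases hf0 : f = 0
      · rw [hf0, degree_zero, WithBot.add_bot]; exact WithBot.bot_lt_coe (u.length + u.length)
      · exact WithBot.add_lt_add_of_lt_of_le (by simpa [degree_eq_bot] using hf0) hq hf
  rw [hr, degree_mul, hZd] at hPdeg
  exact absurd hPdeg (not_lt.2 (by gcongr))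

/-- The quotient q is known on u and must be extended to v. There the radix does not vanish, so r
can be computed by division, and it is then extended back to u. At a zero of the modulus the radix
times r equals the product. The condition that f has no zero on u is part of the encoding, so the
cost bound is independent of it. -/
theorem isScaledMul_valueMul {u v : List F} (hu : u.Nodup) (hlen : u.length = v.length)
    (hdis : List.Disjoint u v) {T : ℕ} {ext ext' : List ℕ → Alg F (List ℕ)}
    (hext : ∀ (mem : List F) (l : List ℕ) (xs : List F),
      Rep mem l xs → xs.length = u.length → (ext l).Holds mem fun out m t =>
      t ≤ T ∧ ∃ ys, Rep m out ys ∧ ys.length = v.length ∧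
        ∀ g : F[X], g.degree < u.length → xs = u.map (fun x => g.eval x) →
          ys = v.map fun x => g.eval x)
    (hext' : ∀ (mem : List F) (l : List ℕ) (xs : List F),
      Rep mem l xs → xs.length = v.length → (ext' l).Holds mem fun out m t =>
      t ≤ T ∧ ∃ ys, Rep m out ys ∧ ys.length = u.length ∧
        ∀ g : F[X], g.degree < u.length → xs = v.map (fun x => g.eval x) →
          ys = u.map fun x => g.eval x)
    {mem₀ : List F} {fu fv : List ℕ} {f : F[X]} {δ : F} (hfdeg : f.degree ≤ u.length)
    (hfu : Rep mem₀ fu (u.map fun x => f.eval x)) (hfv : Rep mem₀ fv (v.map fun x => f.eval x)) :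
    IsScaledMul mem₀ (u.length + v.length) (2 * T + 7 * u.length)
      {α | f.eval (α + δ) = 0} (fun α => (u.map fun s => α + δ - s).prod)
      (fun xs φ => (∀ x ∈ u, f.eval x ≠ 0) ∧
        ValueEnc u v δ {α | f.eval (α + δ) = 0} xs φ)
      (valueMul ext ext' u v fu fv) := by
  intro mem h0 l l' xs ys hl hl' hxl hyl
  have hfu := hfu.mono h0
  have hfv := hfv.mono h0
  refine (holds_zipMul (hl.take u.length) (hl'.take u.length)).bind fun tu m1 t1 i1 htu => ?_
  refine (holds_zipDiv htu.1 (hfu.mono i1)).bind fun q m2 t2 i2 hq => ?_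
  refine (hext _ _ _ hq.1 (by simp [hxl, hyl])).bind fun q' m3 t3 i3 hq' => ?_
  obtain ⟨ht3, qs, hqs, hqsl, hqsv⟩ := hq'
  have j3 := (i1.trans i2).trans i3
  refine (holds_zipMul ((hl.mono j3).drop u.length) ((hl'.mono j3).drop u.length)).bind
    fun tv m4 t4 i4 htv => ?_
  refine (holds_zipMul (hqs.mono i4) (hfv.mono (j3.trans i4))).bind fun w m5 t5 i5 hw => ?_
  refine (holds_zipSub (htv.1.mono i5) hw.1).bind fun y m6 t6 i6 hy => ?_
  refine (holds_constList _ _).bind fun zi m7 t7 i7 hzi => ?_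
  refine (holds_zipMul (hy.1.mono i7) hzi.1).bind fun r m8 t8 i8 hr => ?_
  refine (hext' _ _ _ hr.1 (by simp [hxl, hyl, hqsl])).bind fun r' m9 t9 i9 hr' => ?_
  obtain ⟨ht9, rs, hrs, hrsl, hrsv⟩ := hr'
  refine Alg.holds_pure ⟨?_, _, hrs.append (hr.1.mono i9), ?_, ?_⟩
  · have e1 := htu.2
    have e2 := hq.2
    have e4 := htv.2
    have e5 := hw.2
    have e6 := hy.2
    have e7 := hzi.2
    have e8 := hr.2
    simp only [List.length_map, List.length_zipWith, List.length_take, List.length_drop, hxl, hyl,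
      hqsl] at e1 e2 e4 e5 e6 e7 e8
    omega
  · simp [hxl, hyl, hqsl, hrsl]
  · rintro φ ψ ⟨hfne, r₁, hd₁, rfl, hv₁⟩ ⟨-, r₂, hd₂, rfl, hv₂⟩
    obtain ⟨qq, rr, hqd, hrd, hqq, hrr⟩ := exists_mod_quotient hu hfdeg hd₁ hd₂ hfne
    have htake : ∀ g : F[X], ((u ++ v).map fun x => g.eval x).take u.length =
        u.map fun x => g.eval x := fun g => by
      rw [List.map_append, List.take_left' (by simp)]
    have hdrop : ∀ g : F[X], ((u ++ v).map fun x => g.eval x).drop u.length =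
        v.map fun x => g.eval x := fun g => by
      rw [List.map_append, List.drop_left' (by simp)]
    have hZev : ∀ x : F, ((u.map fun s => (X - C s)).prod).eval x = (u.map fun s => x - s).prod := by
      intro x
      rw [eval_list_prod, List.map_map]
      simp [Function.comp_def]
    have hqs1 : qs = v.map fun x => qq.eval x := by
      refine hqsv qq hqd ?_
      rw [htake, htake, zipWith_map_map, zipWith_map_map]
      exact List.map_congr_left fun x hx => (hqq x hx).symm
    have hrs1 : List.zipWith (fun x1 x2 => x1 * x2) (List.zipWith (fun x1 x2 => x1 - x2)
        (List.zipWith (fun x1 x2 => x1 * x2)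
          (((u ++ v).map fun x => r₁.eval x).drop u.length)
          (((u ++ v).map fun x => r₂.eval x).drop u.length))
        (List.zipWith (fun x1 x2 => x1 * x2) qs (v.map fun x => f.eval x)))
        (v.map fun x => ((u.map fun s => x - s).prod)⁻¹) = v.map fun x => rr.eval x := by
      rw [hdrop, hdrop, hqs1, zipWith_map_map, zipWith_map_map, zipWith_map_map, zipWith_map_map]
      refine List.map_congr_left fun x hx => ?_
      have hz : (u.map fun s => x - s).prod ≠ 0 := by
        rw [ne_eq, List.prod_eq_zero_iff]
        intro h
        obtain ⟨s, hs, hs'⟩ := List.mem_map.1 h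
        rw [sub_eq_zero] at hs'
        subst hs'
        exact hdis hs hx
      have := congrArg (eval x) hrr
      rw [eval_mul, hZev, eval_sub, eval_mul, eval_mul] at this
      rw [← this, mul_comm, inv_mul_cancel_left₀ hz]
    have hrs2 := hrsv rr hrd hrs1
    refine ⟨fun α => rr.eval (α + δ), ⟨hfne, rr, hrd, ?_, fun α _ => rfl⟩, fun α hα => ?_⟩
    · exact (congrArg₂ (· ++ ·) hrs2 hrs1).trans List.map_append.symm
    · have := congrArg (eval (α + δ)) hrr
      rw [eval_mul, hZev, eval_sub, eval_mul, eval_mul, hv₁ α hα, hv₂ α hα,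
        show f.eval (α + δ) = 0 from hα, mul_zero, sub_zero] at this
      exact this

end ValueSplitter

/-! ### The splitter on values -/

section ValueSplitter

open Polynomial

/-- The matrix of polynomial interpolation. -/
noncomputable def interpolationMatrix {F : Type} [Field F] [DecidableEq F] (u : List F) :
    List (List F) :=
  (List.range u.length).map fun k => u.map fun x => (Lagrange.basis u.toFinset id x).coeff k

theorem toPoly_map_coeff {F : Type} [Field F] [Fintype F] [DecidableEq F] {g : F[X]} {m : ℕ} (hg : g.degree < m) :
    toPoly ((List.range m).map fun k => g.coeff k) = g := by
  ext n
  rw [coeff_toPoly]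
  by_cases hn : n < m
  · rw [List.getD_eq_getElem _ _ (by simpa using hn)]; simp
  · rw [List.getD_eq_default _ _ (by simpa using hn)]
    exact (degree_lt_iff_coeff_zero _ _ |>.1 hg n (by omega)).symm

theorem toPoly_interpolationMatrix {F : Type} [Field F] [Fintype F] [DecidableEq F] {u : List F} (hu : u.Nodup)
    {g : F[X]} (hg : g.degree < u.length) :
    toPoly ((interpolationMatrix u).map fun r => dot r (u.map fun x => g.eval x)) = g := by
  conv_rhs => rw [← toPoly_map_coeff hg]
  congr 1
  rw [interpolationMatrix, List.map_map]
  refine List.map_congr_left fun k _ => ?_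
  simp only [Function.comp]
  rw [dot, zipWith_map_map, ← List.sum_toFinset _ hu]
  conv_rhs => rw [eq_sum_lagrange_basis hu hg, finsetSum_coeff]
  refine Finset.sum_congr rfl fun x _ => ?_
  rw [coeff_C_mul, mul_comm]

variable {p : ℕ} [Fact p.Prime]

/-- A splitter that works with values of polynomials. -/
noncomputable def valueSplitter (ext ext' : List ℕ → Alg (ZMod p) (List ℕ)) (u v : List (ZMod p))
    (a : ℕ) (l : List ℕ) : Alg (ZMod p) (List ℕ) := do
  let fu ← forEach (fun s => do
    let c ← exec (.const s)
    let x ← exec (.sub c a)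
    horner x l) u
  let fv ← forEach (fun s => do
    let c ← exec (.const s)
    let x ← exec (.sub c a)
    horner x l) v
  let cx ← constList (u ++ v)
  let c1 ← constList ((u ++ v).map fun _ => 1)
  let px ← powProg (valueMul ext ext' u v fu fv) ((p - 1) / 2) cx
  let p1 ← powProg (valueMul ext ext' u v fu fv) ((p - 1) / 2) c1
  let e ← zipInstr .sub (px.take u.length) (p1.take u.length)
  let co ← matVec (interpolationMatrix u) e
  taylorShift a co

/-- The point sets are fixed while δ is random, so the program works modulo f(X - δ), whose zeros
are α + δ, and raises X to the power. Interpolation and a Taylor shift by δ, both of quadratic cost,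
return to the original variable. A shift is bad only if f(X - δ) has a zero on u. -/
theorem isSplitter_valueSplitter (hp : 3 ≤ p) {u v : List (ZMod p)} (hu : u.Nodup)
    (hlen : u.length = v.length) (hdis : List.Disjoint u v) {T d : ℕ} (hd : 1 ≤ d)
    (hdu : d + 1 ≤ u.length) (hud : u.length ≤ 4 * d) (hext : CanExtend T u.length u v)
    (hext' : CanExtend T u.length v u) :
    ∃ body, IsSplitter d (4 * Nat.log 2 p * (2 * T + 7 * u.length) + 4 * u.length * d +
      5 * u.length * u.length + 18 * u.length) u body := by
  obtain ⟨ext, hext⟩ := hext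
  obtain ⟨ext', hext'⟩ := hext'
  refine ⟨valueSplitter ext ext' u v, ?_⟩
  intro mem a δ l xs ha hl hxl
  set f := toPoly xs with hf
  set m := u.length with hm
  set N := (p - 1) / 2 with hN
  have hN0 : 0 < N := by omega
  have hhorner : ∀ (s : ZMod p) (m : List (ZMod p)), mem <+: m →
      (do let c ← exec (.const s)
          let x ← exec (.sub c a)
          horner x l : Alg (ZMod p) ℕ).Holds m fun b m' t =>
        m'[b]? = some ((f.comp (X - C δ)).eval s) ∧ t ≤ 2 * d + 5 := by
    intro s m hm
    refine (holds_const s m).bind fun c m1 t1 i1 hc => ?_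
    refine (holds_sub hc.1 (getElem?_mono ha (hm.trans i1))).bind fun x m2 t2 i2 hx => ?_
    refine (holds_horner hx.1 (hl.mono ((hm.trans i1).trans i2))).mono fun b m3 t3 _ hb => ?_
    refine ⟨by rw [hb.1]; simp [hf], ?_⟩
    have := hb.2
    have := hc.2
    have := hx.2
    omega
  refine (holds_forEach fun s _ m hm => hhorner s m hm).bind fun fu m1 t1 i1 hfu => ?_
  refine (holds_forEach fun s _ m hm => hhorner s m (i1.trans hm)).bind fun fv m2 t2 i2 hfv => ?_
  refine (holds_constList _ _).bind fun cx m3 t3 i3 hcx => ?_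
  refine (holds_constList _ _).bind fun c1 m4 t4 i4 hc1 => ?_
  have hfdeg : (f.comp (X - C δ)).degree ≤ u.length := by
    refine degree_le_natDegree.trans ?_
    rw [natDegree_comp, natDegree_X_sub_C, mul_one]
    have h1 := degree_toPoly_lt xs
    rw [hxl] at h1
    by_cases h0 : f = 0
    · rw [h0]; simp
    · have := (natDegree_lt_iff_degree_lt h0).2 h1
      exact_mod_cast (by omega : f.natDegree ≤ u.length)
  have hmul := isScaledMul_valueMul hu hlen hdis hext hext' (mem₀ := m2) (δ := δ)
    hfdeg (hfu.1.mono i2) hfv.1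
  have hcl : (u ++ v).length = u.length + v.length := List.length_append
  refine (holds_powProg hmul N hN0 (i3.trans i4) (hcx.1.mono i4) hcl).bind
    fun px m5 t5 i5 hpx => ?_
  obtain ⟨ht5, xw, hxw, hxwl, hxwv⟩ := hpx
  refine (holds_powProg hmul N hN0 ((i3.trans i4).trans i5) (hc1.1.mono i5)
    (by rw [List.length_map, hcl])).bind fun p1 m6 t6 i6 hp1 => ?_
  obtain ⟨ht6, x1, hx1, hx1l, hx1v⟩ := hp1
  refine (holds_zipSub ((hxw.mono i6).take m) (hx1.take m)).bind fun e m7 t7 i7 he => ?_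
  have hrows : ∀ r ∈ interpolationMatrix u, r.length ≤ m := by
    intro r hr
    obtain ⟨k, _, rfl⟩ := List.mem_map.1 hr
    simp [hm]
  have hrl : (interpolationMatrix u).length = m := by simp [interpolationMatrix, hm]
  refine (holds_matVec hrows he.1).bind fun co m8 t8 i8 hco => ?_
  refine (holds_taylorShift (getElem?_mono ha ((((((((i1.trans i2).trans i3).trans i4).trans
    i5).trans i6).trans i7).trans i8))) hco.1).mono fun out m9 t9 i9 hout => ?_
  obtain ⟨es, hes, hesl, hesp, ht9⟩ := hout
  simp only [List.length_map, hrl] at hesl ht9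
  refine ⟨?_, es, hes, by omega, ?_⟩
  · have e1 := hfu.2
    have e2 := hfv.2
    have e3 := hcx.2
    have e4 := hc1.2
    have e7 := he.2
    have e8 := hco.2
    have hNp : Nat.log 2 N ≤ Nat.log 2 p := Nat.log_mono_right (by omega)
    have h5 : 2 * Nat.log 2 N * (2 * T + 7 * m) ≤ 2 * Nat.log 2 p * (2 * T + 7 * m) := by gcongr
    simp only [List.length_map, hcl, ← hlen, ← hm, hrl, List.length_take] at e1 e2 e3 e4 e7 e8
    have e7' : t7 ≤ m := e7.trans (min_le_left _ _)
    nlinarith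
  · intro hf0 hS α hα
    have hS' : ∀ x ∈ u, (f.comp (X - C δ)).eval x ≠ 0 := by
      intro x hx; simpa using hS x hx
    have hmem : α ∈ {α | (f.comp (X - C δ)).eval (α + δ) = 0} := by
      simpa using hα
    have hz : (u.map fun s => α + δ - s).prod ≠ 0 := by
      rw [ne_eq, List.prod_eq_zero_iff]
      intro h
      obtain ⟨s, hs, hs'⟩ := List.mem_map.1 h
      apply hS s hs
      rw [← sub_eq_zero.1 hs']
      simpa using hα
    obtain ⟨χw, ⟨-, rw', hrwd, hrwe, hrwv⟩, hχw⟩ := hxwv (fun α => α + δ)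
      ⟨hS', X, by rw [degree_X]; exact_mod_cast (by omega : 1 < u.length), by simp, by simp⟩
    obtain ⟨χo, ⟨-, ro', hrod, hroe, hrov⟩, hχo⟩ := hx1v (fun α => 1)
      ⟨hS', 1, by rw [degree_one]; exact_mod_cast (by omega : 0 < u.length), by simp, by simp⟩
    have htake : ∀ g : (ZMod p)[X], ((u ++ v).map fun x => g.eval x).take m =
        u.map fun x => g.eval x := fun g => by
      rw [List.map_append, List.take_left' (by simp [hm])]
    have hgdeg : (rw' - ro').degree < u.length :=
      lt_of_le_of_lt (degree_sub_le _ _) (max_lt hrwd hrod)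
    have hevals : List.zipWith (fun x1 x2 => x1 - x2) (xw.take m) (x1.take m) =
        u.map fun x => (rw' - ro').eval x := by
      rw [hrwe, hroe, htake, htake, zipWith_map_map]
      simp
    rw [hesp, hevals, toPoly_interpolationMatrix hu hgdeg, eval_comp, eval_sub]
    simp only [eval_add, eval_X, eval_C]
    rw [hrwv α hmem, hrov α hmem, hχw α hmem hz, hχo α hmem hz]
    exact scaled_pow_sub_eq_zero_iff hz N

end ValueSplitter

/-! ### Karatsuba multiplication and Montgomery reduction -/

section Karatsuba

open Polynomial

variable {F : Type} [Field F] [Fintype F] [DecidableEq F]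

theorem toPoly_take_add (xs : List F) (n : ℕ) :
    toPoly (xs.take n) + X ^ n * toPoly (xs.drop n) = toPoly xs := by
  by_cases hn : n ≤ xs.length
  · exact toPoly_take_add_drop xs n hn
  · rw [List.take_of_length_le (by omega), List.drop_of_length_le (by omega)]
    simp [toPoly]

theorem toPoly_shift (n : ℕ) (xs : List F) :
    toPoly (List.replicate n 0 ++ xs) = X ^ n * toPoly xs := by
  rw [toPoly_append, toPoly_replicate_zero, zero_add, List.length_replicate]

theorem toPoly_take_of_degree_lt {xs : List F} {n : ℕ} (h : (toPoly xs).degree < n) :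
    toPoly ((xs ++ List.replicate n 0).take n) = toPoly xs := by
  have hx : toPoly (xs ++ List.replicate n 0) = toPoly xs := by
    rw [toPoly_append, toPoly_replicate_zero, mul_zero, add_zero]
  ext m
  by_cases hm : m < n
  · rw [← hx, coeff_toPoly, coeff_toPoly, List.getD_eq_getElem?_getD, List.getD_eq_getElem?_getD,
      List.getElem?_take_of_lt hm]
  · rw [(degree_lt_iff_coeff_zero _ _).1 h m (by omega), coeff_toPoly,
      List.getD_eq_default _ _ (by simp; omega)]

/-- Karatsuba multiplication of polynomials with at most `2 ^ k` coefficients. -/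
def karatsuba (z : ℕ) : ℕ → List ℕ → List ℕ → Alg F (List ℕ)
  | 0, as, bs => zipInstr .mul as bs
  | k + 1, as, bs => do
      let p0 ← karatsuba z k (as.take (2 ^ k)) (bs.take (2 ^ k))
      let p2 ← karatsuba z k (as.drop (2 ^ k)) (bs.drop (2 ^ k))
      let s ← addList (as.take (2 ^ k)) (as.drop (2 ^ k))
      let s' ← addList (bs.take (2 ^ k)) (bs.drop (2 ^ k))
      let p1 ← karatsuba z k s s'
      let m ← subList z p1 p0
      let m' ← subList z m p2
      let r ← addList p0 (List.replicate (2 ^ k) z ++ m')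
      addList r (List.replicate (2 ^ k + 2 ^ k) z ++ p2)

/-- The additions and subtractions of one level cost at most 13 * 2^k. The term 13 * 2^k on the left
of the bound makes the recursion T(k+1) ≤ 3 T(k) + 13 * 2^k close exactly. -/
theorem holds_karatsuba {z : ℕ} (k : ℕ) : ∀ {l l' : List ℕ} {mem xs ys : List F},
    mem[z]? = some 0 → Rep mem l xs → Rep mem l' ys → xs.length ≤ 2 ^ k → ys.length ≤ 2 ^ k →
    (karatsuba z k l l').Holds mem fun out m t => ∃ zs, Rep m out zs ∧
      zs.length ≤ 2 ^ (k + 1) ∧ toPoly zs = toPoly xs * toPoly ys ∧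
      t + 13 * 2 ^ k ≤ 14 * 3 ^ k := by
  induction k with
  | zero =>
    intro l l' mem xs ys _ h h' hx hy
    refine (holds_zipMul h h').mono fun out m t _ hQ => ?_
    refine ⟨_, hQ.1, ?_, ?_, ?_⟩
    · rw [List.length_zipWith]; omega
    · match xs, ys, hx, hy with
      | [], _, _, _ => simp [toPoly]
      | _ :: _, [], _, _ => simp [toPoly]
      | [x], [y], _, _ => simp [toPoly]
    · have := hQ.2; omega
  | succ k ih =>
    intro l l' mem xs ys hz h h' hx hy
    have h2 : 2 ^ (k + 1) = 2 ^ k + 2 ^ k := by ring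
    have h3 : 3 ^ (k + 1) = 3 * 3 ^ k := by ring
    have h4 : 2 ^ (k + 1 + 1) = 2 ^ k + 2 ^ k + 2 ^ k + 2 ^ k := by ring
    have hdl : ∀ w : List F, w.length ≤ 2 ^ (k + 1) → (w.drop (2 ^ k)).length ≤ 2 ^ k := by
      intro w hw; rw [List.length_drop]; omega
    have htl : ∀ w : List F, (w.take (2 ^ k)).length ≤ 2 ^ k := by
      intro w; rw [List.length_take]; omega
    rw [h2] at ih
    refine (ih hz (h.take _) (h'.take _) (htl _) (htl _)).bind fun p0 m1 t1 i1 hp0 => ?_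
    obtain ⟨z0, hz0, hz0l, hz0p, ht1⟩ := hp0
    refine (ih (getElem?_mono hz i1) ((h.drop _).mono i1) ((h'.drop _).mono i1) (hdl _ hx)
      (hdl _ hy)).bind fun p2 m2 t2 i2 hp2 => ?_
    obtain ⟨z2, hz2, hz2l, hz2p, ht2⟩ := hp2
    have i12 := i1.trans i2
    refine (holds_addList ((h.take (2 ^ k)).mono i12) ((h.drop (2 ^ k)).mono i12)).bind
      fun s m3 t3 i3 hs => ?_
    obtain ⟨s1, hs1, hs1l, hs1p, ht3⟩ := hs
    have i13 := i12.trans i3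
    refine (holds_addList ((h'.take (2 ^ k)).mono i13) ((h'.drop (2 ^ k)).mono i13)).bind
      fun s' m4 t4 i4 hs' => ?_
    obtain ⟨s2, hs2, hs2l, hs2p, ht4⟩ := hs'
    refine (ih (getElem?_mono hz (i13.trans i4)) (hs1.mono i4) hs2
      (hs1l.le.trans (max_le (htl _) (hdl _ hx))) (hs2l.le.trans (max_le (htl _) (hdl _ hy)))).bind
      fun p1 m5 t5 i5 hp1 => ?_
    obtain ⟨z1, hz1, hz1l, hz1p, ht5⟩ := hp1
    have i25 := (i3.trans i4).trans i5
    have i15 := i1.trans (i2.trans i25)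
    refine (holds_subList (getElem?_mono hz i15) hz1 (hz0.mono (i2.trans i25))).bind
      fun m m6 t6 i6 hm => ?_
    obtain ⟨v1, hv1, hv1l, hv1p, ht6⟩ := hm
    refine (holds_subList (getElem?_mono hz (i15.trans i6)) hv1 (hz2.mono (i25.trans i6))).bind
      fun m' m7 t7 i7 hm' => ?_
    obtain ⟨v2, hv2, hv2l, hv2p, ht7⟩ := hm'
    have i27 := i25.trans (i6.trans i7)
    have hz7 := getElem?_mono hz (i12.trans i27)
    refine (holds_addList (hz0.mono (i2.trans i27)) (Rep.append (Rep.replicate (2 ^ k) hz7) hv2)).bind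
      fun r m8 t8 i8 hr => ?_
    obtain ⟨r1, hr1, hr1l, hr1p, ht8⟩ := hr
    refine (holds_addList hr1 (Rep.append (Rep.replicate (2 ^ k + 2 ^ k)
      (getElem?_mono hz7 i8)) (hz2.mono (i27.trans i8)))).mono fun out m9 t9 i9 ho => ?_
    obtain ⟨zs, hzs, hzsl, hzsp, ht9⟩ := ho
    simp only [List.length_append, List.length_replicate] at hr1l hzsl ht8 ht9
    have e1 := hdl _ hx
    have e2 := hdl _ hy
    refine ⟨zs, hzs, ?_, ?_, ?_⟩
    · omega
    · rw [hzsp, hr1p, toPoly_shift, toPoly_shift, hv2p, hv1p, hz1p, hz0p, hz2p, hs1p, hs2p,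
        ← toPoly_take_add xs (2 ^ k), ← toPoly_take_add ys (2 ^ k), pow_add]
      ring
    · omega

/-- Montgomery multiplication modulo the polynomial with coefficients `f`, with radix `X ^ d`. -/
def montgomeryMul (z k d : ℕ) (f J l l' : List ℕ) : Alg F (List ℕ) := do
  let t ← karatsuba z k l l'
  let q ← karatsuba z k (t.take d) J
  let y ← karatsuba z k (q.take d) f
  let w ← subList z t y
  pure ((w.drop d ++ List.replicate d z).take d)

/-- With J the inverse of f modulo X^d, subtracting (t J mod X^d) f from the product t clears its
lowest d coefficients, and the shift by d is the scaling α^d. An inverse exists only for f(0) ≠ 0,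
which the encoding therefore includes. -/
theorem isScaledMul_montgomeryMul {z k d : ℕ} {mem₀ fs Js : List F} {f J : List ℕ}
    (hz : mem₀[z]? = some 0) (hf : Rep mem₀ f fs) (hJ : Rep mem₀ J Js) (hfl : fs.length = d + 1)
    (hJl : Js.length = d) (hd : 1 ≤ d) (hk : d + 1 ≤ 2 ^ k)
    (hJf : (toPoly fs).eval 0 ≠ 0 → ∃ W, 1 = toPoly Js * toPoly fs + X ^ d * W) :
    IsScaledMul mem₀ d (44 * 3 ^ k) {α | (toPoly fs).eval α = 0} (fun α => α ^ d)
      (fun xs φ => (toPoly fs).eval 0 ≠ 0 ∧ ∀ α, φ α = (toPoly xs).eval α)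
      (montgomeryMul z k d f J) := by
  intro mem i0 l l' xs ys hx hy hxl hyl
  have h23 : 2 ^ k ≤ 3 ^ k := Nat.pow_le_pow_left (by norm_num) k
  have hk2 : 2 ^ (k + 1) = 2 * 2 ^ k := by ring
  have hz' := getElem?_mono hz i0
  refine (holds_karatsuba k hz' hx hy (by omega) (by omega)).bind fun t m1 t1 i1 ht => ?_
  obtain ⟨ts, hts, htsl, htsp, ht1⟩ := ht
  refine (holds_karatsuba k (getElem?_mono hz' i1) (hts.take d) (hJ.mono (i0.trans i1))
    (by rw [List.length_take]; omega) (by omega)).bind fun q m2 t2 i2 hq => ?_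
  obtain ⟨qs, hqs, hqsl, hqsp, ht2⟩ := hq
  have i12 := i1.trans i2
  refine (holds_karatsuba k (getElem?_mono hz' i12) (hqs.take d) (hf.mono (i0.trans i12))
    (by rw [List.length_take]; omega) (by omega)).bind fun y m3 t3 i3 hy => ?_
  obtain ⟨ws, hws, hwsl, hwsp, ht3⟩ := hy
  refine (holds_subList (getElem?_mono hz' (i12.trans i3)) (hts.mono (i2.trans i3)) hws).bind
    fun w m4 t4 i4 hw => ?_
  obtain ⟨vs, hvs, hvsl, hvsp, ht4⟩ := hw
  refine Alg.holds_pure ⟨by omega, _, ((hvs.drop d).append (Rep.replicate d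
    (getElem?_mono hz' ((i12.trans i3).trans i4)))).take d, by simp, ?_⟩
  rintro φ ψ ⟨hf0, hφ⟩ ⟨-, hψ⟩
  refine ⟨_, ⟨hf0, fun α => rfl⟩, fun α hα => ?_⟩
  obtain ⟨W, hW⟩ := hJf hf0
  have h1 := toPoly_take_add ts d
  have h2 := toPoly_take_add qs d
  have hdvd : X ^ d ∣ toPoly vs := by
    refine ⟨toPoly (ts.drop d) + toPoly (ts.take d) * W + toPoly (qs.drop d) * toPoly fs, ?_⟩
    rw [hvsp, hwsp, ← h1]
    have e : toPoly (qs.take d) = toPoly (ts.take d) * toPoly Js - X ^ d * toPoly (qs.drop d) := by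
      rw [← hqsp, ← h2]; ring
    rw [e]
    linear_combination (toPoly (ts.take d)) * hW
  have h3 := toPoly_take_add vs d
  have htake : toPoly (vs.take d) = 0 := by
    refine Polynomial.eq_zero_of_dvd_of_degree_lt ((dvd_add_left (dvd_mul_right _ _)).1
      (h3 ▸ hdvd)) ?_
    rw [degree_X_pow]
    refine (degree_toPoly_lt _).trans_le ?_
    exact_mod_cast (List.length_take_le d vs)
  rw [htake, zero_add] at h3
  have hlt : ∀ {us : List F} {n : ℕ}, us.length ≤ n + 1 → (toPoly us).natDegree ≤ n := by
    intro us n hu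
    refine natDegree_le_iff_coeff_eq_zero.2 fun m hm => ?_
    rw [coeff_toPoly, List.getD_eq_default _ _ (by omega)]
  have hdeg : (toPoly vs).natDegree < 2 * d := by
    have a1 : (toPoly ts).natDegree ≤ (d - 1) + (d - 1) := by
      rw [htsp]
      exact natDegree_mul_le.trans (add_le_add (hlt (by omega)) (hlt (by omega)))
    have a2 : (toPoly ws).natDegree ≤ (d - 1) + d := by
      rw [hwsp]
      refine natDegree_mul_le.trans (add_le_add (hlt ?_) (hlt (by omega)))
      have := List.length_take_le d qs
      omega
    have a3 := natDegree_sub_le (toPoly ts) (toPoly ws)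
    rw [← hvsp] at a3
    omega
  have hdrop : (toPoly (vs.drop d)).degree < d := by
    by_cases h0 : toPoly (vs.drop d) = 0
    · rw [h0, degree_zero]; exact WithBot.bot_lt_coe _
    · rw [← natDegree_lt_iff_degree_lt h0]
      rw [← h3, natDegree_mul (pow_ne_zero _ X_ne_zero) h0, natDegree_X_pow] at hdeg
      omega
  rw [toPoly_take_of_degree_lt hdrop, hφ, hψ, ← eval_mul, ← htsp]
  have e := congrArg (eval α) (h3.trans hvsp)
  rw [eval_mul, eval_pow, eval_X, eval_sub, hwsp, eval_mul, show (toPoly fs).eval α = 0 from hα,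
    mul_zero, sub_zero] at e
  exact e

end Karatsuba

/-! ### The splitter on coefficients -/

section MontgomerySplitter

open Polynomial

variable {p : ℕ} [Fact p.Prime]

/-- A splitter that uses Montgomery multiplication. -/
def montgomerySplitter (k d : ℕ) (a : ℕ) (l : List ℕ) : Alg (ZMod p) (List ℕ) := do
  let z ← exec (.const 0)
  let o ← exec (.const 1)
  let J ← divSeries z d [o] l
  let px ← powProg (montgomeryMul z k d l J) ((p - 1) / 2) (a :: o :: List.replicate (d - 2) z)
  let p1 ← powProg (montgomeryMul z k d l J) ((p - 1) / 2) (o :: List.replicate (d - 1) z)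
  subList z px p1

theorem isSplitter_montgomerySplitter (hp : 3 ≤ p) {k d : ℕ} (hd : 2 ≤ d) (hk : d + 1 ≤ 2 ^ k) :
    IsSplitter (p := p) d (176 * Nat.log 2 p * 3 ^ k + 2 * d * d + 2 * d + 2) []
      (montgomerySplitter k d) := by
  intro mem a δ l xs ha hl hxl
  have hN0 : 0 < (p - 1) / 2 := by omega
  refine (holds_const 0 mem).bind fun z m1 t1 i1 hz => ?_
  refine (holds_const 1 m1).bind fun o m2 t2 i2 ho => ?_
  have hz2 := getElem?_mono hz.1 i2
  obtain ⟨x, xs', rfl⟩ : ∃ x xs', xs = x :: xs' := by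
    cases xs with
    | nil => simp at hxl
    | cons x xs' => exact ⟨x, xs', rfl⟩
  obtain ⟨b, bs, rfl⟩ : ∃ b bs, l = b :: bs := by
    cases hl; exact ⟨_, _, rfl⟩
  have hl2 : Rep m2 (b :: bs) (x :: xs') := hl.mono (i1.trans i2)
  refine (holds_divSeries (n := d) hz2 (Rep.cons ho.1 Rep.nil) (List.forall₂_cons.1 hl2).1
    (List.forall₂_cons.1 hl2).2).bind fun J m3 t3 i3 hJ => ?_
  obtain ⟨Js, hJs, hJsl, hJsW, ht3⟩ := hJ
  have hz3 := getElem?_mono hz2 i3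
  have ho3 := getElem?_mono ho.1 i3
  have hx0 : (toPoly (x :: xs')).eval 0 = x := by simp [toPoly]
  have hmul := isScaledMul_montgomeryMul hz3 (hl2.mono i3) hJs hxl hJsl (by omega) hk (by
    rw [hx0]
    intro h
    obtain ⟨W, hW⟩ := hJsW h
    exact ⟨W, by rw [← hW]; simp [toPoly]⟩)
  have ha3 := getElem?_mono ha ((i1.trans i2).trans i3)
  -- The residue X + δ has the d coefficients δ, 1, 0, ..., 0, which requires d ≥ 2.
  refine (holds_powProg hmul _ hN0 (List.prefix_refl _)
    (Rep.cons ha3 (Rep.cons ho3 (Rep.replicate (d - 2) hz3))) (by simp; omega)).bind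
    fun px m4 t4 i4 hpx => ?_
  obtain ⟨ht4, xw, hxw, hxwl, hxwv⟩ := hpx
  refine (holds_powProg hmul _ hN0 i4
    ((Rep.cons ho3 (Rep.replicate (d - 1) hz3)).mono i4) (by simp; omega)).bind
    fun p1 m5 t5 i5 hp1 => ?_
  obtain ⟨ht5, x1, hx1, hx1l, hx1v⟩ := hp1
  refine (holds_subList (getElem?_mono hz3 (i4.trans i5)) (hxw.mono i5) hx1).mono
    fun out m6 t6 i6 hout => ?_
  obtain ⟨es, hes, hesl, hesp, ht6⟩ := hout
  refine ⟨?_, es, hes, by omega, ?_⟩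
  · have hNp : Nat.log 2 ((p - 1) / 2) ≤ Nat.log 2 p := Nat.log_mono_right (by omega)
    have h5 : 2 * Nat.log 2 ((p - 1) / 2) * (44 * 3 ^ k) ≤ 2 * Nat.log 2 p * (44 * 3 ^ k) := by
      gcongr
    have := hz.2
    have := ho.2
    have hxl' : xs'.length = d := by simpa using hxl
    rw [hxl'] at ht3
    have : d * (2 * d + 1) = 2 * d * d + d := by ring
    have : 2 * Nat.log 2 p * (44 * 3 ^ k) = 88 * (Nat.log 2 p * 3 ^ k) := by ring
    have : 176 * Nat.log 2 p * 3 ^ k = 176 * (Nat.log 2 p * 3 ^ k) := by ring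
    omega
  · intro hf0 _ α hα
    have hα0 : α ≠ 0 := by rintro rfl; exact hf0 hα
    have hz : α ^ d ≠ 0 := pow_ne_zero _ hα0
    obtain ⟨χw, ⟨-, hχwe⟩, hχw⟩ := hxwv (fun α => α + δ) ⟨hf0, fun α => by
      simp [toPoly, toPoly_replicate_zero, add_comm]⟩
    obtain ⟨χo, ⟨-, hχoe⟩, hχo⟩ := hx1v (fun α => 1) ⟨hf0, fun α => by
      simp [toPoly, toPoly_replicate_zero]⟩
    rw [hesp, eval_sub, ← hχwe, ← hχoe, hχw α hα hz, hχo α hα hz]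
    exact scaled_pow_sub_eq_zero_iff hz _

end MontgomerySplitter

/-! ### Choice of the splitter according to the sizes of p and d -/

section ChooseSplitter

/-- With e = log₂ d this absorbs the factor log p = O(log d) into the gap between the Karatsuba cost
3^e and d². The summand 3 makes the induction work from e = 0. -/
theorem add_three_mul_three_pow_le (e : ℕ) : (e + 3) * 3 ^ e ≤ 3 * 4 ^ e := by
  induction e with
  | zero => norm_num
  | succ e ih =>
    calc (e + 1 + 3) * 3 ^ (e + 1) = (3 * (e + 4)) * 3 ^ e := by ring
      _ ≤ (4 * (e + 3)) * 3 ^ e := Nat.mul_le_mul_right _ (by omega)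
      _ = 4 * ((e + 3) * 3 ^ e) := by ring
      _ ≤ 4 * (3 * 4 ^ e) := Nat.mul_le_mul_left _ ih
      _ = 3 * 4 ^ (e + 1) := by ring

variable {p : ℕ} [Fact p.Prime]

theorem exists_isSplitter_of_log_le (hp : 3 ≤ p) {d : ℕ} (hd : 2 ≤ d)
    (h : Nat.log 2 p ≤ 128 * Nat.log 2 d) :
    ∃ body T, IsSplitter (p := p) d T [] body ∧ T ≤ 250000 * (d * d) := by
  refine ⟨_, _, isSplitter_montgomerySplitter hp (k := Nat.log 2 d + 1) hd
    (Nat.lt_pow_succ_log_self (by norm_num) d), ?_⟩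
  have h1 := Nat.pow_log_le_self 2 (x := d) (by omega)
  have h2 := add_three_mul_three_pow_le (Nat.log 2 d)
  set e := Nat.log 2 d
  have h3 : 4 ^ e ≤ d * d := by
    calc 4 ^ e = 2 ^ e * 2 ^ e := by rw [← mul_pow, show 2 * 2 = 4 from rfl]
      _ ≤ d * d := Nat.mul_le_mul h1 h1
  have h4 : 176 * Nat.log 2 p * 3 ^ (e + 1) ≤ 176 * (128 * e) * 3 ^ (e + 1) := by gcongr
  have h5 : 176 * (128 * e) * 3 ^ (e + 1) = 67584 * (e * 3 ^ e) := by ring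
  have h6 : e * 3 ^ e ≤ (e + 3) * 3 ^ e := by gcongr; omega
  nlinarith

/-- A tower with fibers of size n and L = d/n + 1 base values gives between d + 1 and 3d points. A
multiplication costs O(nL (L + k)) with k = O(log d). Repeated log p times, the part with L gives
O(d²) and the part with k gives O(d log d log p). -/
theorem exists_isSplitter_of_le_log (hp : 3 ≤ p) {d : ℕ} (hd : 2 ≤ d)
    (h : 128 ≤ Nat.log 2 p) (h' : 2 * Nat.log 2 d + 20 ≤ Nat.log 2 p) :
    ∃ S body T, IsSplitter (p := p) d T S body ∧ 12 * (d * S.length) ≤ p ∧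
      T ≤ 10000 * (d * d + d * Nat.log 2 d * Nat.log 2 p) := by
  have hpp := Nat.pow_log_le_self 2 (x := p) (by omega)
  have hdd := Nat.lt_pow_succ_log_self (b := 2) (by norm_num) d
  have he : 1 ≤ Nat.log 2 d := Nat.log_pos (by norm_num) hd
  set lam := Nat.log 2 p with hlam
  set e := Nat.log 2 d with he'
  -- The fiber size n is the largest power of 2 below both limits: lam / 64 lets a tower exist over
  -- ℤ/p, and 2 * d keeps the number of points linear in d.
  set μ := min (2 * d) (lam / 64) with hμ
  have hμ0 : μ ≠ 0 := by omega
  set k := Nat.log 2 μ with hk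
  have hn1 : 2 ^ k ≤ μ := Nat.pow_log_le_self 2 hμ0
  have hn2 : μ < 2 ^ (k + 1) := Nat.lt_pow_succ_log_self (by norm_num) μ
  have hkn : k < 2 ^ k := Nat.lt_two_pow_self
  have hke : k ≤ 2 * e := by
    have : k ≤ Nat.log 2 (d * 2) := Nat.log_mono_right (by omega)
    rw [Nat.log_mul_base (by norm_num) (by omega)] at this
    omega
  set n := 2 ^ k with hn
  have hn0 : 0 < n := by positivity
  set L := d / n + 1 with hL
  have hL1 : n * (d / n) ≤ d := Nat.mul_div_le d n
  have hL2 : d < n * L := by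
    rw [hL]; exact Nat.lt_mul_div_succ d hn0
  have hnL : n * L ≤ 3 * d := by
    have : n * L = n * (d / n) + n := by rw [hL]; ring
    omega
  have hLd : L ≤ 2 * d := by
    have := Nat.div_le_self d n
    omega
  have hbig : 36 * (d * d) ≤ p := by
    refine le_trans ?_ hpp
    calc 36 * (d * d) ≤ 2 ^ 6 * (2 ^ (e + 1) * 2 ^ (e + 1)) := by
          refine Nat.mul_le_mul (by norm_num) (Nat.mul_le_mul hdd.le hdd.le)
      _ = 2 ^ (2 * e + 8) := by rw [← pow_add, ← pow_add]; congr 1; ring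
      _ ≤ 2 ^ lam := Nat.pow_le_pow_right (by norm_num) (by omega)
  obtain ⟨u, v, hul, hvl, hun, -, hdis, hext, hext'⟩ := exists_canExtend (p := p) (by omega) k L
    ((Nat.pow_le_pow_right (by norm_num) (by omega : 16 * n ≤ lam)).trans hpp) (by
      refine le_trans ?_ hpp
      calc 2 ^ (n + k) * (2 * L) ≤ 2 ^ (n + k) * (2 ^ 2 * 2 ^ (e + 1)) :=
            Nat.mul_le_mul_left _ (by omega)
        _ = 2 ^ (n + k + (2 + (e + 1))) := by rw [← pow_add, ← pow_add]
        _ ≤ 2 ^ lam := Nat.pow_le_pow_right (by norm_num) (by omega))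
  rw [← hn] at hul hvl hext hext'
  rw [← hul] at hext hext'
  obtain ⟨body, hbody⟩ := isSplitter_valueSplitter hp hun (hul.trans hvl.symm) hdis (d := d)
    (by omega) (by omega) (by omega) hext hext'
  refine ⟨u, body, _, hbody, ?_, ?_⟩
  · rw [hul]
    calc 12 * (d * (n * L)) ≤ 12 * (d * (3 * d)) := by gcongr
      _ = 36 * (d * d) := by ring
      _ ≤ p := hbig
  · rw [hul]
    -- If n ≤ d, the limit 2 * d was not the active one, so lam is at most about 128 n; if n > d,
    -- the quotient is zero.
    have hΛL : lam * (d / n) ≤ 128 * d := by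
      by_cases hnd : d < n
      · rw [Nat.div_eq_of_lt hnd]; omega
      · have h1 : lam ≤ 128 * n := by
          rw [pow_succ] at hn2
          omega
        calc lam * (d / n) ≤ 128 * n * (d / n) := by gcongr
          _ = 128 * (n * (d / n)) := by ring
          _ ≤ 128 * d := by gcongr
    set m := n * L with hm
    have e1 : 4 * lam * (2 * (n * (L * (3 * L + 1 + 10 * k))) + 7 * m) =
        m * (24 * (lam * (d / n)) + 60 * lam + 80 * (k * lam)) := by
      rw [hm, hL]; ring
    have e2 : k * lam ≤ 2 * (e * lam) := by
      calc k * lam ≤ 2 * e * lam := by gcongr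
        _ = _ := by ring
    have e3 : lam ≤ e * lam := Nat.le_mul_of_pos_left _ he
    have e4 : 24 * (lam * (d / n)) + 60 * lam + 80 * (k * lam) ≤ 3072 * d + 220 * (e * lam) := by
      omega
    have e5 : m * (24 * (lam * (d / n)) + 60 * lam + 80 * (k * lam)) ≤
        3 * d * (3072 * d + 220 * (e * lam)) := Nat.mul_le_mul hnL e4
    have e6 : 4 * m * d ≤ 12 * (d * d) := by
      calc 4 * m * d ≤ 4 * (3 * d) * d := by gcongr
        _ = _ := by ring
    have e7 : 5 * m * m ≤ 45 * (d * d) := by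
      calc 5 * m * m ≤ 5 * (3 * d) * (3 * d) := by gcongr
        _ = _ := by ring
    have e8 : 3 * d * (3072 * d + 220 * (e * lam)) = 9216 * (d * d) + 660 * (d * e * lam) := by ring
    have e9 : d ≤ d * d := Nat.le_mul_self d
    rw [e1]
    omega

theorem exists_isSplitter (hp : 3 ≤ p) {d : ℕ} (hd : 2 ≤ d) :
    ∃ S body T, IsSplitter (p := p) d T S body ∧ 12 * (d * S.length) ≤ p ∧
      T ≤ 250000 * (d * d + d * Nat.log 2 d * Nat.log 2 p) := by
  have he : 1 ≤ Nat.log 2 d := Nat.log_pos (by norm_num) hd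
  -- If either condition fails, log p ≤ 128 log d, because log d ≥ 1.
  by_cases h : 128 ≤ Nat.log 2 p ∧ 2 * Nat.log 2 d + 20 ≤ Nat.log 2 p
  · obtain ⟨S, body, T, h1, h2, h3⟩ := exists_isSplitter_of_le_log hp hd h.1 h.2
    exact ⟨S, body, T, h1, h2, h3.trans (Nat.mul_le_mul_right _ (by norm_num))⟩
  · obtain ⟨body, T, h1, h2⟩ := exists_isSplitter_of_log_le hp hd (by omega)
    exact ⟨[], body, T, h1, by simp, h2.trans (Nat.mul_le_mul_left _ (Nat.le_add_right _ _))⟩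

end ChooseSplitter

/-! ### Recursive splitting, with brute force at the depth limit -/

section FindRoots

open Polynomial

section BruteForce

variable {F : Type} [Field F] [Fintype F] [DecidableEq F]

/-- The zeros of a polynomial among the elements of a given list, by evaluation. -/
def zerosAmong (l : List ℕ) : List F → Alg F (List ℕ)
  | [] => pure []
  | x :: xs => do
      let c ← exec (.const x)
      let y ← horner c l
      let b ← testZero y
      let r ← zerosAmong l xs
      pure (if b then c :: r else r)

theorem holds_zerosAmong {l : List ℕ} {cs : List F} : ∀ {mem xs : List F}, Rep mem l xs →
    (zerosAmong l cs).Holds mem fun out m t =>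
      Rep m out (cs.filter fun x => (toPoly xs).eval x = 0) ∧
        t ≤ cs.length * (2 * xs.length + 3) := by
  induction cs with
  | nil => intro mem xs h; exact Alg.holds_pure ⟨Rep.nil, Nat.zero_le _⟩
  | cons x cs ih =>
    intro mem xs h
    refine (holds_const x mem).bind fun c m1 t1 i1 hc => ?_
    refine (holds_horner hc.1 (h.mono i1)).bind fun y m2 t2 i2 hy => ?_
    refine (holds_testZero hy.1).bind fun b m3 t3 i3 hb => ?_
    obtain ⟨rfl, rfl, rfl⟩ := hb
    refine (ih (h.mono (i1.trans i2))).bind fun r m4 t4 i4 hr => ?_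
    refine Alg.holds_pure ⟨?_, ?_⟩
    · by_cases h0 : (toPoly xs).eval x = 0
      · simp only [h0, decide_true, if_true, List.filter_cons_of_pos]
        exact Rep.cons (getElem?_mono hc.1 (i2.trans i4)) hr.1
      · simpa [h0] using hr.1
    · have := hc.2
      have := hy.2
      have := hr.2
      rw [List.length_cons, Nat.succ_mul]
      generalize cs.length * (2 * xs.length + 3) = w at *
      omega

/-- The list of coefficients of a polynomial of exactly the formal degree, and not divisible
by `X`. -/
def Reduced (xs : List F) : Prop :=
  (toPoly xs).eval 0 ≠ 0 ∧ (toPoly xs).natDegree + 1 = xs.length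

/-- Divide a polynomial by its greatest common divisor with another one. -/
def splitBy (z : ℕ) (l e : List ℕ) : Alg F (List ℕ × List ℕ) := do
  let g₀ ← gcdList z (5 * l.length) l e
  let g ← trimTop g₀
  let h ← divSeries z (l.length - g.length + 1) l g
  pure (g, h)

/-- Since f(0) ≠ 0, powers of X in the gcd do not matter. The exact cofactor is found as a power
series quotient, truncated just above the degree of the cofactor. The factorization holds for every
list e, so a failed splitting never harms correctness. -/
theorem holds_splitBy {z d : ℕ} {l e : List ℕ} {mem xs es : List F} (hz : mem[z]? = some 0)
    (hl : Rep mem l xs) (he : Rep mem e es) (hxs : Reduced xs) (hd : 2 ≤ d)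
    (hxl : xs.length = d + 1) (hel : es.length ≤ 4 * d) :
    (splitBy z l e).Holds mem fun out m t => ∃ gs hs, Rep m out.1 gs ∧ Rep m out.2 hs ∧
      Reduced gs ∧ Reduced hs ∧ toPoly gs * toPoly hs = toPoly xs ∧
      (∀ α, (toPoly xs).eval α = 0 → ((toPoly gs).eval α = 0 ↔ (toPoly es).eval α = 0)) ∧
      t ≤ 80 * (d * d) := by
  obtain ⟨hx0, hxd⟩ := hxs
  have hll := hl.length_eq
  -- The fuel 5 (d + 1) exceeds the total length, which is at most (d + 1) + 4d.
  refine (holds_gcdList (M := 4 * d) hz hl he (by omega) (by omega) hel).bind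
    fun g₀ m1 t1 i1 hg₀ => ?_
  obtain ⟨gs₀, hgs₀, hg₀l, hdx, hde, hroot, ht1⟩ := hg₀
  refine (holds_trimTop hgs₀).bind fun g m2 t2 i2 hg => ?_
  obtain ⟨gs, hgs, hgp, hglast, hgl, ht2⟩ := hg
  rw [← hgp] at hdx hde
  have hf0 : toPoly xs ≠ 0 := by intro h; rw [h] at hx0; simp at hx0
  obtain ⟨c, hc⟩ := hdx
  have hg0 : toPoly gs ≠ 0 := left_ne_zero_of_mul (hc ▸ hf0)
  have hc0 : c ≠ 0 := right_ne_zero_of_mul (hc ▸ hf0)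
  have hge : (toPoly gs).eval 0 ≠ 0 := by
    intro h; rw [hc, eval_mul, h, zero_mul] at hx0; exact hx0 rfl
  have hgne : gs ≠ [] := by rintro rfl; exact hg0 rfl
  have hgd := natDegree_toPoly hgne (hglast hgne)
  have hcd : (toPoly gs).natDegree + c.natDegree = d := by
    rw [← natDegree_mul hg0 hc0, ← hc]; omega
  obtain ⟨y, ys, rfl⟩ : ∃ y ys, gs = y :: ys := by
    cases gs with
    | nil => exact absurd rfl hgne
    | cons y ys => exact ⟨y, ys, rfl⟩
  obtain ⟨b, bs, rfl⟩ : ∃ b bs, g = b :: bs := by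
    cases hgs; exact ⟨_, _, rfl⟩
  have hy0 : y ≠ 0 := by simpa [toPoly] using hge
  have hgsl := hgs.length_eq
  refine (holds_divSeries (n := l.length - (b :: bs).length + 1) (getElem?_mono hz (i1.trans i2))
    (hl.mono (i1.trans i2)) (List.forall₂_cons.1 hgs).1 (List.forall₂_cons.1 hgs).2).bind
    fun h m3 t3 i3 hh => ?_
  obtain ⟨hs, hhs, hhl, hW, ht3⟩ := hh
  obtain ⟨W, hW⟩ := hW hy0
  have hn : l.length - (b :: bs).length + 1 = c.natDegree + 1 := by omega
  rw [hn] at hhl hW ht3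
  -- The gcd has a non-zero constant term and can be cancelled modulo the power of X; degrees then
  -- identify the series quotient with c.
  have hcop : IsCoprime (X ^ (c.natDegree + 1)) (toPoly (y :: ys)) := by
    refine IsCoprime.pow_left ?_
    refine (irreducible_X.coprime_iff_not_dvd).2 ?_
    rw [X_dvd_iff, coeff_zero_eq_eval_zero]
    exact hge
  have hhc : toPoly hs = c := by
    rw [← sub_eq_zero]
    refine Polynomial.eq_zero_of_dvd_of_degree_lt (p := X ^ (c.natDegree + 1))
      (hcop.dvd_of_dvd_mul_left ⟨-W, ?_⟩) ?_
    · have := hc.symm.trans hW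
      linear_combination -this
    · rw [degree_X_pow]
      refine (degree_sub_le _ _).trans_lt (max_lt ?_ ?_)
      · have := degree_toPoly_lt hs
        rwa [hhl] at this
      · exact degree_le_natDegree.trans_lt (by exact_mod_cast Nat.lt_succ_self _)
  refine Alg.holds_pure ⟨_, hs, hgs.mono i3, hhs, ⟨hge, hgd⟩, ⟨?_, by rw [hhc, hhl]⟩,
    by rw [hhc, ← hc], fun α hα => ⟨fun h => ?_, fun h => ?_⟩, ?_⟩
  · rw [hhc]; intro h; rw [hc, eval_mul, h, mul_zero] at hx0; exact hx0 rfl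
  · obtain ⟨w, hw⟩ := hde
    rw [hw, eval_mul, h, zero_mul]
  · rw [hgp]
    refine hroot α ?_ hα h
    rintro rfl; exact hx0 hα
  · simp only [List.length_cons] at hgd hgsl hgl
    have h1 : ys.length ≤ d := by omega
    have h2 : c.natDegree + 1 ≤ d + 1 := by omega
    have h3 : (c.natDegree + 1) * (2 * ys.length + 1) ≤ (d + 1) * (2 * d + 1) := by gcongr
    rw [hll, hxl] at ht1
    nlinarith

end BruteForce

variable {p : ℕ} [Fact p.Prime]

/-- The recursion of the zero-finding procedure for polynomials not divisible by `X`: split by the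
quadratic characters of the zeros shifted by a random element, use brute force at depth `r`. -/
noncomputable def findRoots (body : ℕ → ℕ → List ℕ → Alg (ZMod p) (List ℕ)) (z : ℕ) :
    ℕ → List ℕ → Alg (ZMod p) (List ℕ)
  | _, [] => pure []
  | _, [_] => pure []
  | _, [a, b] => do
      let c ← exec (.sub z a)
      let r ← exec (.div c b)
      pure [r]
  | 0, a :: b :: c :: l => zerosAmong (a :: b :: c :: l) Finset.univ.toList
  | r + 1, a :: b :: c :: l => do
      let δ ← exec .random
      let e ← body (l.length + 2) δ (a :: b :: c :: l)
      let gh ← splitBy z (a :: b :: c :: l) e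
      let x ← findRoots body z r gh.1
      let y ← findRoots body z r gh.2
      pure (x ++ y)

theorem findRoots_zero (body : ℕ → ℕ → List ℕ → Alg (ZMod p) (List ℕ)) (z : ℕ) {d : ℕ}
    (hd : 2 ≤ d) {l : List ℕ} (hl : l.length = d + 1) :
    findRoots body z 0 l = zerosAmong l Finset.univ.toList := by
  match l with
  | [] => simp at hl
  | [_] => simp at hl; omega
  | [_, _] => simp at hl; omega
  | _ :: _ :: _ :: _ => rfl

theorem findRoots_succ (body : ℕ → ℕ → List ℕ → Alg (ZMod p) (List ℕ)) (z r : ℕ) {d : ℕ}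
    (hd : 2 ≤ d) {l : List ℕ} (hl : l.length = d + 1) :
    findRoots body z (r + 1) l = (do
      let δ ← exec .random
      let e ← body d δ l
      let gh ← splitBy z l e
      let x ← findRoots body z r gh.1
      let y ← findRoots body z r gh.2
      pure (x ++ y)) := by
  match l with
  | [] => simp at hl
  | [_] => simp at hl; omega
  | [_, _] => simp at hl; omega
  | _ :: _ :: _ :: l =>
    obtain rfl : d = l.length + 2 := by simp at hl; omega
    rfl

theorem holds_findRoots_of_length_le (body : ℕ → ℕ → List ℕ → Alg (ZMod p) (List ℕ)) {z : ℕ}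
    (r : ℕ) {l : List ℕ} {mem xs : List (ZMod p)} (hz : mem[z]? = some 0) (hl : Rep mem l xs)
    (hxs : Reduced xs) (hxl : xs.length ≤ 2) :
    (findRoots body z r l).Holds mem fun out m t =>
      (∃ ys, Rep m out ys ∧ ∀ x, x ∈ ys ↔ (toPoly xs).eval x = 0) ∧ t ≤ 2 * (xs.length - 1) := by
  obtain ⟨hx0, hxd⟩ := hxs
  rcases hl with _ | @⟨a, x, l, xs, hx, _ | @⟨b, y, l, xs, hy, _ | _⟩⟩
  · simp [toPoly] at hx0
  · have : findRoots body z r [a] = pure [] := by cases r <;> rfl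
    rw [this]
    refine Alg.holds_pure ⟨⟨[], Rep.nil, fun y => ?_⟩, Nat.zero_le _⟩
    have : x ≠ 0 := by simpa [toPoly] using hx0
    simp [toPoly, this]
  · have : findRoots body z r [a, b] = (do
      let c ← exec (.sub z a)
      let r ← exec (.div c b)
      pure [r]) := by cases r <;> rfl
    rw [this]
    refine (holds_sub hz hx).bind fun c m1 t1 i1 hc => ?_
    refine (holds_div hc.1 (getElem?_mono hy i1)).bind fun q m2 t2 i2 hq => ?_
    refine Alg.holds_pure ⟨⟨_, Rep.cons hq.1 Rep.nil, fun w => ?_⟩, ?_⟩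
    · have hy0 : y ≠ 0 := by
        rintro rfl
        simp [toPoly] at hxd
      simp only [zero_sub, List.mem_singleton, toPoly, mul_zero, add_zero, eval_add, eval_C,
        eval_mul, eval_X]
      rw [eq_div_iff hy0]
      constructor
      · intro h; rw [h]; ring
      · intro h; linear_combination h
    · have := hc.2
      have := hq.2
      simp; omega
  · simp at hxl

theorem holds_random (mem : List (ZMod p)) :
    (exec .random : Alg (ZMod p) ℕ).Holds mem fun a m t => (∃ δ, m[a]? = some δ) ∧ t = 1 := by
  intro y _
  exact ⟨⟨y, getElem?_append_length _ _⟩, rfl⟩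

/-- Correct for all random choices: each splitting is a factorization, and evaluation at all
elements of the field ends the recursion. -/
theorem holds_findRoots {body : ℕ → ℕ → List ℕ → Alg (ZMod p) (List ℕ)} {T : ℕ → ℕ}
    {S : ℕ → List (ZMod p)} (hbody : ∀ d, 2 ≤ d → IsSplitter d (T d) (S d) (body d)) {z : ℕ}
    (r : ℕ) : ∀ {l : List ℕ} {mem xs : List (ZMod p)}, mem[z]? = some 0 → Rep mem l xs →
    Reduced xs → (findRoots body z r l).Holds mem fun out m _ =>
      ∃ ys, Rep m out ys ∧ ∀ x, x ∈ ys ↔ (toPoly xs).eval x = 0 := by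
  induction r with
  | zero =>
    intro l mem xs hz hl hxs
    by_cases hd : xs.length ≤ 2
    · exact (holds_findRoots_of_length_le body 0 hz hl hxs hd).mono fun _ _ _ _ h => h.1
    · have hll := hl.length_eq
      rw [findRoots_zero body z (d := l.length - 1) (by omega) (by omega)]
      refine (holds_zerosAmong hl).mono fun out m t _ h => ⟨_, h.1, fun x => ?_⟩
      simp
  | succ r ih =>
    intro l mem xs hz hl hxs
    by_cases hd : xs.length ≤ 2
    · exact (holds_findRoots_of_length_le body _ hz hl hxs hd).mono fun _ _ _ _ h => h.1
    · have hll := hl.length_eq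
      obtain ⟨d, hxl⟩ : ∃ d, xs.length = d + 1 := ⟨xs.length - 1, by omega⟩
      rw [findRoots_succ body z r (d := d) (by omega) (by omega)]
      refine (holds_random mem).bind fun a m1 t1 i1 ha => ?_
      obtain ⟨⟨δ, ha⟩, -⟩ := ha
      refine (hbody d (by omega) m1 a δ l xs ha (hl.mono i1) hxl).bind fun e m2 t2 i2 he => ?_
      obtain ⟨-, es, hes, hesl, -⟩ := he
      have i12 := i1.trans i2
      refine (holds_splitBy (getElem?_mono hz i12) (hl.mono i12) hes hxs (by omega) hxl hesl).bind
        fun gh m3 t3 i3 hgh => ?_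
      obtain ⟨gs, hs, hgs, hhs, hgr, hhr, hmul, -, -⟩ := hgh
      have i13 := i12.trans i3
      refine (ih (getElem?_mono hz i13) hgs hgr).bind fun x m4 t4 i4 hx => ?_
      obtain ⟨y1, hy1, hy1m⟩ := hx
      refine (ih (getElem?_mono hz (i13.trans i4)) (hhs.mono i4) hhr).bind fun y m5 t5 i5 hy => ?_
      obtain ⟨y2, hy2, hy2m⟩ := hy
      refine Alg.holds_pure ⟨_, (hy1.mono i5).append hy2, fun x => ?_⟩
      rw [List.mem_append, hy1m, hy2m, ← hmul, eval_mul, mul_eq_zero]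

end FindRoots

/-! ### Expected cost of compositions -/

section ExpectedCost

variable {F α β : Type} [Field F] [Fintype F] [DecidableEq F]

/-- The first program is averaged, the second one is bounded uniformly over all outcomes of the
first. Averaging over a random shift is the separate lemma `ecost_random_bind_le`. -/
theorem Alg.ecost_bind_le_add {p : Alg F α} {f : α → Alg F β} {B : ℝ≥0∞} : ∀ {mem : List F},
    Alg.Holds p mem (fun a m _ => (f a).ecost m ≤ B) → (p >>= f).ecost mem ≤ p.ecost mem + B := by
  induction p with
  | pure a => intro mem h; exact h.trans (by simp [Alg.ecost])
  | instr I k ih =>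
    intro mem h
    change 1 + ∑' x, I.value mem x * Alg.ecost (k mem.length >>= f) (mem ++ [x]) ≤
      1 + ∑' x, I.value mem x * Alg.ecost (k mem.length) (mem ++ [x]) + B
    rw [add_assoc]
    gcongr
    calc _ ≤ ∑' x, (I.value mem x * Alg.ecost (k mem.length) (mem ++ [x]) + I.value mem x * B) := by
          refine ENNReal.tsum_le_tsum fun x => ?_
          by_cases hx : x ∈ (I.value mem).support
          · rw [← mul_add]; gcongr; exact ih _ (h x hx)
          · rw [PMF.mem_support_iff, not_not] at hx; simp [hx]
      _ = _ := by rw [ENNReal.tsum_add, ENNReal.tsum_mul_right, PMF.tsum_coe, one_mul]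
  | isZero i k ih =>
    intro mem h
    change 1 + Alg.ecost (k (decide (lookup mem i = 0)) >>= f) mem ≤
      1 + Alg.ecost (k (decide (lookup mem i = 0))) mem + B
    rw [add_assoc]
    gcongr
    exact ih _ h

theorem Alg.ecost_bind_le_of_holds {p : Alg F α} {f : α → Alg F β} {T B : ℝ} {mem : List F}
    (hT : 0 ≤ T) (hB : 0 ≤ B)
    (h : p.Holds mem fun a m t => (t : ℝ) ≤ T ∧ (f a).ecost m ≤ ENNReal.ofReal B) :
    (p >>= f).ecost mem ≤ ENNReal.ofReal (T + B) := by
  rw [ENNReal.ofReal_add hT hB]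
  refine (Alg.ecost_bind_le_add (h.mono fun _ _ _ _ h => h.2)).trans ?_
  gcongr
  refine Alg.Holds.ecost_le (h.mono fun _ _ t _ h => ?_)
  rw [← ENNReal.ofReal_natCast]
  exact ENNReal.ofReal_le_ofReal h.1

theorem ecost_random_bind_le {f : ℕ → Alg F α} {g : F → ℝ} {G : ℝ} {mem : List F}
    (hg : ∀ x, 0 ≤ g x) (h : ∀ x, (f mem.length).ecost (mem ++ [x]) ≤ ENNReal.ofReal (g x))
    (hG : ∑ x, g x ≤ Fintype.card F * G) :
    (exec .random >>= f).ecost mem ≤ ENNReal.ofReal (1 + G) := by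
  have hc : (0 : ℝ) < Fintype.card F := by exact_mod_cast Fintype.card_pos
  have hG0 : 0 ≤ G := by
    have := (Finset.sum_nonneg fun x _ => hg x).trans hG
    exact nonneg_of_mul_nonneg_right this hc
  change 1 + ∑' x, PMF.uniformOfFintype F x * (f mem.length).ecost (mem ++ [x]) ≤ _
  rw [ENNReal.ofReal_add zero_le_one hG0, ENNReal.ofReal_one]
  gcongr
  rw [tsum_fintype]
  calc _ ≤ ∑ x, (Fintype.card F : ℝ≥0∞)⁻¹ * ENNReal.ofReal (g x) := by
        refine Finset.sum_le_sum fun x _ => ?_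
        rw [PMF.uniformOfFintype_apply]
        gcongr
        exact h x
    _ = (Fintype.card F : ℝ≥0∞)⁻¹ * ENNReal.ofReal (∑ x, g x) := by
        rw [← Finset.mul_sum, ENNReal.ofReal_sum_of_nonneg fun x _ => hg x]
    _ ≤ (Fintype.card F : ℝ≥0∞)⁻¹ * ENNReal.ofReal (Fintype.card F * G) := by
        gcongr
    _ = ENNReal.ofReal G := by
        rw [ENNReal.ofReal_mul hc.le, ENNReal.ofReal_natCast, ← mul_assoc,
          ENNReal.inv_mul_cancel (by exact_mod_cast hc.ne') (ENNReal.natCast_ne_top _), one_mul]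

end ExpectedCost

/-! ### Probability that a random shift fails to separate two zeros -/

section Collisions

open Polynomial

variable {p : ℕ} [Fact p.Prime]

theorem pow_eq_one_or_neg_one (hp : 3 ≤ p) {x : ZMod p} (hx : x ≠ 0) :
    x ^ ((p - 1) / 2) = 1 ∨ x ^ ((p - 1) / 2) = -1 := by
  have hodd := (Fact.out : p.Prime).eq_two_or_odd
  rw [← sq_eq_one_iff, ← pow_mul, show (p - 1) / 2 * 2 = p - 1 by omega]
  exact ZMod.pow_card_sub_one_eq_one hx

theorem card_pow_ne_one_le (hp : 3 ≤ p) :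
    p ≤ 2 * (Finset.univ.filter fun x : ZMod p => x ≠ 0 ∧ x ^ ((p - 1) / 2) ≠ 1).card + 1 := by
  have hN : 0 < (p - 1) / 2 := by omega
  have h1 : (Finset.univ.filter fun x : ZMod p => x ^ ((p - 1) / 2) = 1).card ≤ (p - 1) / 2 := by
    refine (Finset.card_le_card (t := (nthRoots ((p - 1) / 2) (1 : ZMod p)).toFinset)
      fun x hx => ?_).trans ((Multiset.toFinset_card_le _).trans (card_nthRoots _ _))
    simpa [mem_nthRoots hN] using hx
  have h2 : (Finset.univ : Finset (ZMod p)) ⊆ insert 0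
      ((Finset.univ.filter fun x : ZMod p => x ≠ 0 ∧ x ^ ((p - 1) / 2) ≠ 1) ∪
        Finset.univ.filter fun x : ZMod p => x ^ ((p - 1) / 2) = 1) := by
    intro x _
    simp only [Finset.mem_insert, Finset.mem_union, Finset.mem_filter, Finset.mem_univ, true_and]
    tauto
  have h3 := (Finset.card_le_card h2).trans (Finset.card_insert_le _ _)
  rw [Finset.card_univ, ZMod.card] at h3
  have h4 := Finset.card_union_le (Finset.univ.filter fun x : ZMod p =>
    x ≠ 0 ∧ x ^ ((p - 1) / 2) ≠ 1) (Finset.univ.filter fun x : ZMod p => x ^ ((p - 1) / 2) = 1)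
  omega

/-- Each non-zero non-square x is the ratio (α + δ)/(β + δ) for one δ, and this δ separates α from
β. That gives at least (p - 1)/2 separating shifts, and (p + 1)/2 ≤ 2p/3. -/
theorem three_mul_card_same_le (hp : 3 ≤ p) {α β : ZMod p} (h : α ≠ β) :
    3 * (Finset.univ.filter fun δ : ZMod p =>
      ((α + δ) ^ ((p - 1) / 2) = 1 ↔ (β + δ) ^ ((p - 1) / 2) = 1)).card ≤ 2 * p := by
  have h1 := card_pow_ne_one_le hp
  have h2 := Finset.card_filter_add_card_filter_not (s := (Finset.univ : Finset (ZMod p)))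
    (fun δ : ZMod p => ((α + δ) ^ ((p - 1) / 2) = 1 ↔ (β + δ) ^ ((p - 1) / 2) = 1))
  rw [Finset.card_univ, ZMod.card] at h2
  have hN : (p - 1) / 2 ≠ 0 := by omega
  have hαβ : α - β ≠ 0 := sub_ne_zero.2 h
  have h3 : (Finset.univ.filter fun x : ZMod p => x ≠ 0 ∧ x ^ ((p - 1) / 2) ≠ 1).card ≤
      (Finset.univ.filter fun δ : ZMod p =>
        ¬ ((α + δ) ^ ((p - 1) / 2) = 1 ↔ (β + δ) ^ ((p - 1) / 2) = 1)).card := by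
    have hne : ∀ x : ZMod p, x ^ ((p - 1) / 2) ≠ 1 → x - 1 ≠ 0 := by
      intro x hx h0
      rw [sub_eq_zero] at h0
      exact hx (by rw [h0, one_pow])
    have hneg : (-1 : ZMod p) ≠ 1 := by
      have : Fact (2 < p) := ⟨by omega⟩
      exact ZMod.neg_one_ne_one
    refine Finset.card_le_card_of_injOn (fun x => (α - x * β) / (x - 1)) ?_ ?_
    · intro x hx
      obtain ⟨hx0, hx1⟩ : x ≠ 0 ∧ x ^ ((p - 1) / 2) ≠ 1 := by simpa using hx
      have hx2 := hne x hx1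
      have hx3 := (pow_eq_one_or_neg_one hp hx0).resolve_left hx1
      have ea : α + (α - x * β) / (x - 1) = x * ((α - β) / (x - 1)) := by field_simp; ring
      have eb : β + (α - x * β) / (x - 1) = (α - β) / (x - 1) := by field_simp; ring
      simp only [Finset.coe_filter, Finset.mem_univ, true_and, Set.mem_ofPred_eq]
      rw [ea, eb, mul_pow, hx3]
      rcases pow_eq_one_or_neg_one hp (div_ne_zero hαβ hx2) with h | h <;> rw [h] <;>
        simp [hneg]
    · intro x hx y hy hxy
      have hx2 := hne x (by simpa using (Finset.mem_filter.1 hx).2.2)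
      have hy2 := hne y (by simpa using (Finset.mem_filter.1 hy).2.2)
      have hxy : (α - x * β) / (x - 1) = (α - y * β) / (y - 1) := hxy
      rw [div_eq_div_iff hx2 hy2] at hxy
      have : (α - β) * (y - x) = 0 := by linear_combination hxy
      exact (sub_eq_zero.1 ((mul_eq_zero.1 this).resolve_left hαβ)).symm
  omega

theorem card_bad_shift_le {f : (ZMod p)[X]} (hf : f ≠ 0) (S : List (ZMod p)) :
    (Finset.univ.filter fun δ : ZMod p => ∃ s ∈ S, f.eval (s - δ) = 0).card ≤
      S.length * f.natDegree := by
  induction S with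
  | nil => simp
  | cons s S ih =>
    have h1 : (Finset.univ.filter fun δ : ZMod p => f.eval (s - δ) = 0).card ≤ f.natDegree := by
      refine le_trans ?_ (card_roots' f)
      refine le_trans ?_ (Multiset.toFinset_card_le _)
      refine Finset.card_le_card_of_injOn (fun δ => s - δ) ?_ fun x _ y _ h => sub_right_injective h
      intro δ hδ
      simpa [hf] using hδ
    have h2 : (Finset.univ.filter fun δ : ZMod p => ∃ t ∈ s :: S, f.eval (t - δ) = 0) =
        (Finset.univ.filter fun δ : ZMod p => f.eval (s - δ) = 0) ∪
          Finset.univ.filter fun δ : ZMod p => ∃ s ∈ S, f.eval (s - δ) = 0 := by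
      ext δ; simp
    rw [h2, List.length_cons, Nat.succ_mul]
    have := Finset.card_union_le (Finset.univ.filter fun δ : ZMod p => f.eval (s - δ) = 0)
      (Finset.univ.filter fun δ : ZMod p => ∃ s ∈ S, f.eval (s - δ) = 0)
    omega

/-- The pairs of different elements of `A` that the shift `δ` may fail to separate. -/
noncomputable def unseparated (f : (ZMod p)[X]) (S : List (ZMod p)) (A : Finset (ZMod p))
    (δ : ZMod p) : Finset (ZMod p × ZMod p) := by
  classical
  exact A.offDiag.filter fun x => (∃ s ∈ S, f.eval (s - δ) = 0) ∨
    ((x.1 + δ) ^ ((p - 1) / 2) = 1 ↔ (x.2 + δ) ^ ((p - 1) / 2) = 1)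

/-- For every pair at most 2p/3 shifts fail to separate it and at most p/12 shifts are bad for the
splitter: together 3p/4. -/
theorem sum_card_unseparated_le (hp : 3 ≤ p) {f : (ZMod p)[X]} (hf : f ≠ 0) {S : List (ZMod p)}
    (hS : 12 * (f.natDegree * S.length) ≤ p) (A : Finset (ZMod p)) :
    4 * ∑ δ, (unseparated f S A δ).card ≤ 3 * p * (A.card * A.card - A.card) := by
  classical
  have h1 : ∑ δ, (unseparated f S A δ).card = ∑ x ∈ A.offDiag, (Finset.univ.filter fun δ =>
      (∃ s ∈ S, f.eval (s - δ) = 0) ∨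
        ((x.1 + δ) ^ ((p - 1) / 2) = 1 ↔ (x.2 + δ) ^ ((p - 1) / 2) = 1)).card := by
    simp only [unseparated, Finset.card_filter]
    rw [Finset.sum_comm]
  rw [h1, ← Finset.offDiag_card, Finset.mul_sum, mul_comm _ A.offDiag.card, ← smul_eq_mul]
  refine Finset.sum_le_card_nsmul _ _ _ fun x hx => ?_
  have h2 := three_mul_card_same_le hp (Finset.mem_offDiag.1 hx).2.2
  have h3 := card_bad_shift_le hf S
  rw [Finset.filter_or]
  refine (Nat.mul_le_mul_left 4 (Finset.card_union_le _ _)).trans ?_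
  rw [mul_comm] at h3
  omega

end Collisions

/-! ### Expected cost of the recursion -/

section FindRootsCost

open Polynomial

variable {p : ℕ} [Fact p.Prime]

/-- The bound for the expected cost of `findRoots` at depth `r` and degree `d`. -/
noncomputable def rootsBound (p : ℕ) (C B : ℝ) (r d : ℕ) : ℝ :=
  8 * C * d ^ 2 + 8 * C * B * (d * Real.log d) + 5 * p * (3 / 4) ^ r * (d * (d - 1))

theorem rootsBound_nonneg {C B : ℝ} (hC : 0 ≤ C) (hB : 0 ≤ B) (r d : ℕ) :
    0 ≤ rootsBound p C B r d := by
  have h1 : 0 ≤ Real.log d := Real.log_natCast_nonneg d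
  have h2 : (0 : ℝ) ≤ d * (d - 1) := by
    rcases Nat.eq_zero_or_pos d with rfl | h
    · simp
    · have : (1 : ℝ) ≤ d := by exact_mod_cast h
      nlinarith
  unfold rootsBound
  positivity

/-- The inequality log t ≤ t - 1 at t = a/d. It replaces the logarithms of the sizes of the parts by
squares, which the number of unseparated pairs controls. -/
theorem mul_log_le_mul_log {a d : ℕ} (hd : 0 < d) :
    (a : ℝ) * Real.log a ≤ a * Real.log d + (a : ℝ) ^ 2 / d - a := by
  rcases Nat.eq_zero_or_pos a with rfl | ha
  · simp
  have ha' : (0 : ℝ) < a := by exact_mod_cast ha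
  have hd' : (0 : ℝ) < d := by exact_mod_cast hd
  have h := Real.log_le_sub_one_of_pos (div_pos ha' hd')
  rw [Real.log_div ha'.ne' hd'.ne'] at h
  have h2 := mul_le_mul_of_nonneg_left h ha'.le
  have h3 : (a : ℝ) * (a / d - 1) = (a : ℝ) ^ 2 / d - a := by ring
  linarith

/-- The bound for the cost that remains after the choice of the random shift, if the parts have
`X` unseparated pairs. -/
noncomputable def splitBound (p : ℕ) (C B : ℝ) (r d : ℕ) (X : ℝ) : ℝ :=
  C * (d ^ 2 + B * d) - 1 + 8 * C * (X + d) +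
    8 * C * B * (d * Real.log d + X / d + 1 - d) + 5 * p * (3 / 4) ^ r * X

theorem rootsBound_add_rootsBound_le {C B : ℝ} (hC : 0 ≤ C) (hB : 0 ≤ B) {r a b d : ℕ}
    (hd : 0 < d) (hab : a + b = d) {X : ℝ} (hX : (a : ℝ) * (a - 1) + b * (b - 1) ≤ X) :
    C * (d ^ 2 + B * d) - 1 + (rootsBound p C B r a + rootsBound p C B r b) ≤
      splitBound p C B r d X := by
  have hd' : (0 : ℝ) < d := by exact_mod_cast hd
  have hab' : (a : ℝ) + b = d := by exact_mod_cast hab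
  have h1 := mul_log_le_mul_log (a := a) hd
  have h2 := mul_log_le_mul_log (a := b) hd
  have h3 : (a : ℝ) ^ 2 + b ^ 2 ≤ X + d := by rw [← hab']; linarith
  have h4 : ((a : ℝ) ^ 2 + b ^ 2) / d ≤ X / d + 1 := by
    calc ((a : ℝ) ^ 2 + b ^ 2) / d ≤ (X + d) / d := by gcongr
      _ = X / d + 1 := by rw [add_div, div_self hd'.ne']
  have h5 : (a : ℝ) * Real.log a + b * Real.log b ≤ d * Real.log d + X / d + 1 - d := by
    rw [add_div] at h4
    have : (a : ℝ) * Real.log d + b * Real.log d = d * Real.log d := by rw [← hab']; ring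
    linarith
  have h6 : 8 * C * B * ((a : ℝ) * Real.log a + b * Real.log b) ≤
      8 * C * B * (d * Real.log d + X / d + 1 - d) :=
    mul_le_mul_of_nonneg_left h5 (by positivity)
  have h7 : 8 * C * ((a : ℝ) ^ 2 + b ^ 2) ≤ 8 * C * (X + d) :=
    mul_le_mul_of_nonneg_left h3 (by positivity)
  have h8 : 5 * (p : ℝ) * (3 / 4) ^ r * ((a : ℝ) * (a - 1) + b * (b - 1)) ≤
      5 * p * (3 / 4) ^ r * X := mul_le_mul_of_nonneg_left hX (by positivity)
  unfold rootsBound splitBound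
  linarith

theorem le_splitBound {C B : ℝ} (hC : 0 ≤ C) (hB : 0 ≤ B) {r d : ℕ} (hd : 0 < d) {X : ℝ}
    (hX : 0 ≤ X) : C * (d ^ 2 + B * d) - 1 ≤ splitBound p C B r d X := by
  have hd' : (1 : ℝ) ≤ d := by exact_mod_cast hd
  have h := Real.one_sub_inv_le_log_of_pos (by linarith : (0 : ℝ) < d)
  have h1 : (d : ℝ) - 1 ≤ d * Real.log d := by
    calc (d : ℝ) - 1 = d * (1 - (d : ℝ)⁻¹) := by field_simp
      _ ≤ _ := by gcongr
  have h2 : 0 ≤ 8 * C * B * (d * Real.log d + X / d + 1 - d) := by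
    have : 0 ≤ X / d := by positivity
    have : 0 ≤ d * Real.log d + X / d + 1 - d := by linarith
    positivity
  have h3 : 0 ≤ 5 * (p : ℝ) * (3 / 4) ^ r * X := by positivity
  have h5 : 0 ≤ 8 * C * (X + d) := by positivity
  unfold splitBound
  linarith

theorem splitBound_nonneg {C B : ℝ} (hC : 1 ≤ C) (hB : 0 ≤ B) {r d : ℕ} (hd : 0 < d) {X : ℝ}
    (hX : 0 ≤ X) : 0 ≤ splitBound p C B r d X := by
  refine le_trans ?_ (le_splitBound (by linarith) hB hd hX)
  have hd' : (1 : ℝ) ≤ d := by exact_mod_cast hd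
  have : (0 : ℝ) ≤ B * d := by positivity
  nlinarith

/-- At the average number of unseparated pairs, d² drops by d (d - 1)/4 and d log d drops by (d -
1)/4. The factor 8 in the potential turns these gains into 2C d (d - 1) and 2CB (d - 1), which pay
for C (d² + B d) as soon as d ≥ 2. The brute force term shrinks by 3/4. -/
theorem one_add_splitBound_le {C B : ℝ} (hC : 0 ≤ C) (hB : 0 ≤ B) {r d : ℕ} (hd : 2 ≤ d) :
    1 + splitBound p C B r d (3 / 4 * (d * (d - 1))) ≤ rootsBound p C B (r + 1) d := by
  have hd' : (2 : ℝ) ≤ d := by exact_mod_cast hd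
  have h1 : 3 / 4 * ((d : ℝ) * (d - 1)) / d = 3 / 4 * (d - 1) := by field_simp
  have h2 : 0 ≤ C * (d * ((d : ℝ) - 2)) := mul_nonneg hC (by nlinarith)
  have h3 : 0 ≤ C * B * ((d : ℝ) - 2) := mul_nonneg (by positivity) (by linarith)
  unfold splitBound rootsBound
  rw [h1, pow_succ (3 / 4 : ℝ)]
  nlinarith

/-- The bound is affine and increasing in the number of pairs, so averaging acts on that number
alone. -/
theorem sum_splitBound_le {C B : ℝ} (hC : 0 ≤ C) (hB : 0 ≤ B) {r d : ℕ} {y : ZMod p → ℕ}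
    (hy : 4 * ∑ δ, y δ ≤ 3 * p * (d * d - d)) :
    ∑ δ, splitBound p C B r d (y δ) ≤
      Fintype.card (ZMod p) * splitBound p C B r d (3 / 4 * (d * (d - 1))) := by
  have hs : ∀ X : ℝ, splitBound p C B r d X = splitBound p C B r d 0 +
      (8 * C + 8 * C * B / d + 5 * p * (3 / 4) ^ r) * X := by
    intro X; unfold splitBound; ring
  have hy' : ∑ δ, (y δ : ℝ) ≤ p * (3 / 4 * (d * (d - 1))) := by
    have h : (4 : ℝ) * ∑ δ, (y δ : ℝ) ≤ 3 * p * ((d * d - d : ℕ) : ℝ) := by exact_mod_cast hy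
    rw [Nat.cast_sub (Nat.le_mul_self d), Nat.cast_mul] at h
    linarith
  simp_rw [hs (y _)]
  rw [hs (3 / 4 * _), Finset.sum_add_distrib, ← Finset.mul_sum, Finset.sum_const, nsmul_eq_mul,
    Finset.card_univ, ZMod.card, mul_add]
  have : (0 : ℝ) ≤ 8 * C + 8 * C * B / d + 5 * p * (3 / 4) ^ r := by positivity
  have := mul_le_mul_of_nonneg_left hy' this
  linarith

/-- The set A makes f a product of d distinct linear factors, a property that both parts inherit.
The sizes of the parts enter only through the pairs of zeros that stay together, and these are
unseparated pairs. -/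
theorem ecost_findRoots_le (hp : 3 ≤ p) {body : ℕ → ℕ → List ℕ → Alg (ZMod p) (List ℕ)}
    {T : ℕ → ℕ} {S : ℕ → List (ZMod p)} (hbody : ∀ d, 2 ≤ d → IsSplitter d (T d) (S d) (body d))
    (hS : ∀ d, 2 ≤ d → 12 * (d * (S d).length) ≤ p) {C B : ℝ} (hC : 1 ≤ C) (hB : 0 ≤ B) {n : ℕ}
    (hT : ∀ d, 2 ≤ d → d ≤ n → (T d : ℝ) + 80 * (d * d) + 1 ≤ C * (d ^ 2 + B * d)) {z : ℕ} (r : ℕ) :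
    ∀ {d : ℕ} {l : List ℕ} {mem xs : List (ZMod p)} {A : Finset (ZMod p)}, mem[z]? = some 0 →
    Rep mem l xs → Reduced xs → xs.length = d + 1 → d ≤ n → A.card = d →
    (∀ α ∈ A, (toPoly xs).eval α = 0) →
    (findRoots body z r l).ecost mem ≤ ENNReal.ofReal (rootsBound p C B r d) := by
  have hC0 : 0 ≤ C := by linarith
  have hsmall : ∀ {r d : ℕ} {l : List ℕ} {mem xs : List (ZMod p)}, mem[z]? = some 0 →
      Rep mem l xs → Reduced xs → xs.length = d + 1 → ¬ 2 ≤ d →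
      (findRoots body z r l).ecost mem ≤ ENNReal.ofReal (rootsBound p C B r d) := by
    intro r d l mem xs hz hl hxs hxl hd
    refine Alg.Holds.ecost_le ((holds_findRoots_of_length_le body r hz hl hxs (by omega)).mono
      fun _ _ t _ h => ?_)
    rw [← ENNReal.ofReal_natCast]
    refine ENNReal.ofReal_le_ofReal ?_
    have ht : t ≤ 2 * d := by have := h.2; omega
    have ht' : (t : ℝ) ≤ 2 * d := by exact_mod_cast ht
    refine ht'.trans ?_
    obtain rfl | rfl : d = 0 ∨ d = 1 := by omega
    · simp [rootsBound]
    · simp [rootsBound]; linarith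
  induction r with
  | zero =>
    intro d l mem xs A hz hl hxs hxl hdn hA hroots
    by_cases hd : 2 ≤ d
    swap
    · exact hsmall hz hl hxs hxl hd
    rw [findRoots_zero body z hd (hl.length_eq.trans hxl)]
    refine Alg.Holds.ecost_le ((holds_zerosAmong hl).mono fun _ _ t _ h => ?_)
    rw [← ENNReal.ofReal_natCast]
    refine ENNReal.ofReal_le_ofReal ?_
    have ht := h.2
    rw [Finset.length_toList, Finset.card_univ, ZMod.card, hxl] at ht
    have ht' : (t : ℝ) ≤ p * (2 * (d + 1) + 3) := by exact_mod_cast ht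
    refine ht'.trans ?_
    have hd' : (2 : ℝ) ≤ d := by exact_mod_cast hd
    -- The origin of the term 5p d (d - 1): it pays for brute force and vanishes for d ≤ 1, where no
    -- brute force occurs.
    have h1 : (2 * ((d : ℝ) + 1) + 3) ≤ 5 * (d * (d - 1)) := by nlinarith
    have h2 := mul_le_mul_of_nonneg_left h1 (Nat.cast_nonneg (α := ℝ) p)
    have h3 : 0 ≤ 8 * C * (d : ℝ) ^ 2 := by positivity
    have h4 : 0 ≤ 8 * C * B * (d * Real.log d) := by
      have := Real.log_natCast_nonneg d
      positivity
    unfold rootsBound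
    rw [pow_zero]
    linarith
  | succ r ih =>
    intro d l mem xs A hz hl hxs hxl hdn hA hroots
    by_cases hd : 2 ≤ d
    swap
    · exact hsmall hz hl hxs hxl hd
    have hf0 : toPoly xs ≠ 0 := by intro h; have := hxs.1; rw [h] at this; simp at this
    have hdeg : (toPoly xs).natDegree = d := by have := hxs.2; omega
    rw [findRoots_succ body z r hd (hl.length_eq.trans hxl)]
    refine (ecost_random_bind_le (g := fun δ => splitBound p C B r d
      ((unseparated (toPoly xs) (S d) A δ).card))
      (fun δ => splitBound_nonneg hC hB (by omega) (Nat.cast_nonneg _)) (fun δ => ?_)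
      (sum_splitBound_le hC0 hB ?_)).trans (ENNReal.ofReal_le_ofReal
        (one_add_splitBound_le hC0 hB hd))
    swap
    · have := sum_card_unseparated_le hp hf0 (S := S d) (by rw [hdeg]; exact hS d hd) A
      rwa [hA] at this
    have i1 : mem <+: mem ++ [δ] := List.prefix_append _ _
    set X := (unseparated (toPoly xs) (S d) A δ).card with hX
    -- The share that is left for the two recursive calls after the splitter and the gcd are paid.
    set W := splitBound p C B r d X - (C * (d ^ 2 + B * d) - 1) with hW
    have hW0 : 0 ≤ W := by
      have := le_splitBound (p := p) hC0 hB (r := r) (d := d) (by omega) (Nat.cast_nonneg X)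
      linarith
    refine le_trans ?_ (ENNReal.ofReal_le_ofReal
      (show (T d : ℝ) + (80 * (d * d) + W) ≤ _ by linarith [hT d hd hdn]))
    refine Alg.ecost_bind_le_of_holds (Nat.cast_nonneg _) (by positivity)
      ((hbody d hd _ _ δ l xs (getElem?_append_length _ _) (hl.mono i1) hxl).mono
        fun e m2 t2 i2 he => ⟨by exact_mod_cast he.1, ?_⟩)
    obtain ⟨-, es, hes, hesl, hsplit⟩ := he
    have i12 := i1.trans i2
    refine Alg.ecost_bind_le_of_holds (by positivity) hW0
      ((holds_splitBy (getElem?_mono hz i12) (hl.mono i12) hes hxs hd hxl hesl).mono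
        fun gh m3 t3 i3 hgh => ?_)
    obtain ⟨gs, hs, hgs, hhs, hgr, hhr, hmul, hiff, ht3⟩ := hgh
    refine ⟨by exact_mod_cast ht3, ?_⟩
    have hg0 : toPoly gs ≠ 0 := left_ne_zero_of_mul (hmul ▸ hf0)
    have hh0 : toPoly hs ≠ 0 := right_ne_zero_of_mul (hmul ▸ hf0)
    have hdd : (toPoly gs).natDegree + (toPoly hs).natDegree = d := by
      rw [← natDegree_mul hg0 hh0, hmul, hdeg]
    set A₁ := A.filter fun α => (toPoly gs).eval α = 0 with hA₁
    set A₂ := A.filter fun α => ¬ (toPoly gs).eval α = 0 with hA₂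
    have hA12 : A₁.card + A₂.card = d := by
      rw [← hA]; exact Finset.card_filter_add_card_filter_not _
    have hroot₁ : ∀ α ∈ A₁, (toPoly gs).eval α = 0 := fun α hα => (Finset.mem_filter.1 hα).2
    have hroot₂ : ∀ α ∈ A₂, (toPoly hs).eval α = 0 := by
      intro α hα
      obtain ⟨hα, hα'⟩ := Finset.mem_filter.1 hα
      have := hroots α hα
      rw [← hmul, eval_mul] at this
      exact (mul_eq_zero.1 this).resolve_left hα'
    have hle : ∀ {f : (ZMod p)[X]} {A' : Finset (ZMod p)}, f ≠ 0 → (∀ α ∈ A', f.eval α = 0) →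
        A'.card ≤ f.natDegree := by
      intro f A' hf h
      refine le_trans (Finset.card_le_card (t := f.roots.toFinset) fun α hα => ?_)
        ((Multiset.toFinset_card_le _).trans (card_roots' f))
      simpa [hf] using h α hα
    -- The cardinalities of the two parts of A and the two degrees have the same sum d, so these
    -- inequalities are equalities.
    have hc1 := hle hg0 hroot₁
    have hc2 := hle hh0 hroot₂
    have hgl := hgr.2
    have hhl := hhr.2
    have hcoll : (A₁.card : ℝ) * (A₁.card - 1) + A₂.card * (A₂.card - 1) ≤ X := by
      have hsub : A₁.offDiag ∪ A₂.offDiag ⊆ unseparated (toPoly xs) (S d) A δ := by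
        intro x hx
        simp only [unseparated, Finset.mem_filter]
        have hx' : x ∈ A.offDiag ∧ ((toPoly gs).eval x.1 = 0 ↔ (toPoly gs).eval x.2 = 0) := by
          simp only [hA₁, hA₂, Finset.mem_union, Finset.mem_offDiag, Finset.mem_filter] at hx ⊢
          tauto
        refine ⟨hx'.1, ?_⟩
        by_cases hbad : ∃ s ∈ S d, (toPoly xs).eval (s - δ) = 0
        · exact Or.inl hbad
        · right
          push Not at hbad
          obtain ⟨hx1, hx2, -⟩ := Finset.mem_offDiag.1 hx'.1
          rw [← hsplit hxs.1 hbad _ (hroots _ hx1), ← hsplit hxs.1 hbad _ (hroots _ hx2),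
            ← hiff _ (hroots _ hx1), ← hiff _ (hroots _ hx2)]
          exact hx'.2
      have hdisj : Disjoint A₁.offDiag A₂.offDiag := by
        rw [Finset.disjoint_left]
        intro x hx1 hx2
        simp only [hA₁, hA₂, Finset.mem_offDiag, Finset.mem_filter] at hx1 hx2
        tauto
      have := Finset.card_le_card hsub
      rw [Finset.card_union_of_disjoint hdisj, Finset.offDiag_card, Finset.offDiag_card] at this
      have h' : (((A₁.card * A₁.card - A₁.card : ℕ) : ℝ)) +
          ((A₂.card * A₂.card - A₂.card : ℕ) : ℝ) ≤ X := by exact_mod_cast this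
      rw [Nat.cast_sub (Nat.le_mul_self _), Nat.cast_sub (Nat.le_mul_self _)] at h'
      push_cast at h'
      linarith
    have hfin := rootsBound_add_rootsBound_le (p := p) hC0 hB (r := r) (by omega) hA12 hcoll
    refine le_trans ?_ (ENNReal.ofReal_le_ofReal (show rootsBound p C B r A₁.card +
      rootsBound p C B r A₂.card ≤ W by rw [hW]; linarith))
    have i13 := i12.trans i3
    rw [ENNReal.ofReal_add (rootsBound_nonneg hC0 hB _ _) (rootsBound_nonneg hC0 hB _ _)]
    have hz3 := getElem?_mono hz i13
    refine (Alg.ecost_bind_le_add ((holds_findRoots hbody r hz3 hgs hgr).mono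
      fun x m4 _ i4 _ => ?_)).trans (add_le_add_left
        (ih hz3 hgs hgr (by omega) (by omega) rfl hroot₁) _)
    refine (Alg.ecost_bind_le_add ((holds_findRoots hbody r (getElem?_mono hz3 i4) (hhs.mono i4)
      hhr).mono (R := fun y m _ => Alg.ecost (pure (x ++ y) : Alg (ZMod p) (List ℕ)) m ≤ 0)
      fun y m5 _ _ _ => le_rfl)).trans ?_
    rw [add_zero]
    exact ih (getElem?_mono hz3 i4) (hhs.mono i4) hhr (by omega) (by omega) rfl hroot₂

end FindRootsCost

/-! ### The zero-finding procedure -/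

section ZeroFinder

open Polynomial

variable {p : ℕ} [Fact p.Prime]

/-- A zero-finding procedure: brute force if the polynomial is divisible by `X`, random splitting
to recursion depth `R` otherwise. -/
noncomputable def zeroFinder (body : ℕ → ℕ → List ℕ → Alg (ZMod p) (List ℕ)) (R : ℕ) (l : List ℕ) :
    Alg (ZMod p) (List ℕ) := do
  let g ← trimTop l
  let z ← exec (.const 0)
  let b ← testZero (g.headD z)
  if b then zerosAmong g Finset.univ.toList else findRoots body z R g

theorem isZeroFinder_of_holds {find : List ℕ → Alg (ZMod p) (List ℕ)}
    (h : ∀ {l : List ℕ} {mem xs : List (ZMod p)}, Rep mem l xs → toPoly xs ≠ 0 →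
      (find l).Holds mem fun out m _ => ∃ ys, Rep m out ys ∧ ∀ x, x ∈ ys ↔ (toPoly xs).eval x = 0) :
    IsZeroFinder find := by
  intro mem l hl h0 r hr
  have hrep := Rep.of_lt_length hl
  rw [polyAt_eq_toPoly hrep] at h0 ⊢
  obtain ⟨ys, hys, hm⟩ := (h hrep h0).of_mem_support r hr
  refine ⟨hys.lt_length, fun x => ?_⟩
  rw [hys.map_lookup, hm]
  rfl

theorem rep_headD {mem : List (ZMod p)} {g : List ℕ} {ys : List (ZMod p)} {z : ℕ}
    (h : Rep mem g ys) (h0 : toPoly ys ≠ 0) :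
    mem[g.headD z]? = some ((toPoly ys).eval 0) := by
  cases h with
  | nil => exact absurd rfl h0
  | cons hx _ => simpa [toPoly] using hx

theorem reduced_of_getLast_ne_zero {ys : List (ZMod p)} (h0 : (toPoly ys).eval 0 ≠ 0)
    (hl : ∀ h : ys ≠ [], ys.getLast h ≠ 0) : Reduced ys := by
  have hne : ys ≠ [] := by rintro rfl; simp [toPoly] at h0
  exact ⟨h0, natDegree_toPoly hne (hl hne)⟩

theorem isZeroFinder_zeroFinder {body : ℕ → ℕ → List ℕ → Alg (ZMod p) (List ℕ)} {T : ℕ → ℕ}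
    {S : ℕ → List (ZMod p)} (hbody : ∀ d, 2 ≤ d → IsSplitter d (T d) (S d) (body d)) (R : ℕ) :
    IsZeroFinder (zeroFinder body R) := by
  refine isZeroFinder_of_holds fun {l mem xs} hl h0 => ?_
  refine (holds_trimTop hl).bind fun g m1 t1 i1 hg => ?_
  obtain ⟨ys, hys, hyp, hlast, -, -⟩ := hg
  rw [← hyp] at h0 ⊢
  refine (holds_const 0 m1).bind fun z m2 t2 i2 hz => ?_
  refine (holds_testZero (rep_headD (hys.mono i2) h0)).bind fun b m3 t3 i3 hb => ?_
  obtain ⟨rfl, rfl, rfl⟩ := hb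
  by_cases he : (toPoly ys).eval 0 = 0
  · simp only [he, decide_true, if_true]
    refine (holds_zerosAmong (hys.mono i2)).mono fun out m t _ h => ⟨_, h.1, fun x => ?_⟩
    simp
  · simp only [he, decide_false, Bool.false_eq_true, if_false]
    exact (holds_findRoots hbody R hz.1 (hys.mono i2) (reduced_of_getLast_ne_zero he hlast)).mono
      fun _ _ _ _ h => h

theorem ecost_zeroFinder_le {body : ℕ → ℕ → List ℕ → Alg (ZMod p) (List ℕ)} {R d : ℕ} {B : ℝ}
    {l : List ℕ} {mem xs : List (ZMod p)} (hB : 0 ≤ B) (hl : Rep mem l xs) (hxs : Reduced xs)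
    (hxl : xs.length = d + 1)
    (h : ∀ {g : List ℕ} {m ys : List (ZMod p)} {z : ℕ}, m[z]? = some 0 → Rep m g ys →
      Reduced ys → ys.length = d + 1 → toPoly ys = toPoly xs →
      (findRoots body z R g).ecost m ≤ ENNReal.ofReal B) :
    (zeroFinder body R l).ecost mem ≤ ENNReal.ofReal (d + 1 + (1 + (1 + B))) := by
  refine Alg.ecost_bind_le_of_holds (by positivity) (by positivity) ((holds_trimTop hl).mono
    fun g m1 t1 i1 hg => ?_)
  obtain ⟨ys, hys, hyp, hlast, -, ht1⟩ := hg
  have he : (toPoly ys).eval 0 ≠ 0 := by rw [hyp]; exact hxs.1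
  have hr := reduced_of_getLast_ne_zero he hlast
  have hyl : ys.length = d + 1 := by rw [← hr.2, hyp, hxs.2, hxl]
  refine ⟨by rw [hxl] at ht1; exact_mod_cast ht1, ?_⟩
  refine Alg.ecost_bind_le_of_holds (by positivity) (by positivity) ((holds_const 0 m1).mono
    fun z m2 t2 i2 hz => ⟨by rw [hz.2]; simp, ?_⟩)
  refine Alg.ecost_bind_le_of_holds (by positivity) hB ((holds_testZero
    (rep_headD (hys.mono i2) (by rintro h; rw [h] at he; simp at he))).mono
    fun b m3 t3 i3 hb => ?_)
  obtain ⟨rfl, rfl, rfl⟩ := hb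
  refine ⟨by simp, ?_⟩
  simp only [he, decide_false, Bool.false_eq_true, if_false]
  exact h hz.1 (hys.mono i2) hr hyl hyp

theorem natLog_two_le (n : ℕ) : (Nat.log 2 n : ℝ) ≤ 2 * Real.log n := by
  rcases Nat.eq_zero_or_pos n with rfl | hn
  · simp
  have h1 : ((2 ^ Nat.log 2 n : ℕ) : ℝ) ≤ n := by
    exact_mod_cast Nat.pow_log_le_self 2 hn.ne'
  have h2 := Real.log_le_log (by positivity) h1
  rw [Nat.cast_pow, Real.log_pow, Nat.cast_two] at h2
  have h3 := Real.log_two_gt_d9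
  have h4 : (0 : ℝ) ≤ Nat.log 2 n := Nat.cast_nonneg _
  nlinarith

/-- As 2 · (3/4)³ < 1, a depth of 3 (log₂ p + 1) makes the brute force term harmless. -/
theorem mul_three_quarters_pow_le (n : ℕ) :
    (n : ℝ) * (3 / 4) ^ (3 * (Nat.log 2 n + 1)) ≤ 1 := by
  have h1 : (n : ℝ) ≤ 2 ^ (Nat.log 2 n + 1) := by
    exact_mod_cast (Nat.lt_pow_succ_log_self (by norm_num) n).le
  calc (n : ℝ) * (3 / 4) ^ (3 * (Nat.log 2 n + 1)) ≤
        2 ^ (Nat.log 2 n + 1) * ((3 / 4) ^ 3) ^ (Nat.log 2 n + 1) := by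
        rw [pow_mul]; gcongr
    _ = (2 * (3 / 4) ^ 3) ^ (Nat.log 2 n + 1) := by rw [mul_pow]
    _ ≤ 1 := pow_le_one₀ (by norm_num) (by norm_num)

/-- The bound `K (1 + d² + d log² d log p)` for the expected cost of zero finding. -/
def HasRootCost (K : ℝ) (find : List ℕ → Alg (ZMod p) (List ℕ)) : Prop :=
  ∀ {d : ℕ} {l : List ℕ} {mem xs : List (ZMod p)} {A : Finset (ZMod p)}, Rep mem l xs →
    Reduced xs → xs.length = d + 1 → A.card = d → (∀ α ∈ A, (toPoly xs).eval α = 0) →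
    (find l).ecost mem ≤
      ENNReal.ofReal (K * (1 + (d : ℝ) ^ 2 + d * Real.log d ^ 2 * Real.log p))

theorem exists_isZeroFinder_of_two_lt (hp : 3 ≤ p) :
    ∃ find : List ℕ → Alg (ZMod p) (List ℕ), IsZeroFinder find ∧ HasRootCost 10000000 find := by
  choose S body T h1 h2 h3 using fun d : ℕ => fun hd : 2 ≤ d => exists_isSplitter (p := p) hp hd
  set S' : ℕ → List (ZMod p) := fun d => if hd : 2 ≤ d then S d hd else [] with hS'
  set body' : ℕ → ℕ → List ℕ → Alg (ZMod p) (List ℕ) :=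
    fun d => if hd : 2 ≤ d then body d hd else fun _ _ => pure [] with hbody'
  set T' : ℕ → ℕ := fun d => if hd : 2 ≤ d then T d hd else 0 with hT'
  have hsplit : ∀ d, 2 ≤ d → IsSplitter d (T' d) (S' d) (body' d) := by
    intro d hd
    simp only [hS', hbody', hT', dif_pos hd]
    exact h1 d hd
  refine ⟨zeroFinder body' (3 * (Nat.log 2 p + 1)), isZeroFinder_zeroFinder hsplit _, ?_⟩
  intro d l mem xs A hl hxs hxl hA hroots
  -- B is fixed by the degree at the top of the recursion; all smaller degrees satisfy the same cost
  -- condition.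
  have hB : (0 : ℝ) ≤ Nat.log 2 d * Nat.log 2 p := by positivity
  have hb := rootsBound_nonneg (p := p) (C := 250081) (by norm_num) hB
    (3 * (Nat.log 2 p + 1)) d
  refine (ecost_zeroFinder_le hb hl hxs hxl fun {g m ys z} hz hg hr hyl hyp =>
    ecost_findRoots_le hp hsplit ?_ (by norm_num) hB (n := d) ?_ _ hz hg hr hyl le_rfl hA
      (by rw [hyp]; exact hroots)).trans (ENNReal.ofReal_le_ofReal ?_)
  · intro d hd
    simp only [hS', dif_pos hd]
    exact h2 d hd
  · intro d' hd' hdd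
    simp only [hT', dif_pos hd']
    have e1 : (T d' hd' : ℝ) ≤ 250000 * (d' * d' + d' * Nat.log 2 d' * Nat.log 2 p) := by
      exact_mod_cast h3 d' hd'
    have e2 : (2 : ℝ) ≤ d' := by exact_mod_cast hd'
    have e3 : (Nat.log 2 d' : ℝ) ≤ Nat.log 2 d := by exact_mod_cast Nat.log_mono_right hdd
    have e4 : (d' : ℝ) * Nat.log 2 d' * Nat.log 2 p ≤ d' * Nat.log 2 d * Nat.log 2 p := by gcongr
    have e5 : (0 : ℝ) ≤ d' * Nat.log 2 d * Nat.log 2 p := by positivity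
    nlinarith
  · have e1 := natLog_two_le d
    have e2 := natLog_two_le p
    have e3 := mul_three_quarters_pow_le p
    have l1 := Real.log_natCast_nonneg d
    have l2 := Real.log_natCast_nonneg p
    have e4 : (Nat.log 2 d : ℝ) * Nat.log 2 p ≤ (2 * Real.log d) * (2 * Real.log p) := by gcongr
    have e5 := mul_le_mul_of_nonneg_right e4 (by positivity : 0 ≤ (d : ℝ) * Real.log d)
    have e6 : (d : ℝ) ≤ d ^ 2 := by exact_mod_cast Nat.le_self_pow (by norm_num) d
    have e7 : (0 : ℝ) ≤ d * (d - 1) := by nlinarith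
    have e8 := mul_le_mul_of_nonneg_right e3 e7
    have e9 : (0 : ℝ) ≤ d * Real.log d ^ 2 * Real.log p := by positivity
    have e10 : (0 : ℝ) ≤ (d : ℝ) := Nat.cast_nonneg _
    have e11 : (0 : ℝ) ≤ (d : ℝ) ^ 2 := by positivity
    unfold rootsBound
    calc _ = (d : ℝ) + 3 + (8 * 250081 * d ^ 2 + 8 * 250081 *
          (Nat.log 2 d * Nat.log 2 p * (d * Real.log d)) + 5 *
          (p * (3 / 4) ^ (3 * (Nat.log 2 p + 1)) * (d * (d - 1)))) := by ring
      _ ≤ (d : ℝ) + 3 + (8 * 250081 * d ^ 2 + 8 * 250081 *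
          (2 * Real.log d * (2 * Real.log p) * (d * Real.log d)) + 5 * (1 * (d * (d - 1)))) := by
        gcongr
      _ = (d : ℝ) + 3 + 8 * 250081 * d ^ 2 + 32 * 250081 *
          (d * Real.log d ^ 2 * Real.log p) + 5 * (d * (d - 1)) := by ring
      _ ≤ _ := by nlinarith

theorem exists_isZeroFinder :
    ∃ find : List ℕ → Alg (ZMod p) (List ℕ), IsZeroFinder find ∧ HasRootCost 10000000 find := by
  by_cases hp : 3 ≤ p
  · exact exists_isZeroFinder_of_two_lt hp
  -- Quadratic characters do not help for p = 2, but evaluation at the two elements is linear in d.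
  have hp2 : p = 2 := by have := (Fact.out : p.Prime).two_le; omega
  refine ⟨fun l => zerosAmong l Finset.univ.toList, isZeroFinder_of_holds fun hl _ =>
    (holds_zerosAmong hl).mono fun out m t _ h => ⟨_, h.1, fun x => by simp⟩, ?_⟩
  intro d l mem xs A hl hxs hxl _ _
  refine Alg.Holds.ecost_le ((holds_zerosAmong hl).mono fun out m t _ h => ?_)
  rw [← ENNReal.ofReal_natCast]
  refine ENNReal.ofReal_le_ofReal ?_
  have ht := h.2
  rw [Finset.length_toList, Finset.card_univ, ZMod.card, hxl] at ht
  have ht' : (t : ℝ) ≤ p * (2 * (d + 1) + 3) := by exact_mod_cast ht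
  have hp' : (p : ℝ) = 2 := by exact_mod_cast hp2
  have l2 := Real.log_natCast_nonneg p
  have e6 : (d : ℝ) ≤ d ^ 2 := by exact_mod_cast Nat.le_self_pow (by norm_num) d
  have e9 : (0 : ℝ) ≤ d * Real.log d ^ 2 * Real.log p := by positivity
  have e10 : (0 : ℝ) ≤ (d : ℝ) := Nat.cast_nonneg _
  rw [hp'] at ht'
  linarith

end ZeroFinder

/-! ### Newton's identities -/

section Newton

open Polynomial

variable {F : Type} [Field F] [Fintype F] [DecidableEq F]

/-- The alternating sum `x₁ y₁ - x₂ y₂ + x₃ y₃ - ⋯`. -/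
def altSum : List F → List F → F
  | x :: xs, y :: ys => x * y - altSum xs ys
  | _, _ => 0

theorem altSum_eq_sum (xs : List F) : ∀ ys : List F, xs.length ≤ ys.length →
    altSum xs ys = ∑ i ∈ Finset.range xs.length, (-1) ^ i * (xs.getD i 0 * ys.getD i 0) := by
  induction xs with
  | nil => intro ys _; simp [altSum]
  | cons x xs ih =>
    intro ys h
    cases ys with
    | nil => simp at h
    | cons y ys =>
      rw [altSum, ih ys (by simpa using h), List.length_cons, Finset.sum_range_succ']
      simp only [List.getD_cons_succ, List.getD_cons_zero, pow_zero, one_mul, pow_succ, mul_neg,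
        mul_one, neg_mul, Finset.sum_neg_distrib]
      ring

theorem holds_altDot {as ws : List ℕ} : ∀ {neg : Bool} {acc : ℕ} {mem xs ys : List F} {a : F},
    mem[acc]? = some a → Rep mem as xs → Rep mem ws ys →
    (altDot neg acc (as.zip ws)).Holds mem fun b m t =>
      m[b]? = some (if neg then a - altSum xs ys else a + altSum xs ys) ∧ t ≤ 2 * xs.length := by
  induction as generalizing ws with
  | nil =>
    intro neg acc mem xs ys a ha h _
    cases h
    exact Alg.holds_pure ⟨by simpa [altSum] using ha, le_rfl⟩
  | cons i as ih =>
    intro neg acc mem xs ys a ha h h'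
    cases h with
    | @cons _ x _ xs hx h =>
    cases h' with
    | nil => exact Alg.holds_pure ⟨by simpa [altSum] using ha, Nat.zero_le _⟩
    | @cons _ y _ ys hy h' =>
    rw [List.zip_cons_cons]
    refine (holds_mul hx hy).bind fun t m1 t1 i1 ht => ?_
    have hacc : (exec (if neg then .sub acc t else .add acc t) : Alg F ℕ).Holds m1 fun b m t =>
        m[b]? = some (if neg then a - x * y else a + x * y) ∧ t = 1 := by
      cases neg
      · exact holds_add (getElem?_mono ha i1) ht.1
      · exact holds_sub (getElem?_mono ha i1) ht.1
    refine hacc.bind fun acc' m2 t2 i2 ha' => ?_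
    refine (ih ha'.1 (Rep.mono h (i1.trans i2)) (Rep.mono h' (i1.trans i2))).mono
      fun b m3 t3 _ hb => ⟨?_, ?_⟩
    · rw [hb.1]
      cases neg <;> simp [altSum] <;> ring
    · have := ht.2
      have := ha'.2
      have := hb.2
      simp only [List.length_cons]
      omega

/-- The values that `newton` computes. -/
def newtonList (ys : List F) : ℕ → List F
  | 0 => [1]
  | k + 1 => altSum (newtonList ys k) ys / ((k + 1 : ℕ) : F) :: newtonList ys k

theorem length_newtonList (ys : List F) (k : ℕ) : (newtonList ys k).length = k + 1 := by
  induction k with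
  | zero => rfl
  | succ k ih => simp [newtonList, ih]

theorem holds_newton {ws : List ℕ} {mem ys : List F} (h : Rep mem ws ys) (k : ℕ) :
    (newton ws k).Holds mem fun out m t =>
      Rep m out (newtonList ys k) ∧ t ≤ 1 + k * (2 * k + 5) := by
  induction k with
  | zero =>
    refine (holds_const 1 mem).bind fun a m t _ ha => ?_
    exact Alg.holds_pure ⟨Rep.cons ha.1 Rep.nil, by rw [ha.2]⟩
  | succ k ih =>
    refine ih.bind fun as m1 t1 i1 has => ?_
    refine (holds_const 0 m1).bind fun z m2 t2 i2 hz => ?_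
    refine (holds_altDot hz.1 (has.1.mono i2) (h.mono (i1.trans i2))).bind fun t m3 t3 i3 ht => ?_
    refine (holds_const _ m3).bind fun c m4 t4 i4 hc => ?_
    refine (holds_div (getElem?_mono ht.1 i4) hc.1).bind fun a m5 t5 i5 ha => ?_
    refine Alg.holds_pure ⟨Rep.cons ?_ (has.1.mono (i2.trans (i3.trans (i4.trans i5)))), ?_⟩
    · rw [ha.1]; simp
    · have := has.2
      have := hz.2
      have ht' := ht.2
      have := hc.2
      have := ha.2
      rw [length_newtonList] at ht'
      have e : (k + 1) * (2 * (k + 1) + 5) = k * (2 * k + 5) + 2 * k + (2 * k + 7) := by ring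
      omega

/-- The values that `alternate` computes. -/
def alternateList : List F → List F
  | [] => []
  | x :: xs => (if Even xs.length then x else 0 - x) :: alternateList xs

theorem length_alternateList (xs : List F) : (alternateList xs).length = xs.length := by
  induction xs with
  | nil => rfl
  | cons x xs ih => simp [alternateList, ih]

theorem holds_alternate {l : List ℕ} : ∀ {mem xs : List F}, Rep mem l xs →
    (alternate l).Holds mem fun out m t =>
      Rep m out (alternateList xs) ∧ t ≤ 2 * xs.length := by
  induction l with
  | nil => intro mem xs h; cases h; exact Alg.holds_pure ⟨Rep.nil, le_rfl⟩
  | cons a l ih =>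
    intro mem xs h
    cases h with
    | @cons _ x _ xs hx h =>
    refine (ih h).bind fun bs m1 t1 i1 hbs => ?_
    have hle : l.length = xs.length := h.length_eq
    have ht := hbs.2
    rw [hle, List.length_cons, alternateList]
    split_ifs with he
    · exact Alg.holds_pure ⟨Rep.cons (getElem?_mono hx i1) hbs.1, by omega⟩
    · refine (holds_const 0 m1).bind fun z m2 t2 i2 hz => ?_
      refine (holds_sub hz.1 (getElem?_mono hx (i1.trans i2))).bind fun b m3 t3 i3 hb => ?_
      refine Alg.holds_pure ⟨Rep.cons hb.1 (hbs.1.mono (i2.trans i3)), ?_⟩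
      have := hz.2
      have := hb.2
      omega

variable {s : ℕ}

/-- Newton's identities determine the elementary symmetric polynomials one by one, because 1, ..., s
are invertible. The list runs from the last one down, so that zipping it with the power sums pairs
e_(k-i) with w_(i+1). -/
theorem newtonList_eq_esymm {x : Fin s → F} {ys : List F}
    (hys : ys = List.ofFn fun j : Fin s => ∑ i, x i ^ ((j : ℕ) + 1))
    (hchar : ∀ k, 0 < k → k ≤ s → (k : F) ≠ 0) {k : ℕ} (hk : k ≤ s) :
    newtonList ys k = (List.range (k + 1)).reverse.map fun j =>
      MvPolynomial.aeval x (MvPolynomial.esymm (Fin s) F j) := by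
  induction k with
  | zero => simp [newtonList]
  | succ k ih =>
    have ih := ih (by omega)
    rw [List.range_succ, List.reverse_append, List.reverse_singleton, List.singleton_append,
      List.map_cons, ← ih, newtonList]
    congr 1
    have hk0 : ((k + 1 : ℕ) : F) ≠ 0 := hchar _ (by omega) hk
    have hN := congrArg (MvPolynomial.aeval x) (MvPolynomial.mul_esymm_eq_sum (Fin s) F (k + 1))
    rw [div_eq_iff hk0, mul_comm _ ((k + 1 : ℕ) : F)]
    simp only [map_mul, map_natCast, map_sum, map_pow, map_neg, map_one] at hN
    rw [hN, altSum_eq_sum _ _ (by rw [length_newtonList, hys, List.length_ofFn]; omega),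
      length_newtonList, ih, Finset.sum_filter, Finset.Nat.sum_antidiagonal_eq_sum_range_succ_mk,
      Finset.sum_range_succ _ (k + 1), if_neg (lt_irrefl _), add_zero, ← Finset.sum_range_reflect,
      Finset.mul_sum]
    refine Finset.sum_congr rfl fun j hj => ?_
    have hj : j < k + 1 := Finset.mem_range.1 hj
    obtain ⟨m, rfl⟩ : ∃ m, k = j + m := ⟨k - j, by omega⟩
    have e1 : j + m + 1 - 1 - j = m := by omega
    have e2 : j + m + 1 - j = m + 1 := by omega
    have e4 : j + m + 1 - 1 - m = j := by omega
    simp only [e1, e2]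
    rw [if_pos (by omega), List.getD_eq_getElem _ _ (by simp),
      List.getD_eq_getElem _ _ (by rw [hys, List.length_ofFn]; omega)]
    simp only [hys, List.getElem_map, List.getElem_reverse, List.getElem_range, List.getElem_ofFn,
      List.length_range, e4, MvPolynomial.psum, map_sum, map_pow, MvPolynomial.aeval_X]
    have e3 : (-1 : F) ^ (j + m + 1 + 1) * (-1) ^ j = (-1) ^ m := by
      rw [← pow_add, show j + m + 1 + 1 + j = m + 2 * (j + 1) by ring, pow_add, pow_mul]; simp
    rw [← e3]; ring

theorem toPoly_alternateList_esymm (e : ℕ → F) (k : ℕ) :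
    toPoly (alternateList ((List.range (k + 1)).reverse.map e)) =
      ∑ j ∈ Finset.range (k + 1), (-1) ^ j * (C (e j) * X ^ (k - j)) := by
  induction k with
  | zero => simp [alternateList, toPoly]
  | succ k ih =>
    rw [List.range_succ, List.reverse_append, List.reverse_singleton, List.singleton_append,
      List.map_cons, alternateList, toPoly, ih, Finset.sum_range_succ _ (k + 1), Finset.mul_sum,
      add_comm]
    congr 1
    · refine Finset.sum_congr rfl fun j hj => ?_
      have : k + 1 - j = k - j + 1 := by have := Finset.mem_range.1 hj; omega
      rw [this, pow_succ]; ring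
    · simp only [List.length_map, List.length_reverse, List.length_range, Nat.sub_self, pow_zero,
        mul_one]
      split_ifs with h
      · rw [h.neg_one_pow, one_mul]
      · rw [(Nat.not_even_iff_odd.1 h).neg_one_pow]; simp

end Newton

/-! ### Recovery of the index set from its power sums, with the cost -/

section Reconstruction

open Polynomial

section Field

variable {F : Type} [Field F] [Fintype F] [DecidableEq F]

theorem exists_toPoly_dropWhile (xs : List F) : ∃ k,
    toPoly xs = X ^ k * toPoly (xs.dropWhile (· = 0)) ∧
      k + (xs.dropWhile (· = 0)).length = xs.length ∧
      (toPoly xs ≠ 0 → (toPoly (xs.dropWhile (· = 0))).eval 0 ≠ 0) := by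
  induction xs with
  | nil => exact ⟨0, by simp [toPoly]⟩
  | cons x xs ih =>
    by_cases hx : x = 0
    · obtain ⟨k, h1, h2, h3⟩ := ih
      rw [List.dropWhile_cons_of_pos (by simpa using hx)]
      refine ⟨k + 1, ?_, by rw [List.length_cons]; omega, fun h => h3 ?_⟩
      · rw [toPoly, hx, C_0, zero_add, pow_succ', mul_assoc, ← h1]
      · rintro h0
        exact h (by rw [toPoly, hx, C_0, h0, mul_zero, add_zero])
    · rw [List.dropWhile_cons_of_neg (by simpa using hx)]
      exact ⟨0, by simp, by simp, fun _ => by simpa [toPoly] using hx⟩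

theorem X_pow_mul_eq_X_pow_mul {P Q : F[X]} (hP : P.eval 0 ≠ 0) (hQ : Q.eval 0 ≠ 0) {k m : ℕ}
    (h : X ^ k * P = X ^ m * Q) : k = m ∧ P = Q := by
  have key : ∀ {P Q : F[X]}, P.eval 0 ≠ 0 → ∀ {k m : ℕ}, X ^ k * P = X ^ m * Q → m ≤ k := by
    intro P Q hP k m h
    by_contra hlt
    obtain ⟨j, rfl⟩ : ∃ j, m = k + (j + 1) := ⟨m - k - 1, by omega⟩
    rw [pow_add, mul_assoc] at h
    rw [mul_left_cancel₀ (pow_ne_zero _ X_ne_zero) h] at hP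
    simp at hP
  obtain rfl := le_antisymm (key hQ h.symm) (key hP h)
  exact ⟨rfl, mul_left_cancel₀ (pow_ne_zero _ X_ne_zero) h⟩

/-- All exponents are positive, so padding A by zeros to s numbers keeps the power sums. Vieta's
formulas for the padded multiset give the polynomial, and the padding is the factor X^(s-|A|). -/
theorem toPoly_alternateList_newtonList {s : ℕ} (hchar : ∀ k, 0 < k → k ≤ s → (k : F) ≠ 0)
    {A : Finset F} (hA : A.card ≤ s) :
    toPoly (alternateList (newtonList (List.ofFn fun j : Fin s => ∑ α ∈ A, α ^ ((j : ℕ) + 1)) s)) =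
      X ^ (s - A.card) * ∏ α ∈ A, (X - C α) := by
  obtain ⟨M, hM⟩ : ∃ M, M = A.val + Multiset.replicate (s - A.card) (0 : F) := ⟨_, rfl⟩
  have hMs : M.card = s := by
    rw [hM, Multiset.card_add, Multiset.card_replicate, Finset.card_val]; omega
  obtain ⟨x, hx⟩ : ∃ x : Fin s → F, Finset.univ.val.map x = M := by
    obtain ⟨l, rfl⟩ := Quot.exists_rep M
    have hl : l.length = s := hMs
    subst hl
    exact ⟨l.get, by rw [Fin.univ_val_map, List.ofFn_get]; rfl⟩
  have hsum : ∀ j : Fin s, ∑ α ∈ A, α ^ ((j : ℕ) + 1) = ∑ i, x i ^ ((j : ℕ) + 1) := by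
    intro j
    have h := congrArg (fun N : Multiset F => (N.map fun α => α ^ ((j : ℕ) + 1)).sum) (hx.trans hM)
    simp only [Multiset.map_map, Multiset.map_add, Multiset.sum_add, Multiset.map_replicate,
      Multiset.sum_replicate] at h
    rw [zero_pow (by omega), smul_zero, add_zero] at h
    exact h.symm
  simp only [hsum]
  rw [newtonList_eq_esymm rfl hchar le_rfl, toPoly_alternateList_esymm]
  simp only [MvPolynomial.aeval_esymm_eq_multiset_esymm, hx]
  have hv := Multiset.prod_X_sub_X_eq_sum_esymm M
  rw [hMs] at hv
  rw [← hv, hM, Multiset.map_add, Multiset.prod_add, Multiset.map_replicate, Multiset.prod_replicate,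
    C_0, sub_zero, mul_comm]
  rfl

end Field

variable {p : ℕ} [Fact p.Prime]

theorem rep_range {F : Type} (ys : List F) : Rep ys (List.range ys.length) ys := by
  rw [Rep, List.forall₂_iff_get]
  refine ⟨by simp, fun i h1 h2 => ?_⟩
  simp

theorem Alg.holds_of_support {F α : Type} [Field F] [Fintype F] [DecidableEq F] {P : Alg F α} :
    ∀ {mem : List F} {Q : α → List F → ℕ → Prop},
    (∀ r ∈ (P.run mem).support, Q r.result r.memory r.operations) → P.Holds mem Q := by
  induction P with
  | pure a => intro mem Q h; exact h ⟨a, mem, 0⟩ (by simp [run])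
  | instr I k ih =>
    intro mem Q h x hx
    refine ih _ fun r hr => h r.tick ?_
    simp only [run, PMF.mem_support_bind_iff, PMF.mem_support_map_iff]
    exact ⟨x, hx, r, hr, rfl⟩
  | isZero i k ih =>
    intro mem Q h
    refine ih _ fun r hr => h r.tick ?_
    simp only [run, PMF.mem_support_map_iff]
    exact ⟨r, hr, rfl⟩

/-- The list of power sums of the elements of `A`. -/
def powerSums (s : ℕ) (A : Finset (ZMod p)) : List (ZMod p) :=
  List.ofFn fun j : Fin s => ∑ α ∈ A, α ^ ((j : ℕ) + 1)

/-- Since 0 ∉ A, removing the factors X removes exactly the padding. -/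
theorem strip_newtonList {s : ℕ} (hs : s < p) {A : Finset (ZMod p)} (h0 : 0 ∉ A)
    (hA : A.card ≤ s) {gs : List (ZMod p)}
    (hgs : gs = (alternateList (newtonList (powerSums s A) s)).dropWhile (· = 0)) :
    toPoly gs = ∏ α ∈ A, (X - C α) ∧ Reduced gs ∧ gs.length = A.card + 1 := by
  have hchar : ∀ k, 0 < k → k ≤ s → ((k : ℕ) : ZMod p) ≠ 0 := by
    intro k hk hks h
    rw [ZMod.natCast_eq_zero_iff] at h
    exact absurd (Nat.le_of_dvd hk h) (by omega)
  have hpoly := toPoly_alternateList_newtonList hchar hA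
  obtain ⟨k, h1, h2, h3⟩ := exists_toPoly_dropWhile (alternateList (newtonList (powerSums s A) s))
  rw [← hgs] at h1 h2 h3
  have hP0 : (∏ α ∈ A, (X - C α)).eval 0 ≠ 0 := by
    rw [eval_prod, Finset.prod_ne_zero_iff]
    intro α hα
    rw [eval_sub, eval_X, eval_C, zero_sub, neg_ne_zero]
    rintro rfl; exact h0 hα
  have hprod : (∏ α ∈ A, (X - C α)) ≠ 0 := by intro h; rw [h] at hP0; simp at hP0
  have hg0 := h3 (by rw [powerSums, hpoly]; exact mul_ne_zero (pow_ne_zero _ X_ne_zero) hprod)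
  obtain ⟨hk, hg⟩ := X_pow_mul_eq_X_pow_mul hg0 hP0 (h1.symm.trans hpoly)
  rw [length_alternateList, length_newtonList] at h2
  have hlen : gs.length = A.card + 1 := by omega
  refine ⟨hg, ⟨hg0, ?_⟩, hlen⟩
  rw [hg, natDegree_prod_of_monic _ _ fun α _ => monic_X_sub_C α, hlen]
  simp

theorem eval_prod_X_sub_C_eq_zero_iff {A : Finset (ZMod p)} {x : ZMod p} :
    (∏ α ∈ A, (X - C α)).eval x = 0 ↔ x ∈ A := by
  rw [eval_prod, Finset.prod_eq_zero_iff]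
  simp [sub_eq_zero]

theorem holds_reconstIdx {find : List ℕ → Alg (ZMod p) (List ℕ)} (hfind : IsZeroFinder find) {s : ℕ}
    (hs : s < p) {A : Finset (ZMod p)} (h0 : 0 ∉ A) (hA : A.card ≤ s) :
    (reconstIdx find s).Holds (powerSums s A) fun out m _ =>
      ∀ x, x ∈ out.map (lookup m) ↔ x ∈ A := by
  have hr : Rep (powerSums s A) (List.range s) (powerSums s A) := by
    have := rep_range (powerSums s A)
    rwa [show (powerSums s A).length = s by simp [powerSums]] at this
  refine (holds_newton hr s).bind fun as m1 t1 i1 has => ?_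
  refine (holds_alternate has.1).bind fun f m2 t2 i2 hf => ?_
  refine (holds_stripX hf.1).bind fun g m3 t3 i3 hg => ?_
  obtain ⟨hgp, hgr, -⟩ := strip_newtonList hs h0 hA rfl
  have hpoly := polyAt_eq_toPoly hg.1
  refine (Alg.holds_of_support (Q := fun (out : List ℕ) m _ => ∀ x, x ∈ out.map (lookup m) ↔ x ∈ A)
    fun r hr x => ?_)
  rw [(hfind m3 g hg.1.lt_length (by
    rw [hpoly]; intro h; have := hgr.1; rw [h] at this; simp at this) r hr).2 x, hpoly, hgp,
    IsRoot.def, eval_prod_X_sub_C_eq_zero_iff]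

theorem ecost_reconstIdx_le {find : List ℕ → Alg (ZMod p) (List ℕ)} {K : ℝ} (hK : 0 ≤ K)
    (hfind : HasRootCost K find) {s : ℕ} (hs0 : 0 < s) (hs : s < p) {A : Finset (ZMod p)}
    (h0 : 0 ∉ A) (hA : A.card ≤ s) :
    (reconstIdx find s).ecost (powerSums s A) ≤ ENNReal.ofReal ((2 * K + 14) * ((s : ℝ) ^ 2 +
      s * Real.log s ^ 2 * (Real.log s + Real.log p))) := by
  have hr : Rep (powerSums s A) (List.range s) (powerSums s A) := by
    have := rep_range (powerSums s A)
    rwa [show (powerSums s A).length = s by simp [powerSums]] at this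
  have l1 := Real.log_natCast_nonneg s
  have l2 := Real.log_natCast_nonneg p
  set W : ℝ := K * (1 + (s : ℝ) ^ 2 + s * Real.log s ^ 2 * Real.log p) with hW
  have hW0 : 0 ≤ W := by positivity
  -- Without W this is 2s² + 8s + 4 ≤ 14 s²; the summand 1 inside W is absorbed by doubling K.
  refine le_trans (b := ENNReal.ofReal (1 + s * (2 * s + 5) + (2 * (s + 1) + ((s + 1) + W)))) ?_
    (ENNReal.ofReal_le_ofReal ?_)
  · refine Alg.ecost_bind_le_of_holds (by positivity) (by positivity) ((holds_newton hr s).mono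
      fun as m1 t1 i1 has => ⟨by exact_mod_cast has.2, ?_⟩)
    refine Alg.ecost_bind_le_of_holds (by positivity) (by positivity) ((holds_alternate has.1).mono
      fun f m2 t2 i2 hf => ⟨?_, ?_⟩)
    · have := hf.2
      rw [length_newtonList] at this
      exact_mod_cast this
    refine Alg.ecost_bind_le_of_holds (by positivity) (by positivity) ((holds_stripX hf.1).mono
      fun g m3 t3 i3 hg => ⟨?_, ?_⟩)
    · have := hg.2
      rw [length_alternateList, length_newtonList] at this
      exact_mod_cast this
    obtain ⟨hgp, hgr, hgl⟩ := strip_newtonList hs h0 hA rfl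
    refine (hfind hg.1 hgr hgl rfl fun α hα => ?_).trans (ENNReal.ofReal_le_ofReal ?_)
    · rw [hgp]; exact eval_prod_X_sub_C_eq_zero_iff.2 hα
    · have e1 : (A.card : ℝ) ≤ s := by exact_mod_cast hA
      have e2 : Real.log A.card ≤ Real.log s := by
        rcases Nat.eq_zero_or_pos A.card with h | h
        · rw [h]; simpa using l1
        · exact Real.log_le_log (by exact_mod_cast h) e1
      have e3 := Real.log_natCast_nonneg A.card
      rw [hW]
      gcongr
  · have e1 : (1 : ℝ) ≤ s := by exact_mod_cast hs0
    have e2 : 0 ≤ (s : ℝ) * Real.log s ^ 2 * Real.log s := by positivity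
    have e3 : 0 ≤ (s : ℝ) * Real.log s ^ 2 * Real.log p := by positivity
    have e4 : (s : ℝ) ≤ s ^ 2 := by nlinarith
    have e5 : K ≤ K * s ^ 2 := by nlinarith
    have e6 : 0 ≤ K * ((s : ℝ) * Real.log s ^ 2 * Real.log s) := mul_nonneg hK e2
    have e7 : 0 ≤ K * ((s : ℝ) * Real.log s ^ 2 * Real.log p) := mul_nonneg hK e3
    rw [hW]
    nlinarith

end Reconstruction

/-! ### The compression scheme -/

section Compression

namespace Circuit

variable {M : Type} {n : ℕ}

theorem gates_sum_le [Zero M] (l : List (Circuit M n)) :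
    (sum l).gates ≤ (l.map fun c => c.gates + 1).sum := by
  induction l with
  | nil => simp [sum, gates]
  | cons a l ih =>
    cases l with
    | nil => simp [sum]
    | cons b l =>
      rw [List.map_cons, List.sum_cons, sum, gates]
      omega

theorem value_sum [CommRing M] (x : Fin n → M) (l : List (Circuit M n)) :
    (sum l).value x = (l.map (value x)).sum := by
  induction l with
  | nil => simp [sum, value]
  | cons a l ih =>
    cases l with
    | nil => simp [sum]
    | cons b l => rw [List.map_cons, List.sum_cons, ← ih, sum, value]

theorem value_matrixRow [CommRing M] {m : ℕ} (A : Matrix (Fin m) (Fin n) M) (j : Fin m)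
    (x : Fin n → M) : (matrixRow A j).value x = ∑ i, A j i * x i := by
  rw [matrixRow, value_sum, List.map_ofFn, List.sum_ofFn]
  rfl

theorem gates_matrixRow_le [Zero M] {m : ℕ} (A : Matrix (Fin m) (Fin n) M) (j : Fin m) :
    (matrixRow A j).gates ≤ 2 * n := by
  refine (gates_sum_le _).trans ?_
  rw [List.map_ofFn, List.sum_ofFn]
  simp [gates, mul_comm]

end Circuit

theorem compIdxCost_le (p N s : ℕ) : compIdxCost p N s ≤ 2 * (N * s) := by
  refine (Finset.sum_le_sum fun j _ => Circuit.gates_matrixRow_le _ j).trans ?_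
  rw [Finset.sum_const, Finset.card_univ, Fintype.card_fin, smul_eq_mul]
  exact le_of_eq (by ring)

theorem decryptAll_eq {C M : Type*} (dec : C → M) (l : List C) :
    decryptAll dec l = (l.map dec, l.length) := by
  induction l with
  | nil => rfl
  | cons c l ih => simp [decryptAll, ih]

theorem map_eq_pure_of_forall_support {α β : Type*} {P : PMF α} {f : α → β} {b : β}
    (h : ∀ a ∈ P.support, f a = b) : P.map f = PMF.pure b := by
  calc P.map f = P.bind fun _ => PMF.pure b := by
        refine PMF.ext fun c => ?_
        rw [PMF.map, PMF.bind_apply, PMF.bind_apply]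
        refine tsum_congr fun a => ?_
        by_cases ha : a ∈ P.support
        · rw [Function.comp, h a ha]
        · rw [PMF.mem_support_iff, not_not] at ha
          rw [ha, zero_mul, zero_mul]
    _ = PMF.pure b := PMF.bind_const _ _

variable {p : ℕ} [Fact p.Prime]

/-- The set of the positions of the non-zero entries of a vector, as elements of `ℤ/p`. -/
def indexElements {N : ℕ} (v : Fin N → ZMod p) : Finset (ZMod p) :=
  (Finset.univ.filter fun i => v i ≠ 0).image fun i : Fin N => (((i : ℕ) + 1 : ℕ) : ZMod p)

theorem injective_natCast_add_one {N : ℕ} (hN : N < p) :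
    Function.Injective fun i : Fin N => (((i : ℕ) + 1 : ℕ) : ZMod p) := by
  intro i j h
  have h' := (ZMod.natCast_eq_natCast_iff' _ _ _).1 h
  rw [Nat.mod_eq_of_lt (by omega), Nat.mod_eq_of_lt (by omega)] at h'
  exact Fin.ext (by omega)

theorem mem_indexElements {N : ℕ} (hN : N < p) {v : Fin N → ZMod p} {i : Fin N} :
    (((i : ℕ) + 1 : ℕ) : ZMod p) ∈ indexElements v ↔ v i ≠ 0 := by
  rw [indexElements]
  rw [show (((i : ℕ) + 1 : ℕ) : ZMod p) = (fun i : Fin N => (((i : ℕ) + 1 : ℕ) : ZMod p)) i from rfl,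
    (injective_natCast_add_one hN).mem_finset_image]
  simp

theorem zero_notMem_indexElements {N : ℕ} (hN : N < p) (v : Fin N → ZMod p) :
    0 ∉ indexElements v := by
  intro h
  obtain ⟨i, -, hi⟩ := Finset.mem_image.1 h
  rw [ZMod.natCast_eq_zero_iff] at hi
  exact absurd (Nat.le_of_dvd (by omega) hi) (by omega)

theorem card_indexElements_le {N s : ℕ} {v : Fin N → ZMod p} (hv : IsSparse s v) :
    (indexElements v).card ≤ s := by
  refine Finset.card_image_le.trans (le_trans (le_of_eq ?_) hv)
  rw [← Set.ncard_coe_finset]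
  congr 1
  ext i
  simp [indexSet]

/-- For entries 0 and 1 the matrix product is a power sum of the positions, which are distinct
modulo p. -/
theorem sum_powerMatrix_mul {N s : ℕ} (hN : N < p) {v : Fin N → ZMod p} (hv : IsIndexVector v)
    (j : Fin s) :
    ∑ i, powerMatrix p N s j i * v i = ∑ α ∈ indexElements v, α ^ ((j : ℕ) + 1) := by
  rw [indexElements, Finset.sum_image fun _ _ _ _ h => injective_natCast_add_one hN h,
    Finset.sum_filter]
  refine Finset.sum_congr rfl fun i _ => ?_
  rcases hv i with h | h <;> simp [powerMatrix, h]

theorem indexVectorOf_eq {N : ℕ} (hN : N < p) {v : Fin N → ZMod p} (hv : IsIndexVector v)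
    {zeros : List (ZMod p)} (h : ∀ x, x ∈ zeros ↔ x ∈ indexElements v) :
    indexVectorOf N zeros = v := by
  funext i
  rw [indexVectorOf]
  simp only [h, mem_indexElements hN]
  rcases hv i with h | h <;> simp [h]

theorem map_dec_compIdx {E : HEScheme.{u} (ZMod p)} {N s : ℕ} (hN : N < p)
    (hE : ∀ j : Fin s, E.Supports (Circuit.matrixRow (powerMatrix p N s) j))
    {pk : E.PublicKey} {sk : E.SecretKey} (hk : (pk, sk) ∈ E.keyGen.support) {v : Fin N → ZMod p}
    (hv : IsIndexVector v) {c : Fin N → E.Ciphertext} (hc : E.IsEncryption pk v c) :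
    decryptAll (E.dec sk) (List.ofFn (compIdx E N s pk c)) = (powerSums s (indexElements v), s) := by
  rw [decryptAll_eq, List.length_ofFn, List.map_ofFn, powerSums]
  congr 2
  funext j
  simp only [Function.comp, compIdx]
  rw [E.dec_eval pk sk hk N _ (hE j) v c hc, Circuit.value_matrixRow, sum_powerMatrix_mul hN hv]

theorem expectedOperations_map {P : PMF (Outcome (ZMod p) (List ℕ))}
    {f : Outcome (ZMod p) (List ℕ) → Step1Outcome p} (hf : ∀ r, (f r).operations = r.operations) :
    expectedOperations (P.map f) = ∑' r, P r * (r.operations : ℝ≥0∞) := by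
  rw [expectedOperations, Alg.tsum_map_mul]
  simp only [hf]

end Compression

end HomComp

/-! ### Assembly -/

theorem mainTheorem1 :
    ∃ (K : ℝ) (findZeros : ∀ p : ℕ, List ℕ → HomComp.Alg (ZMod p) (List ℕ)),
      (∀ (p : ℕ) [Fact p.Prime], HomComp.IsZeroFinder (findZeros p)) ∧
      ∀ (p N s : ℕ) [Fact p.Prime], N < p → 0 < s → s < p →
        ((HomComp.compIdxCost p N s : ℕ) : ℝ) ≤ K * ((N : ℝ) * (s : ℝ)) ∧
        ∀ E : HomComp.HEScheme.{u} (ZMod p),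
          (∀ j : Fin s,
            E.Supports (HomComp.Circuit.matrixRow (HomComp.powerMatrix p N s) j)) →
          HomComp.IsHomCompression E N s (HomComp.sparseIndexVectors p N s)
            (HomComp.compIdx E N s) (HomComp.decompIdx E N s (findZeros p)) ∧
          ∀ pk sk, (pk, sk) ∈ E.keyGen.support →
            ∀ v ∈ HomComp.sparseIndexVectors p N s, ∀ c : Fin N → E.Ciphertext,
              E.IsEncryption pk v c →
              (∀ r ∈ (HomComp.decompIdxStep1 E s (findZeros p) sk
                  (HomComp.compIdx E N s pk c)).support, r.decryptions = s) ∧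
              HomComp.expectedOperations (HomComp.decompIdxStep1 E s (findZeros p) sk
                  (HomComp.compIdx E N s pk c)) ≤
                ENNReal.ofReal (K * ((s : ℝ) ^ 2 +
                  (s : ℝ) * Real.log s ^ 2 * (Real.log s + Real.log p))) := by
  classical
  choose find hfind hcost using fun (p : ℕ) (h : Fact p.Prime) => HomComp.exists_isZeroFinder (p := p)
  -- K comes from the bound for the reconstruction; for p not prime the procedure is an arbitrary
  -- default.
  refine ⟨2 * 10000000 + 14, fun p => if h : p.Prime then find p ⟨h⟩ else fun _ => pure [],
    fun p hp => ?_, fun p N s hp hN hs0 hs => ⟨?_, fun E hE => ?_⟩⟩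
  · beta_reduce
    rw [dif_pos hp.out]
    exact hfind p hp
  · have h : ((HomComp.compIdxCost p N s : ℕ) : ℝ) ≤ 2 * (N * s) := by
      exact_mod_cast HomComp.compIdxCost_le p N s
    have : (0 : ℝ) ≤ N * s := by positivity
    linarith
  beta_reduce
  rw [dif_pos hp.out]
  have hA := fun {v : Fin N → ZMod p} (hv : v ∈ HomComp.sparseIndexVectors p N s) =>
    HomComp.card_indexElements_le hv.2
  refine ⟨fun pk sk hk v hv c hc => ?_, fun pk sk hk v hv c hc => ⟨fun r hr => ?_, ?_⟩⟩
  · refine HomComp.map_eq_pure_of_forall_support fun r hr => ?_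
    rw [HomComp.decompIdxStep1, HomComp.map_dec_compIdx hN hE hk hv.1 hc,
      PMF.mem_support_map_iff] at hr
    obtain ⟨r', hr', rfl⟩ := hr
    exact HomComp.indexVectorOf_eq hN hv.1 ((HomComp.holds_reconstIdx (hfind p hp) hs
      (HomComp.zero_notMem_indexElements hN v) (hA hv)).of_mem_support r' hr')
  · rw [HomComp.decompIdxStep1, HomComp.map_dec_compIdx hN hE hk hv.1 hc,
      PMF.mem_support_map_iff] at hr
    obtain ⟨r', -, rfl⟩ := hr
    rfl
  · rw [HomComp.decompIdxStep1, HomComp.map_dec_compIdx hN hE hk hv.1 hc,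
      HomComp.expectedOperations_map fun r => rfl, HomComp.Alg.tsum_run_operations]
    exact HomComp.ecost_reconstIdx_le (by norm_num) (hcost p hp) hs0 hs
      (HomComp.zero_notMem_indexElements hN v) (hA hv)
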